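/- Let $(\mathcal K,[\cdot,\cdot])$ be a Krein space and let $N$ be a bounded linear normal operator on $\mathcal K$ (that is, $NN^*=N^*N$ for the Krein space adjoint) with real part $A=\frac{N+N^*}{2}$ and imaginary part $B=\frac{N-N^*}{2i}$. Assume that $N$ is definitizable, and fix nonzero real polynomials $p,q$ with $[p(A)x,x]\ge 0$ and $[q(B)x,x]\ge 0$ for all $x\in\mathcal K$. Let $\mathcal V,\mathcal V_1,\mathcal V_2$ be the Hilbert space completions of $\mathcal K$ modulo the respective kernels with respect to $[(p(A)+q(B))\cdot,\cdot]$, $[p(A)\cdot,\cdot]$, $[q(B)\cdot,\cdot]$, and let $T,T_1,T_2$ be the (injective) adjoints of the canonical maps of $\mathcal K$ into $\mathcal V,\mathcal V_1,\mathcal V_2$, so that $TT^*=p(A)+q(B)$, $T_1T_1^*=p(A)$, $T_2T_2^*=q(B)$. Let $R_j:\mathcal V_j\to\mathcal V$ be the contractions with $T_j=TR_j$, put $\Theta(N)=T^{-1}NT$, a bounded normal operator on $\mathcal V$, and let $E$ be its spectral measure. For $\xi\in\mathbb C$ let $\mathfrak d_p(\xi)$, $\mathfrak d_q(\xi)$ be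 the orders of $\xi$ as a zero of $p$, $q$. Put $Z=\{z\in\mathbb C: p(\operatorname{Re} z)=0=q(\operatorname{Im} z)\}$ and $Z^i=(p^{-1}\{0\}\times q^{-1}\{0\})\setminus(\mathbb R\times\mathbb R)$. Let $\mathcal M_N$ be the set of functions $\phi$ on the disjoint union $(\sigma(\Theta(N))\cup Z)\,\dot\cup\, Z^i$ whose values are families $\phi(z)=(\phi(z)_{k,l})$ of complex numbers indexed as follows: * by $\{(0,0)\}$ if $z\in\sigma(\Theta(N))\setminus Z$; * by $\{0,\dots,m-1\}\times\{0,\dots,n-1\}\cup\{(m,0),(0,n)\}$ with $m=\mathfrak d_p(\operatorname{Re} z)$, $n=\mathfrak d_q(\operatorname{Im} z)$ if $z\in Z$; * by $\{0,\dots,\mathfrak d_p(\xi)-1\}\times\{0,\dots,\mathfrak d_q(\eta)-1\}$ if $z=(\xi,\eta)\in Z^i$. Let $\mathcal F_N$ be the set of all $\phi\in\mathcal M_N$ that are bounded and Borel measurable on $\sigma(\Theta(N))\setminus Z$ and such that for every $w\in\sigma(\Theta(N))\cap Z$, with $m=\mathfrak d_p(\operatorname{Re} w)$ and $n=\mathfrak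 d_q(\operatorname{Im} w)$, the quotient $$\frac{\phi(z)-\sum_{k=0}^{m-1}\sum_{l=0}^{n-1}\phi(w)_{k,l}\operatorname{Re}(z-w)^k\operatorname{Im}(z-w)^l}{\max\big(|\operatorname{Re}(z-w)|^{m},|\operatorname{Im}(z-w)|^{n}\big)}$$ is bounded for $z\in\sigma(\Theta(N))\setminus\{w\}$ in some neighbourhood of $w$. A polynomial $s\in\mathbb C[z,w]$ defines $s_N\in\mathcal M_N$, whose entries are the Taylor coefficients $\frac1{k!\,l!}\partial_z^k\partial_w^l s$ at $(\operatorname{Re} z,\operatorname{Im} z)$ for $z \in \sigma(\Theta(N))\cup Z$, respectively at $(\xi,\eta)\in Z^i$. For $\phi\in\mathcal F_N$ put $$\phi(N)=s(A,B)+T\Big(\int_{\sigma(\Theta(N))\setminus Z} g\,dE+\sum_{w\in\sigma(\Theta(N))\cap Z}\big(g_1(w)R_1R_1^*E\{w\}+g_2(w)R_2R_2^*E\{w\}\big)\Big)T^*,$$ where $s\in\mathbb C[z,w]$ and $g$ (complex valued, bounded and measurable on $\sigma(\Theta(N))\setminus Z$; with values $(g_1,g_2)\in\mathbb C^2$ on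 $\sigma(\Theta(N))\cap Z$) satisfy the following conditions: * the entries of $\phi-s_N$ with $k<m$, $l<n$ vanish at all points of $Z\,\dot\cup\,Z^i$, where $(m,n)$ are the orders of the zeros of $p,q$ at the point; * $\phi(z)=s_N(z)+(p(\operatorname{Re} z)+q(\operatorname{Im} z))\,g(z)$ for $z\in\sigma(\Theta(N))\setminus Z$; * for $z\in\sigma(\Theta(N))\cap Z$ the entries of $\phi(z)-s_N(z)$ with indices $(m,0)$ and $(0,n)$ are $\frac{p^{(m)}(\operatorname{Re} z)}{m!}g_1(z)$ and $\frac{q^{(n)}(\operatorname{Im} z)}{n!}g_2(z)$. Finally let $$\sigma_N=\big(\sigma(\Theta(N))\cup(Z\cap\sigma(N))\big)\,\dot\cup\,\{(\alpha,\beta)\in Z^i:\ \alpha+i\beta,\ \bar\alpha+i\bar\beta\in\sigma(N)\}.$$ Then for every $\phi\in\mathcal F_N$ such $s$ and $g$ exist, and for every choice of them the resulting operator $\phi(N)$ satisfies $$\sigma(\phi(N))\subseteq\overline{\{\phi(z)_{0,0}:\ z\in\sigma_N\}}.$$ -/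

import Mathlib

open scoped ComplexOrder InnerProductSpace
open MeasureTheory UniformSpace

noncomputable section

/-! ### Krein spaces and operators on them -/

/-- A Krein space, presented as a Hilbert space together with a fundamental symmetry `J`
(`J = J*`, `J² = 1`). The Krein space form is `[x, y] = (J x, y)`. -/
class KreinSpace (K : Type*) [NormedAddCommGroup K] [InnerProductSpace ℂ K]
    [CompleteSpace K] where
  /-- The fundamental symmetry. -/
  J : K →L[ℂ] K
  isSelfAdjoint_J : IsSelfAdjoint J
  J_mul_J : J * J = 1

section Krein

variable {K : Type*} [NormedAddCommGroup K] [InnerProductSpace ℂ K] [CompleteSpace K]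
  [KreinSpace K]

/-- The indefinite inner product `[x, y]`, linear in `x` and conjugate linear in `y`
(the inner product of Mathlib is conjugate linear in its first argument). -/
def kreinForm (x y : K) : ℂ := ⟪y, (KreinSpace.J : K →L[ℂ] K) x⟫_ℂ

/-- The adjoint of a bounded operator with respect to the indefinite inner product. -/
def kreinAdjoint (C : K →L[ℂ] K) : K →L[ℂ] K := KreinSpace.J * star C * KreinSpace.J

theorem J_J_apply (x : K) :
    (KreinSpace.J : K →L[ℂ] K) ((KreinSpace.J : K →L[ℂ] K) x) = x := by
  have h := congrArg (fun f : K →L[ℂ] K => f x) (KreinSpace.J_mul_J (K := K))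
  simpa using h

theorem inner_J_left (x y : K) :
    ⟪(KreinSpace.J : K →L[ℂ] K) x, y⟫_ℂ = ⟪x, (KreinSpace.J : K →L[ℂ] K) y⟫_ℂ :=
  (KreinSpace.isSelfAdjoint_J (K := K)).isSymmetric x y

theorem kreinForm_kreinAdjoint (C : K →L[ℂ] K) (x y : K) :
    kreinForm (C x) y = kreinForm x (kreinAdjoint C y) := by
  simp only [kreinForm, kreinAdjoint, mul_apply_eq_comp,
    ContinuousLinearMap.star_eq_adjoint]
  rw [inner_J_left, J_J_apply, ContinuousLinearMap.adjoint_inner_left, inner_J_left]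

/-- `[G x, x] ≥ 0` for all `x`. -/
def KreinNonneg (G : K →L[ℂ] K) : Prop := ∀ x, 0 ≤ kreinForm (G x) x

theorem KreinNonneg.isPositive {G : K →L[ℂ] K} (hG : KreinNonneg G) :
    (KreinSpace.J * G : K →L[ℂ] K).IsPositive := by
  rw [ContinuousLinearMap.isPositive_iff_complex]
  intro x
  have h := hG x
  have h2 : ⟪(KreinSpace.J * G : K →L[ℂ] K) x, x⟫_ℂ = kreinForm (G x) x := by
    rw [← inner_conj_symm]
    exact Complex.conj_eq_iff_im.2 (Complex.nonneg_iff.1 h).2.symm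
  rw [h2]
  exact ⟨Complex.conj_eq_iff_re.1 (Complex.conj_eq_iff_im.2 (Complex.nonneg_iff.1 h).2.symm),
    (Complex.nonneg_iff.1 h).1⟩

theorem KreinNonneg.add {G H : K →L[ℂ] K} (hG : KreinNonneg G) (hH : KreinNonneg H) :
    KreinNonneg (G + H) := by
  intro x
  have h : kreinForm ((G + H) x) x = kreinForm (G x) x + kreinForm (H x) x := by
    simp [kreinForm]
  rw [h]
  exact add_nonneg (hG x) (hH x)

/-! ### The Hilbert space attached to a nonnegative operator -/

set_option linter.unusedVariables false in
/-- The space `K` equipped with the positive semidefinite inner product `[G x, y]`. -/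
def PreGram (G : K →L[ℂ] K) (hG : KreinNonneg G) : Type _ := K

section Gram

variable (G : K →L[ℂ] K) (hG : KreinNonneg G)

instance : AddCommGroup (PreGram G hG) := inferInstanceAs (AddCommGroup K)
instance : Module ℂ (PreGram G hG) := inferInstanceAs (Module ℂ K)

/-- The identity map from `K` to `PreGram G hG`. -/
def toPreGram : K ≃ₗ[ℂ] PreGram G hG := LinearEquiv.refl ℂ K

/-- The inner product `[G x, y]`. -/
abbrev preGramCore : PreInnerProductSpace.Core ℂ (PreGram G hG) where
  inner y x := kreinForm (G ((toPreGram G hG).symm x)) ((toPreGram G hG).symm y)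
  conj_inner_symm y x := by
    have h := hG.isPositive.isSymmetric ((toPreGram G hG).symm y) ((toPreGram G hG).symm x)
    simp only [ContinuousLinearMap.coe_coe, mul_apply_eq_comp] at h
    simp only [kreinForm]
    rw [inner_conj_symm, h]
  re_inner_nonneg x := (Complex.nonneg_iff.1 (hG ((toPreGram G hG).symm x))).1
  add_left x y z := by simp [kreinForm]
  smul_left x y r := by simp [kreinForm, mul_comm]

instance : SeminormedAddCommGroup (PreGram G hG) :=
  InnerProductSpace.Core.toSeminormedAddCommGroup (c := preGramCore G hG)
instance : InnerProductSpace ℂ (PreGram G hG) :=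
  InnerProductSpace.ofCore (preGramCore G hG)

theorem preGram_inner (x y : K) :
    ⟪toPreGram G hG y, toPreGram G hG x⟫_ℂ = kreinForm (G x) y := rfl

theorem preGram_norm_sq (x : K) :
    ‖toPreGram G hG x‖ ^ 2 = (kreinForm (G x) x).re := by
  rw [← preGram_inner G hG, ← inner_self_eq_norm_sq (𝕜 := ℂ)]
  rfl

/-- The Hilbert space completion of `K / ker G` with respect to `[G x, y]`
(the completion of a seminormed space identifies vectors at distance zero). -/
abbrev GramSpace : Type _ := Completion (PreGram G hG)

theorem preGram_norm_le (x : K) :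
    ‖toPreGram G hG x‖ ≤ Real.sqrt ‖(KreinSpace.J * G : K →L[ℂ] K)‖ * ‖x‖ := by
  have h1 : ‖toPreGram G hG x‖ ^ 2 ≤ ‖(KreinSpace.J * G : K →L[ℂ] K)‖ * ‖x‖ ^ 2 := by
    rw [preGram_norm_sq]
    refine (Complex.re_le_norm _).trans ((norm_inner_le_norm _ _).trans ?_)
    have h2 := (KreinSpace.J * G : K →L[ℂ] K).le_opNorm x
    rw [mul_apply_eq_comp] at h2
    nlinarith [norm_nonneg x]
  have h3 : (Real.sqrt ‖(KreinSpace.J * G : K →L[ℂ] K)‖ * ‖x‖) ^ 2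
      = ‖(KreinSpace.J * G : K →L[ℂ] K)‖ * ‖x‖ ^ 2 := by
    rw [mul_pow, Real.sq_sqrt (norm_nonneg _)]
  exact le_of_sq_le_sq (h1.trans h3.ge) (by positivity)

/-- The embedding `ι` of `K` into its completion `GramSpace G hG`. -/
def gramEmb : K →L[ℂ] GramSpace G hG :=
  (Completion.toComplL : PreGram G hG →L[ℂ] GramSpace G hG) ∘L
    ((toPreGram G hG).toLinearMap.mkContinuous _ (preGram_norm_le G hG))

theorem gramEmb_inner (x y : K) :
    ⟪gramEmb G hG y, gramEmb G hG x⟫_ℂ = kreinForm (G x) y :=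
  (Completion.inner_coe (𝕜 := ℂ) (toPreGram G hG y) (toPreGram G hG x)).trans
    (preGram_inner G hG x y)

theorem denseRange_gramEmb : DenseRange (gramEmb G hG) := by
  have h := (Completion.denseRange_coe (α := PreGram G hG))
  exact h

/-- The operator `T : V → K` whose adjoint with respect to the Hilbert space `V` and the
Krein space `K` is the embedding `ι : K → V`. -/
def gramT : GramSpace G hG →L[ℂ] K :=
  (KreinSpace.J : K →L[ℂ] K) ∘L ContinuousLinearMap.adjoint (gramEmb G hG)

theorem kreinForm_gramT (v : GramSpace G hG) (x : K) :
    kreinForm (gramT G hG v) x = ⟪gramEmb G hG x, v⟫_ℂ := by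
  simp only [kreinForm, gramT, ContinuousLinearMap.comp_apply]
  rw [J_J_apply, ContinuousLinearMap.adjoint_inner_right]

theorem kreinForm_ext {x y : K} (h : ∀ z, kreinForm x z = kreinForm y z) : x = y := by
  have h1 : (KreinSpace.J : K →L[ℂ] K) x = (KreinSpace.J : K →L[ℂ] K) y :=
    ext_inner_left ℂ h
  rw [← J_J_apply x, h1, J_J_apply]

/-- `T T* = G`. -/
theorem gramT_gramEmb : gramT G hG ∘L gramEmb G hG = G := by
  ext x
  refine kreinForm_ext fun z => ?_
  rw [ContinuousLinearMap.comp_apply, kreinForm_gramT, gramEmb_inner]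

theorem gramT_injective : Function.Injective (gramT G hG) := by
  intro v w h
  refine (denseRange_gramEmb G hG).eq_of_inner_right (𝕜 := ℂ) fun x => ?_
  rw [← kreinForm_gramT, ← kreinForm_gramT, h]

/-- Reid's inequality. -/
theorem reid_inequality {K : Type*} [NormedAddCommGroup K] [InnerProductSpace ℂ K]
    [CompleteSpace K] {P X : K →L[ℂ] K} (hP : 0 ≤ P) (hXP : 0 ≤ X * P) :
    X * P ≤ ‖X‖ • P := by
  have hPs : star P = P := (IsSelfAdjoint.of_nonneg hP).star_eq
  have hs : star (X * P) = X * P := (IsSelfAdjoint.of_nonneg hXP).star_eq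
  have h1 : (X * P) * (X * P) ≤ (‖X‖ • P) * (‖X‖ • P) := by
    have h2 := CStarAlgebra.star_left_conjugate_le_norm_smul (a := P) (b := star X * X)
    rw [CStarRing.norm_star_mul_self, hPs] at h2
    calc (X * P) * (X * P) = star (X * P) * (X * P) := by rw [hs]
      _ = P * (star X * X) * P := by rw [star_mul, hPs]; simp only [mul_assoc]
      _ ≤ (‖X‖ * ‖X‖) • (P * P) := h2
      _ = _ := by rw [smul_mul_smul_comm]
  have h3 := CFC.sqrt_le_sqrt _ _ h1
  rwa [CFC.sqrt_mul_self _ hXP,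
    CFC.sqrt_mul_self _ (smul_nonneg (norm_nonneg X) hP)] at h3

theorem preGram_norm_map_le {C : K →L[ℂ] K} (hC : Commute C G) (x : K) :
    ‖toPreGram G hG (C x)‖ ≤
      Real.sqrt ‖star C * KreinSpace.J * C * KreinSpace.J‖ * ‖toPreGram G hG x‖ := by
  set X : K →L[ℂ] K := star C * KreinSpace.J * C * KreinSpace.J with hX
  set P : K →L[ℂ] K := KreinSpace.J * G with hP
  have hP0 : 0 ≤ P := (ContinuousLinearMap.nonneg_iff_isPositive P).2 hG.isPositive
  have hXP : X * P = star C * P * C := by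
    have h : X * P = star C * KreinSpace.J * C * (KreinSpace.J * KreinSpace.J) * G := by
      simp only [hX, hP, mul_assoc]
    rw [h, KreinSpace.J_mul_J, mul_one, mul_assoc _ C G, hC.eq]
    simp only [hP, mul_assoc]
  have hXP0 : 0 ≤ X * P := by rw [hXP]; exact star_left_conjugate_nonneg hP0 C
  have h1 := reid_inequality hP0 hXP0
  rw [ContinuousLinearMap.le_def] at h1
  have h2 := h1.re_inner_nonneg_right x
  have e1 : (‖toPreGram G hG (C x)‖ ^ 2 : ℝ) = RCLike.re ⟪x, (X * P) x⟫_ℂ := by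
    rw [preGram_norm_sq, hXP]
    simp only [mul_apply_eq_comp, ContinuousLinearMap.star_eq_adjoint]
    rw [ContinuousLinearMap.adjoint_inner_right]
    rfl
  have e2 : (‖toPreGram G hG x‖ ^ 2 : ℝ) = RCLike.re ⟪x, P x⟫_ℂ := by
    rw [preGram_norm_sq]
    rfl
  have h3 : ‖toPreGram G hG (C x)‖ ^ 2 ≤ ‖X‖ * ‖toPreGram G hG x‖ ^ 2 := by
    rw [e1, e2]
    have e3 : ⟪x, (‖X‖ • P - X * P) x⟫_ℂ = (‖X‖ : ℂ) * ⟪x, P x⟫_ℂ - ⟪x, (X * P) x⟫_ℂ := by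
      rw [sub_apply, inner_sub_right, smul_apply,
        inner_smul_right_eq_smul]
      simp
    rw [e3] at h2
    simp only [map_sub, RCLike.re_eq_complex_re, Complex.re_ofReal_mul] at h2 ⊢
    linarith
  have h4 : (Real.sqrt ‖X‖ * ‖toPreGram G hG x‖) ^ 2 = ‖X‖ * ‖toPreGram G hG x‖ ^ 2 := by
    rw [mul_pow, Real.sq_sqrt (norm_nonneg _)]
  exact le_of_sq_le_sq (h3.trans h4.ge) (by positivity)

/-- For `C` commuting with `G = T T*`, the operator `Θ(C) = T⁻¹ C T` on `V`, constructed as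
the continuous extension of `ι x ↦ ι (C x)`. -/
def gramTheta (C : K →L[ℂ] K) (hC : Commute C G) : GramSpace G hG →L[ℂ] GramSpace G hG :=
  (LinearMap.mkContinuous
    ((toPreGram G hG).toLinearMap ∘ₗ C.toLinearMap ∘ₗ (toPreGram G hG).symm.toLinearMap)
    _ (preGram_norm_map_le G hG hC)).completion

theorem gramTheta_gramEmb (C : K →L[ℂ] K) (hC : Commute C G) (x : K) :
    gramTheta G hG C hC (gramEmb G hG x) = gramEmb G hG (C x) :=
  ContinuousLinearMap.completion_apply_coe _ _

/-- `T Θ(C) = C T`, i.e. `Θ(C) = T⁻¹ C T`. -/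
theorem gramT_gramTheta (C : K →L[ℂ] K) (hC : Commute C G) :
    gramT G hG ∘L gramTheta G hG C hC = C ∘L gramT G hG := by
  refine ContinuousLinearMap.coeFn_injective ((denseRange_gramEmb G hG).equalizer
    (ContinuousLinearMap.continuous _) (ContinuousLinearMap.continuous _) ?_)
  funext x
  have h := fun y => congrArg (fun f : K →L[ℂ] K => f y) (gramT_gramEmb G hG)
  simp only [Function.comp_apply, ContinuousLinearMap.comp_apply] at h ⊢
  rw [gramTheta_gramEmb, h, h]
  exact congrArg (fun f : K →L[ℂ] K => f x) hC.eq.symm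

end Gram

section TwoGrams

variable (G H : K →L[ℂ] K) (hG : KreinNonneg G) (hH : KreinNonneg H)

theorem preGram_norm_mono (hle : KreinNonneg (G - H)) (x : K) :
    ‖toPreGram H hH x‖ ≤ 1 * ‖toPreGram G hG x‖ := by
  rw [one_mul]
  refine le_of_sq_le_sq ?_ (norm_nonneg _)
  rw [preGram_norm_sq, preGram_norm_sq]
  have h := (Complex.nonneg_iff.1 (hle x)).1
  have h2 : kreinForm ((G - H) x) x = kreinForm (G x) x - kreinForm (H x) x := by
    simp [kreinForm]
  rw [h2, Complex.sub_re] at h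
  linarith

/-- For `H ≤ G`, the contraction `R : V_H → V_G` which is the adjoint of the continuous
extension `V_G → V_H` of `T_G* x ↦ T_H* x`. -/
def gramR (hle : KreinNonneg (G - H)) : GramSpace H hH →L[ℂ] GramSpace G hG :=
  ContinuousLinearMap.adjoint
    (LinearMap.mkContinuous
      ((toPreGram H hH).toLinearMap ∘ₗ (toPreGram G hG).symm.toLinearMap) 1
      (preGram_norm_mono G H hG hH hle)).completion

theorem adjoint_gramR_gramEmb (hle : KreinNonneg (G - H)) (x : K) :
    ContinuousLinearMap.adjoint (gramR G H hG hH hle) (gramEmb G hG x) = gramEmb H hH x := by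
  rw [gramR, ContinuousLinearMap.adjoint_adjoint]
  exact ContinuousLinearMap.completion_apply_coe _ _

/-- `T_H = T_G R`. -/
theorem gramT_gramR (hle : KreinNonneg (G - H)) :
    gramT G hG ∘L gramR G H hG hH hle = gramT H hH := by
  ext v
  refine kreinForm_ext fun z => ?_
  rw [ContinuousLinearMap.comp_apply, kreinForm_gramT, kreinForm_gramT,
    ← ContinuousLinearMap.adjoint_inner_left, adjoint_gramR_gramEmb]

end TwoGrams

end Krein

/-! ### Spectral measures -/

/-- A spectral measure (projection valued measure) on the Borel sets of `ℂ`: a strongly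
countably additive map into the orthogonal projections of a Hilbert space. -/
structure SpectralMeasure (V : Type*) [NormedAddCommGroup V] [InnerProductSpace ℂ V]
    [CompleteSpace V] where
  /-- The projection assigned to a set; only its values on Borel sets are relevant. -/
  proj : Set ℂ → V →L[ℂ] V
  isStarProjection : ∀ Δ, MeasurableSet Δ → IsStarProjection (proj Δ)
  proj_univ : proj Set.univ = 1
  proj_inter : ∀ Δ Δ', MeasurableSet Δ → MeasurableSet Δ' → proj (Δ ∩ Δ') = proj Δ * proj Δ'
  hasSum_iUnion : ∀ Δ : ℕ → Set ℂ, (∀ n, MeasurableSet (Δ n)) →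
    Pairwise (Function.onFun Disjoint Δ) → ∀ x, HasSum (fun n => proj (Δ n) x) (proj (⋃ n, Δ n) x)

namespace SpectralMeasure

variable {V : Type*} [NormedAddCommGroup V] [InnerProductSpace ℂ V] [CompleteSpace V]
  (E : SpectralMeasure V)

theorem inner_proj (Δ : Set ℂ) (hΔ : MeasurableSet Δ) (x : V) :
    ⟪x, E.proj Δ x⟫_ℂ = ((‖E.proj Δ x‖ ^ 2 : ℝ) : ℂ) := by
  have h1 := (E.isStarProjection Δ hΔ).isIdempotentElem
  have h2 := (E.isStarProjection Δ hΔ).isSelfAdjoint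
  have h3 : E.proj Δ x = E.proj Δ (E.proj Δ x) :=
    (congrArg (fun f : V →L[ℂ] V => f x) h1.eq).symm
  have h4 : ⟪x, E.proj Δ (E.proj Δ x)⟫_ℂ = ⟪E.proj Δ x, E.proj Δ x⟫_ℂ :=
    (h2.isSymmetric x (E.proj Δ x)).symm
  rw [h3, h4, ← h3, inner_self_eq_norm_sq_to_K]
  norm_cast

/-- The finite positive Borel measure `Δ ↦ (E(Δ) x, x)`. -/
def scalarMeasure (x : V) : Measure ℂ :=
  Measure.ofMeasurable (fun Δ _ => ENNReal.ofReal (⟪x, E.proj Δ x⟫_ℂ).re)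
    (by
      have h2 := E.hasSum_iUnion (fun _ => ∅) (fun _ => MeasurableSet.empty)
        (fun _ _ _ => Set.disjoint_empty _) x
      have h3 : E.proj ∅ x = 0 := (summable_const_iff _).1 h2.summable
      simp [h3])
    (by
      intro Δ hΔ hd
      have h := E.hasSum_iUnion Δ hΔ hd x
      have h2 : HasSum (fun n => (⟪x, E.proj (Δ n) x⟫_ℂ).re)
          (⟪x, E.proj (⋃ n, Δ n) x⟫_ℂ).re :=
        Complex.hasSum_re ((innerSL ℂ x).hasSum h)
      have h0 : ∀ n, 0 ≤ (⟪x, E.proj (Δ n) x⟫_ℂ).re := by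
        intro n
        rw [E.inner_proj _ (hΔ n), Complex.ofReal_re]
        positivity
      rw [← h2.tsum_eq, ENNReal.ofReal_tsum_of_nonneg h0 h2.summable])

theorem scalarMeasure_apply (x : V) {Δ : Set ℂ} (hΔ : MeasurableSet Δ) :
    E.scalarMeasure x Δ = ENNReal.ofReal (⟪x, E.proj Δ x⟫_ℂ).re :=
  Measure.ofMeasurable_apply Δ hΔ

/-- `B = ∫ h dE` (for `h` bounded and Borel on a set of full `E`-measure), characterized by
`(B x, x) = ∫ h d(E x, x)` for all `x`. -/
def IsIntegral (h : ℂ → ℂ) (B : V →L[ℂ] V) : Prop :=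
  ∀ x, ⟪x, B x⟫_ℂ = ∫ z, h z ∂(E.scalarMeasure x)

/-- `E` is the spectral measure of the normal operator `M`: it is concentrated on the
spectrum of `M`, and `M = ∫ z dE(z)`. -/
def IsSpectralMeasureOf (M : V →L[ℂ] V) : Prop :=
  E.proj (spectrum ℂ M) = 1 ∧ E.IsIntegral (fun z => z) M

end SpectralMeasure

/-! ### Definitizable normal operators -/

section Definitizable

variable (K : Type*) [NormedAddCommGroup K] [InnerProductSpace ℂ K] [CompleteSpace K]
  [KreinSpace K]

variable {K} in
/-- The real part `(N + N*) / 2` (Krein space adjoint). -/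
def kreinRe (N : K →L[ℂ] K) : K →L[ℂ] K := (1 / 2 : ℂ) • (N + kreinAdjoint N)

variable {K} in
/-- The imaginary part `(N - N*) / (2 i)` (Krein space adjoint). -/
def kreinIm (N : K →L[ℂ] K) : K →L[ℂ] K := (1 / (2 * Complex.I)) • (N - kreinAdjoint N)

variable {K} in
/-- The value `p(A)` of a real polynomial. -/
def realPolyOp (p : Polynomial ℝ) (A : K →L[ℂ] K) : K →L[ℂ] K :=
  Polynomial.aeval A (p.map (algebraMap ℝ ℂ))

/-- A bounded normal definitizable operator `N` on the Krein space `K`, together with fixed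
definitizing real polynomials `p` for its real part and `q` for its imaginary part. -/
structure DefinitizableNormal where
  N : K →L[ℂ] K
  normal : N * kreinAdjoint N = kreinAdjoint N * N
  p : Polynomial ℝ
  q : Polynomial ℝ
  p_ne_zero : p ≠ 0
  q_ne_zero : q ≠ 0
  definitizing_p : ∀ x, 0 ≤ kreinForm (realPolyOp p (kreinRe N) x) x
  definitizing_q : ∀ x, 0 ≤ kreinForm (realPolyOp q (kreinIm N) x) x

end Definitizable

namespace DefinitizableNormal

variable {K : Type*} [NormedAddCommGroup K] [InnerProductSpace ℂ K] [CompleteSpace K]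
  [KreinSpace K] (D : DefinitizableNormal K)

/-- The real part of `N`. -/
def A : K →L[ℂ] K := kreinRe D.N

/-- The imaginary part of `N`. -/
def B : K →L[ℂ] K := kreinIm D.N

/-- `p(A)`. -/
def pA : K →L[ℂ] K := realPolyOp D.p D.A

/-- `q(B)`. -/
def qB : K →L[ℂ] K := realPolyOp D.q D.B

theorem pA_nonneg : KreinNonneg D.pA := D.definitizing_p

theorem qB_nonneg : KreinNonneg D.qB := D.definitizing_q

theorem sum_nonneg : KreinNonneg (D.pA + D.qB) := D.pA_nonneg.add D.qB_nonneg

theorem commute_sum : Commute D.N (D.pA + D.qB) := by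
  have h : Commute D.N (kreinAdjoint D.N) := D.normal
  have hA : Commute D.N D.A := ((Commute.refl _).add_right h).smul_right _
  have hB : Commute D.N D.B := ((Commute.refl _).sub_right h).smul_right _
  have key : ∀ (C : K →L[ℂ] K) (r : Polynomial ℂ), Commute D.N C →
      Commute D.N (Polynomial.aeval C r) := by
    intro C r hC
    induction r using Polynomial.induction_on' with
    | add a b ha hb => rw [map_add]; exact ha.add_right hb
    | monomial n a =>
      rw [Polynomial.aeval_monomial]
      exact (Algebra.commute_algebraMap_right a D.N).mul_right (hC.pow_right n)
  exact (key _ _ hA).add_right (key _ _ hB)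

/-- The Hilbert space `V`: the completion of `K / ker (p(A) + q(B))` with respect to
`[(p(A) + q(B)) x, y]`. -/
abbrev V : Type _ := GramSpace (D.pA + D.qB) D.sum_nonneg

/-- The Hilbert space `V₁`: the completion of `K / ker p(A)` with respect to `[p(A) x, y]`. -/
abbrev V₁ : Type _ := GramSpace D.pA D.pA_nonneg

/-- The Hilbert space `V₂`: the completion of `K / ker q(B)` with respect to `[q(B) x, y]`. -/
abbrev V₂ : Type _ := GramSpace D.qB D.qB_nonneg

/-- `T : V → K`, injective with `T T* = p(A) + q(B)`. -/
def T : D.V →L[ℂ] K := gramT (D.pA + D.qB) D.sum_nonneg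

/-- The adjoint `T* : K → V` of `T`. -/
def Tstar : K →L[ℂ] D.V := gramEmb (D.pA + D.qB) D.sum_nonneg

/-- `R₁ : V₁ → V`, the contraction with `T₁ = T R₁`. -/
def R₁ : D.V₁ →L[ℂ] D.V :=
  gramR (D.pA + D.qB) D.pA D.sum_nonneg D.pA_nonneg
    (by rw [add_sub_cancel_left]; exact D.qB_nonneg)

/-- `R₂ : V₂ → V`, the contraction with `T₂ = T R₂`. -/
def R₂ : D.V₂ →L[ℂ] D.V :=
  gramR (D.pA + D.qB) D.qB D.sum_nonneg D.qB_nonneg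
    (by rw [add_sub_cancel_right]; exact D.pA_nonneg)

/-- `R₁ R₁*`. -/
def R₁R₁ : D.V →L[ℂ] D.V := D.R₁ ∘L ContinuousLinearMap.adjoint D.R₁

/-- `R₂ R₂*`. -/
def R₂R₂ : D.V →L[ℂ] D.V := D.R₂ ∘L ContinuousLinearMap.adjoint D.R₂

/-- `Θ(N) = T⁻¹ N T`, a bounded normal operator on the Hilbert space `V`. -/
def ThetaN : D.V →L[ℂ] D.V := gramTheta (D.pA + D.qB) D.sum_nonneg D.N D.commute_sum

/-- `Ξ(S) = T S T*`. -/
def Xi (S : D.V →L[ℂ] D.V) : K →L[ℂ] K := D.T ∘L S ∘L D.Tstar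

/-- The spectrum `σ(Θ(N))`. -/
def specTheta : Set ℂ := spectrum ℂ D.ThetaN

/-! ### The function class -/

/-- The degree of the zero of `p` at `ξ` (it is `0` if `p(ξ) ≠ 0`). -/
def dp (ξ : ℂ) : ℕ := (D.p.map (algebraMap ℝ ℂ)).rootMultiplicity ξ

/-- The degree of the zero of `q` at `η`. -/
def dq (η : ℂ) : ℕ := (D.q.map (algebraMap ℝ ℂ)).rootMultiplicity η

/-- `Z_p^ℝ + i Z_q^ℝ`. -/
def Zreal : Set ℂ := {z | D.p.eval z.re = 0 ∧ D.q.eval z.im = 0}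

/-- `Zⁱ = (p⁻¹{0} × q⁻¹{0}) \ (ℝ × ℝ)`. -/
def Zimag : Set (ℂ × ℂ) :=
  {ζ | (D.p.map (algebraMap ℝ ℂ)).eval ζ.1 = 0 ∧ (D.q.map (algebraMap ℝ ℂ)).eval ζ.2 = 0 ∧
    ¬ (ζ.1.im = 0 ∧ ζ.2.im = 0)}

/-- The disjoint union `(σ(Θ(N)) ∪ (Z_p^ℝ + i Z_q^ℝ)) ⊔ Zⁱ` on which the functions of the
calculus are defined. -/
abbrev Domain : Type := ↥(D.specTheta ∪ D.Zreal) ⊕ ↥D.Zimag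

/-- The point of `ℂ²` belonging to an element of the domain: `(Re z, Im z)` for
`z ∈ σ(Θ(N)) ∪ (Z_p^ℝ + i Z_q^ℝ)` and `(ξ, η)` for `(ξ, η) ∈ Zⁱ`. -/
def point : D.Domain → ℂ × ℂ
  | .inl z => ((z.1.re : ℂ), (z.1.im : ℂ))
  | .inr ζ => ζ.1

open Classical in
/-- The index set of the entries of the values at an element of the domain. With `m`, `n` the
degrees of the zeros of `p`, `q` there, it is `{(0, 0)}` on `σ(Θ(N)) \ (Z_p^ℝ + i Z_q^ℝ)`,
`({0, …, m - 1} × {0, …, n - 1}) ∪ {(m, 0), (0, n)}` on `Z_p^ℝ + i Z_q^ℝ`, and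
`{0, …, m - 1} × {0, …, n - 1}` on `Zⁱ`. -/
def index (x : D.Domain) : Finset (ℕ × ℕ) :=
  match x with
  | .inl z =>
    if z.1 ∈ D.Zreal then
      (Finset.range (D.dp z.1.re) ×ˢ Finset.range (D.dq z.1.im)) ∪
        {(D.dp z.1.re, 0), (0, D.dq z.1.im)}
    else {(0, 0)}
  | .inr ζ => Finset.range (D.dp ζ.1.1) ×ˢ Finset.range (D.dq ζ.1.2)

/-- The space `M_N` of all functions on the domain whose value at `x` is a family of complex
numbers indexed by `index x`. -/
abbrev MN : Type := (x : D.Domain) → D.index x → ℂ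

/-- The entry of `φ(x)` with index `(k, l)` (zero if this is not an index). -/
def entry (φ : D.MN) (x : D.Domain) (k l : ℕ) : ℂ :=
  if h : (k, l) ∈ D.index x then φ x ⟨(k, l), h⟩ else 0

/-- The ideal `R`: at the points of `(Z_p^ℝ + i Z_q^ℝ) ⊔ Zⁱ` the entries with
`k < m`, `l < n` vanish. -/
def IsInR (φ : D.MN) : Prop :=
  (∀ z : ↥(D.specTheta ∪ D.Zreal), z.1 ∈ D.Zreal →
    ∀ k < D.dp z.1.re, ∀ l < D.dq z.1.im, D.entry φ (.inl z) k l = 0) ∧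
  ∀ ζ : ↥D.Zimag, ∀ k < D.dp ζ.1.1, ∀ l < D.dq ζ.1.2, D.entry φ (.inr ζ) k l = 0

/-- The class `F_N`. -/
structure IsInFN (φ : D.MN) : Prop where
  measurable : Measurable fun z : ↥(D.specTheta \ D.Zreal) =>
    D.entry φ (.inl ⟨z.1, Or.inl z.2.1⟩) 0 0
  bounded : ∃ C : ℝ, ∀ z : ↥(D.specTheta \ D.Zreal),
    ‖D.entry φ (.inl ⟨z.1, Or.inl z.2.1⟩) 0 0‖ ≤ C
  growth : ∀ (w : ℂ) (hw : w ∈ D.specTheta ∩ D.Zreal), ∃ U ∈ nhds w, ∃ C : ℝ,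
    ∀ (z : ℂ) (hz : z ∈ D.specTheta), z ∈ U → z ≠ w →
      ‖D.entry φ (.inl ⟨z, Or.inl hz⟩) 0 0
        - ∑ k ∈ Finset.range (D.dp w.re), ∑ l ∈ Finset.range (D.dq w.im),
            D.entry φ (.inl ⟨w, Or.inl hw.1⟩) k l
              * ((z - w).re : ℂ) ^ k * ((z - w).im : ℂ) ^ l‖
      ≤ C * max (|(z - w).re| ^ D.dp w.re) (|(z - w).im| ^ D.dq w.im)

/-! ### The functional calculus -/

/-- The Taylor coefficient `(1 / (k! l!)) ∂^(k+l) s / ∂z^k ∂w^l` at a point of `ℂ²`. -/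
def taylorCoeff (s : MvPolynomial (Fin 2) ℂ) (a : ℂ × ℂ) (k l : ℕ) : ℂ :=
  MvPolynomial.eval ![a.1, a.2]
      ((MvPolynomial.pderiv 0)^[k] ((MvPolynomial.pderiv 1)^[l] s))
    / ((k.factorial : ℂ) * (l.factorial : ℂ))

/-- The element `s_N` of `M_N` given by a polynomial `s ∈ ℂ[z, w]`. -/
def polyFun (s : MvPolynomial (Fin 2) ℂ) : D.MN :=
  fun x kl => taylorCoeff s (D.point x) kl.1.1 kl.1.2

/-- The polynomial `p(z) + q(w)`. -/
def pqPoly : MvPolynomial (Fin 2) ℂ :=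
  Polynomial.aeval (MvPolynomial.X 0) (D.p.map (algebraMap ℝ ℂ)) +
    Polynomial.aeval (MvPolynomial.X 1) (D.q.map (algebraMap ℝ ℂ))

open Classical in
/-- The entry with index `(k, l)` of `((p_N + q_N) · g)(z)`, `z ∈ σ(Θ(N))`, for a function `g`
whose value is `g₀ z ∈ ℂ` off `Z_p^ℝ + i Z_q^ℝ` and `(g₁ z, g₂ z) ∈ ℂ²` on `Z_p^ℝ + i Z_q^ℝ`. -/
def mulEntry (g₀ g₁ g₂ : ℂ → ℂ) (z : ↥D.specTheta) (k l : ℕ) : ℂ :=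
  D.entry (D.polyFun D.pqPoly) (.inl ⟨z.1, Or.inl z.2⟩) k l *
    (if z.1 ∉ D.Zreal then g₀ z.1
      else if (k, l) = (D.dp z.1.re, 0) then g₁ z.1
      else if (k, l) = (0, D.dq z.1.im) then g₂ z.1
      else 0)

/-- A decomposition `φ = s_N + (p_N + q_N) · g` on `σ(Θ(N))` with `φ - s_N ∈ R` and `g`
bounded and measurable on `σ(Θ(N)) \ (Z_p^ℝ + i Z_q^ℝ)`. -/
structure IsDecomposition (φ : D.MN) (s : MvPolynomial (Fin 2) ℂ) (g₀ g₁ g₂ : ℂ → ℂ) :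
    Prop where
  sub_mem : D.IsInR (φ - D.polyFun s)
  measurable : Measurable fun z : ↥(D.specTheta \ D.Zreal) => g₀ z.1
  bounded : ∃ C : ℝ, ∀ z ∈ D.specTheta \ D.Zreal, ‖g₀ z‖ ≤ C
  eq : ∀ (z : ↥D.specTheta), ∀ kl ∈ D.index (.inl ⟨z.1, Or.inl z.2⟩),
    D.entry φ (.inl ⟨z.1, Or.inl z.2⟩) kl.1 kl.2
      = D.entry (D.polyFun s) (.inl ⟨z.1, Or.inl z.2⟩) kl.1 kl.2
        + D.mulEntry g₀ g₁ g₂ z kl.1 kl.2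

/-- The operator `s(A, B)`. -/
def polyOp (s : MvPolynomial (Fin 2) ℂ) : K →L[ℂ] K :=
  ∑ m ∈ s.support, s.coeff m • (D.A ^ m 0 * D.B ^ m 1)

/-- `Φ = φ(N)`, that is,
`Φ = s(A, B) + Ξ(∫ g₀ dE + ∑_w (g₁(w) R₁R₁* E{w} + g₂(w) R₂R₂* E{w}))` where the integral is over
`σ(Θ(N)) \ (Z_p^ℝ + i Z_q^ℝ)`, `w` runs through the finite set `σ(Θ(N)) ∩ (Z_p^ℝ + i Z_q^ℝ)`,
`E` is the spectral measure of `Θ(N)`, and `φ = s_N + (p_N + q_N) · g` is a decomposition. -/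
def IsCalculusValue (φ : D.MN) (Φ : K →L[ℂ] K) : Prop :=
  ∃ (E : SpectralMeasure D.V) (s : MvPolynomial (Fin 2) ℂ) (g₀ g₁ g₂ : ℂ → ℂ)
    (I : D.V →L[ℂ] D.V),
    E.IsSpectralMeasureOf D.ThetaN ∧
    D.IsDecomposition φ s g₀ g₁ g₂ ∧
    E.IsIntegral (Set.indicator (D.specTheta \ D.Zreal) g₀) I ∧
    Φ = D.polyOp s + D.Xi (I + ∑ᶠ w ∈ D.specTheta ∩ D.Zreal,
      (g₁ w • (D.R₁R₁ * E.proj {w}) + g₂ w • (D.R₂R₂ * E.proj {w})))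

/-- The set `σ_N = (σ(Θ(N)) ∪ ((Z_p^ℝ + i Z_q^ℝ) ∩ σ(N))) ⊔
{(α, β) ∈ Zⁱ : α + iβ, conj α + i conj β ∈ σ(N)}`. -/
def sigmaN : Set D.Domain :=
  {x | match x with
    | .inl z => z.1 ∈ D.specTheta ∨ (z.1 ∈ D.Zreal ∧ z.1 ∈ spectrum ℂ D.N)
    | .inr ζ => ζ.1.1 + Complex.I * ζ.1.2 ∈ spectrum ℂ D.N ∧
        star ζ.1.1 + Complex.I * star ζ.1.2 ∈ spectrum ℂ D.N}

end DefinitizableNormal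

end

/-! Write `Ξ(S) = T S T*`, let `A' = Θ(A)` and `B' = Θ(B)` be the real and imaginary parts of
`Θ(N)`, and put `d = (p + q)(A', B')`. Everything rests on the identities `T* T = d`, `r(A, B) Ξ(S)
= Ξ(r(A', B') S)`, `Ξ(S) r(A, B) = Ξ(S r(A', B'))`, `Ξ(S) Ξ(S') = Ξ(S d S')`, `Ξ(R₁R₁*) = p(A)` and
`Ξ(R₂R₂*) = q(B)`. They follow because `T` is injective and `T*` has dense range.

Spectral inclusion. Let `c` lie outside the closure, so that `|φ₀₀ - c| ≥ δ > 0` on `σ_N`. Put `r =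
s - c`, so that `φ(N) - c = r(A, B) + Ξ(G)`, where `G` is the integral `I` plus a sum over `Z`.
Since `p + q` vanishes on `Z`, that sum is annihilated by `d` on both sides. Hence `r(A', B') + G d
= r(A', B') + d G` is the integral `L` of `φ₀₀ - c`, which is invertible on `V`
(`IsDecomposition.exists_inverse_evalTheta`). This controls only what passes through `V`.

The remainder is algebraic. At a common zero `(a, b)` of `r`, `p(z)`, `q(w)`, one of `a + i b` and
`ā + i b̄` is outside `σ(N)`; otherwise `(a, b)` would give a point of `σ_N` at which `φ₀₀ = c`. So
some linear polynomial vanishing at `(a, b)` has an invertible value at `(A, B)`. A prime ideal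
argument (`exists_isUnit_of_common_zeros`) then yields `t, u, v` for which `r t + p u + q v` is
invertible at `(A, B)`. With `M = G t(A', B') - R₁R₁* u(A', B') - R₂R₂* v(A', B')`, the product
`(r(A, B) + Ξ(G)) (t(A, B) - Ξ(L⁻¹ M))` equals this invertible operator, and there is a mirrored
identity on the left (`isUnit_add_of_quasi_inverse`). Hence `φ(N) - c` is invertible.

Existence. Hermite interpolation provides `s`. Off `Z` one is forced to take `g = (φ - s) / (p +
q)`, and the question is its boundedness. From `R₁R₁* d = p(A')` and `R₂R₂* d = q(B')` one gets `|p|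
≤ C |p + q|` and `|q| ≤ C |p + q|` on `σ(Θ(N))`: there is no cancellation between `p` and `q`. So
`|p + q|` dominates the denominator in the growth condition near each point of `Z`, and compactness
finishes. The spectral measure and the integral are constructed from the continuous functional
calculus, through positive functionals, weak limits and induction over bounded Borel functions. -/

noncomputable section

open Filter Topology

/-! ### Induction for bounded Borel functions -/

/-- Bounded Borel functions on `ℂ`. -/
def IsBoundedBorel (f : ℂ → ℂ) : Prop := Measurable f ∧ ∃ C : ℝ, ∀ z, ‖f z‖ ≤ C

theorem isBoundedBorel_indicator_one {Δ : Set ℂ} (hΔ : MeasurableSet Δ) :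
    IsBoundedBorel (Δ.indicator 1) := by
  refine ⟨measurable_one.indicator hΔ, 1, fun z => ?_⟩
  refine (norm_indicator_le_norm_self _ _).trans ?_
  simp

theorem IsBoundedBorel.add {f g : ℂ → ℂ} (hf : IsBoundedBorel f) (hg : IsBoundedBorel g) :
    IsBoundedBorel (f + g) := by
  obtain ⟨C, hC⟩ := hf.2
  obtain ⟨C', hC'⟩ := hg.2
  exact ⟨hf.1.add hg.1, C + C', fun z => (norm_add_le _ _).trans (add_le_add (hC z) (hC' z))⟩

theorem IsBoundedBorel.mul {f g : ℂ → ℂ} (hf : IsBoundedBorel f) (hg : IsBoundedBorel g) :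
    IsBoundedBorel (f * g) := by
  obtain ⟨C, hC⟩ := hf.2
  obtain ⟨C', hC'⟩ := hg.2
  refine ⟨hf.1.mul hg.1, C * C', fun z => ?_⟩
  rw [Pi.mul_apply, norm_mul]
  exact mul_le_mul (hC z) (hC' z) (norm_nonneg _) ((norm_nonneg _).trans (hC z))

theorem IsBoundedBorel.const_smul {f : ℂ → ℂ} (hf : IsBoundedBorel f) (c : ℂ) :
    IsBoundedBorel (c • f) := by
  obtain ⟨C, hC⟩ := hf.2
  refine ⟨hf.1.const_smul c, ‖c‖ * C, fun z => ?_⟩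
  rw [Pi.smul_apply, norm_smul]
  exact mul_le_mul_of_nonneg_left (hC z) (norm_nonneg _)

theorem IsBoundedBorel.integrable {f : ℂ → ℂ} (hf : IsBoundedBorel f) (μ : Measure ℂ)
    [IsFiniteMeasure μ] : Integrable f μ := by
  obtain ⟨C, hC⟩ := hf.2
  exact Integrable.of_bound hf.1.aestronglyMeasurable C (ae_of_all _ hC)

theorem IsBoundedBorel.tendsto_integral {f : ℕ → ℂ → ℂ} {g : ℂ → ℂ} {C : ℝ}
    (hf : ∀ n, Measurable (f n)) (hC : ∀ n z, ‖f n z‖ ≤ C)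
    (h : ∀ z, Tendsto (fun n => f n z) atTop (𝓝 (g z))) (μ : Measure ℂ) [IsFiniteMeasure μ] :
    Tendsto (fun n => ∫ z, f n z ∂μ) atTop (𝓝 (∫ z, g z ∂μ)) :=
  tendsto_integral_of_dominated_convergence (fun _ => C)
    (fun n => (hf n).aestronglyMeasurable) (integrable_const _)
    (fun n => ae_of_all _ (hC n)) (ae_of_all _ h)

/-- A class of functions that is closed under linear combinations and bounded pointwise limits
and contains the indicators of closed sets contains all bounded Borel functions. -/
theorem IsBoundedBorel.induction {Q : (ℂ → ℂ) → Prop}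
    (hclosed : ∀ F : Set ℂ, IsClosed F → Q (F.indicator 1))
    (hadd : ∀ f g, IsBoundedBorel f → IsBoundedBorel g → Q f → Q g → Q (f + g))
    (hsmul : ∀ (c : ℂ) f, IsBoundedBorel f → Q f → Q (c • f))
    (hlim : ∀ (f : ℕ → ℂ → ℂ) (g : ℂ → ℂ) (C : ℝ), (∀ n, Measurable (f n)) →
      (∀ n z, ‖f n z‖ ≤ C) → (∀ z, Tendsto (fun n => f n z) atTop (𝓝 (g z))) →
      (∀ n, Q (f n)) → Q g)
    {f : ℂ → ℂ} (hf : IsBoundedBorel f) : Q f := by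
  have hone : Q 1 := by simpa using hclosed Set.univ isClosed_univ
  have hb1 : IsBoundedBorel 1 := by simpa using isBoundedBorel_indicator_one MeasurableSet.univ
  have hzero : Q 0 := by simpa only [Set.indicator_empty'] using hclosed ∅ isClosed_empty
  -- Dynkin's π-λ theorem with the closed sets as π-system; countable disjoint unions are bounded
  -- pointwise limits of finite ones.
  have hind : ∀ Δ : Set ℂ, MeasurableSet Δ → Q (Δ.indicator 1) := by
    refine MeasurableSpace.induction_on_inter (C := fun Δ _ => Q (Δ.indicator 1))
      ((BorelSpace.measurable_eq (α := ℂ)).trans borel_eq_generateFrom_isClosed)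
      isPiSystem_isClosed (hclosed ∅ isClosed_empty) hclosed ?_ ?_
    · intro Δ hΔ h
      rw [Set.indicator_compl, sub_eq_add_neg, ← neg_one_smul ℂ (Set.indicator Δ 1)]
      exact hadd _ _ hb1 ((isBoundedBorel_indicator_one hΔ).const_smul _) hone
        (hsmul _ _ (isBoundedBorel_indicator_one hΔ) h)
    · intro Δ hd hΔ h
      have hm : ∀ n, MeasurableSet (⋃ i ∈ Finset.range n, Δ i) := fun n =>
        Finset.measurableSet_biUnion _ fun i _ => hΔ i
      refine hlim (fun n => (⋃ i ∈ Finset.range n, Δ i).indicator 1) _ 1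
        (fun n => (isBoundedBorel_indicator_one (hm n)).1) ?_ ?_ ?_
      · intro n z
        refine (norm_indicator_le_norm_self _ _).trans ?_
        simp
      · intro z
        by_cases hz : z ∈ ⋃ i, Δ i
        · obtain ⟨i, hi⟩ := Set.mem_iUnion.1 hz
          refine tendsto_const_nhds.congr' ?_
          filter_upwards [eventually_gt_atTop i] with n hn
          rw [Set.indicator_of_mem hz, Set.indicator_of_mem]
          exact Set.mem_biUnion (Finset.mem_coe.2 (Finset.mem_range.2 hn)) hi
        · refine tendsto_const_nhds.congr fun n => ?_
          rw [Set.indicator_of_notMem hz, Set.indicator_of_notMem]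
          exact fun h' => hz (Set.iUnion₂_subset (fun i _ => Set.subset_iUnion Δ i) h')
      · intro n
        induction n with
        | zero =>
          have h0 : (⋃ i ∈ Finset.range 0, Δ i) = ∅ := by simp
          simpa only [h0, Set.indicator_empty'] using hzero
        | succ n ih =>
          have hdis : Disjoint (Δ n) (⋃ i ∈ Finset.range n, Δ i) := by
            simp only [Set.disjoint_iUnion_right, Finset.mem_range]
            exact fun i hi => hd hi.ne'
          have h2 : (⋃ i ∈ Finset.range (n + 1), Δ i) = Δ n ∪ ⋃ i ∈ Finset.range n, Δ i := by
            rw [Finset.range_add_one, Finset.set_biUnion_insert]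
          rw [h2, Set.indicator_union_of_disjoint hdis]
          exact hadd _ _ (isBoundedBorel_indicator_one (hΔ n))
            (isBoundedBorel_indicator_one (hm n)) (h n) ih
  have hsimple : ∀ s : SimpleFunc ℂ ℂ, Q s ∧ IsBoundedBorel s := by
    intro s
    induction s using SimpleFunc.induction with
    | const c hs =>
      rename_i Δ
      have e : (⇑(SimpleFunc.piecewise Δ hs (SimpleFunc.const ℂ c) (SimpleFunc.const ℂ 0)))
          = c • Δ.indicator 1 := by
        ext z
        by_cases hz : z ∈ Δ <;> simp [hz]
      rw [e]
      exact ⟨hsmul _ _ (isBoundedBorel_indicator_one hs) (hind _ hs),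
        (isBoundedBorel_indicator_one hs).const_smul c⟩
    | add hd h1 h2 =>
      rw [SimpleFunc.coe_add]
      exact ⟨hadd _ _ h1.2 h2.2 h1.1 h2.1, h1.2.add h2.2⟩
  obtain ⟨C, hC⟩ := hf.2
  refine hlim (fun n => SimpleFunc.approxOn f hf.1 Set.univ 0 (Set.mem_univ 0) n) f (C + C)
    (fun n => SimpleFunc.measurable _) (fun n z => ?_) (fun z => ?_) fun n => (hsimple _).1
  · exact (SimpleFunc.norm_approxOn_zero_le hf.1 (Set.mem_univ 0) z n).trans
      (add_le_add (hC z) (hC z))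
  · exact SimpleFunc.tendsto_approxOn hf.1 (Set.mem_univ 0) (by simp)

/-! ### Operators represented by a family of measures -/

section FormIntegral

variable {V : Type*} [NormedAddCommGroup V] [InnerProductSpace ℂ V]

theorem inner_eq_polarization (B : V →L[ℂ] V) (x y : V) :
    ⟪y, B x⟫_ℂ = (⟪x + y, B (x + y)⟫_ℂ - ⟪x - y, B (x - y)⟫_ℂ
      + Complex.I * ⟪x + Complex.I • y, B (x + Complex.I • y)⟫_ℂ
      - Complex.I * ⟪x - Complex.I • y, B (x - Complex.I • y)⟫_ℂ) / 4 := by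
  simp only [map_add, map_sub, map_smul, inner_add_left, inner_add_right, inner_sub_left,
    inner_sub_right, inner_smul_left, inner_smul_right, Complex.conj_I]
  ring_nf
  simp only [Complex.I_sq]
  ring

theorem ext_inner_self {B C : V →L[ℂ] V} (h : ∀ x, ⟪x, B x⟫_ℂ = ⟪x, C x⟫_ℂ) : B = C := by
  ext x
  refine ext_inner_left ℂ fun y => ?_
  rw [inner_eq_polarization B, inner_eq_polarization C]
  simp only [h]

theorem tendsto_inner_of_tendsto_inner_self {B : ℕ → V →L[ℂ] V} {q : V → ℂ}
    (h : ∀ x, Tendsto (fun n => ⟪x, B n x⟫_ℂ) atTop (𝓝 (q x))) (x y : V) :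
    Tendsto (fun n => ⟪y, B n x⟫_ℂ) atTop (𝓝 ((q (x + y) - q (x - y)
      + Complex.I * q (x + Complex.I • y) - Complex.I * q (x - Complex.I • y)) / 4)) := by
  simp only [fun n => inner_eq_polarization (B n) x y]
  exact ((((h _).sub (h _)).add ((h _).const_mul _)).sub ((h _).const_mul _)).div_const _

theorem tendsto_inner_of_forall_self {B : ℕ → V →L[ℂ] V} {C : V →L[ℂ] V}
    (h : ∀ x, Tendsto (fun n => ⟪x, B n x⟫_ℂ) atTop (𝓝 ⟪x, C x⟫_ℂ)) (x y : V) :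
    Tendsto (fun n => ⟪y, B n x⟫_ℂ) atTop (𝓝 ⟪y, C x⟫_ℂ) := by
  rw [inner_eq_polarization C]
  exact tendsto_inner_of_tendsto_inner_self h x y

/-- A sequence of bounded operators whose quadratic forms converge pointwise has a weak limit. -/
theorem exists_weak_limit [CompleteSpace V] {B : ℕ → V →L[ℂ] V} {q : V → ℂ}
    (h : ∀ x, Tendsto (fun n => ⟪x, B n x⟫_ℂ) atTop (𝓝 (q x))) :
    ∃ C : V →L[ℂ] V, ∀ x, ⟪x, C x⟫_ℂ = q x := by
  set l : V → V → ℂ := fun y x => (q (x + y) - q (x - y)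
      + Complex.I * q (x + Complex.I • y) - Complex.I * q (x - Complex.I • y)) / 4
  have hl : ∀ x y, Tendsto (fun n => ⟪y, B n x⟫_ℂ) atTop (𝓝 (l y x)) := fun x y =>
    tendsto_inner_of_tendsto_inner_self h x y
  have hl' : ∀ x y, Tendsto (fun n => ⟪B n x, y⟫_ℂ) atTop (𝓝 (star (l y x))) := fun x y => by
    simpa using (hl x y).star
  -- The uniform boundedness principle is used twice: for the functionals `y ↦ ⟪B n x, y⟫` with `x`
  -- fixed, and then for the operators `B n`. The resulting bound makes the limit form continuous.
  have hpt : ∀ x, ∃ C, ∀ n, ‖B n x‖ ≤ C := by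
    intro x
    obtain ⟨C, hC⟩ := banach_steinhaus (g := fun n => innerSL ℂ (B n x)) fun y => by
      obtain ⟨C, hC⟩ := (hl' x y).norm.bddAbove_range
      exact ⟨C, fun n => hC ⟨n, rfl⟩⟩
    exact ⟨C, fun n => by simpa using hC n⟩
  obtain ⟨C, hC⟩ := banach_steinhaus hpt
  have hbound : ∀ x y, ‖star (l y x)‖ ≤ C * ‖x‖ * ‖y‖ := fun x y =>
    le_of_tendsto (hl' x y).norm <| Eventually.of_forall fun n =>
      (norm_inner_le_norm _ _).trans (mul_le_mul_of_nonneg_right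
        ((B n).le_of_opNorm_le (hC n) x) (norm_nonneg _))
  -- Nothing is assumed about `q`; sesquilinearity of the limit is inherited from the approximating
  -- forms by uniqueness of limits.
  let S : V →ₗ⋆[ℂ] V →ₗ[ℂ] ℂ := LinearMap.mk₂'ₛₗ (starRingEnd ℂ) (RingHom.id ℂ)
    (fun x y => star (l y x))
    (fun x x' y => tendsto_nhds_unique (hl' (x + x') y) (by
      simpa [inner_add_left] using (hl' x y).add (hl' x' y)))
    (fun c x y => tendsto_nhds_unique (hl' (c • x) y) (by
      simpa [inner_smul_left, mul_comm] using (hl' x y).const_mul (star c)))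
    (fun x y y' => tendsto_nhds_unique (hl' x (y + y')) (by
      simpa [inner_add_right] using (hl' x y).add (hl' x y')))
    (fun c x y => tendsto_nhds_unique (hl' x (c • y)) (by
      simpa [inner_smul_right] using (hl' x y).const_mul c))
  refine ⟨InnerProductSpace.continuousLinearMapOfBilin (S.mkContinuous₂ C hbound), fun x => ?_⟩
  rw [← inner_conj_symm, InnerProductSpace.continuousLinearMapOfBilin_apply]
  refine (tendsto_nhds_unique (?_ : Tendsto _ atTop (𝓝 _)) (h x))
  simpa [S] using hl x x

variable {μ : V → Measure ℂ}

/-- `(B x, x) = ∫ h dμ_x` for all `x`. -/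
def IsFormIntegral (μ : V → Measure ℂ) (h : ℂ → ℂ) (B : V →L[ℂ] V) : Prop :=
  ∀ x, ⟪x, B x⟫_ℂ = ∫ z, h z ∂(μ x)

namespace IsFormIntegral

theorem unique {h : ℂ → ℂ} {B C : V →L[ℂ] V} (hB : IsFormIntegral μ h B)
    (hC : IsFormIntegral μ h C) : B = C :=
  ext_inner_self fun x => (hB x).trans (hC x).symm

theorem smul {h : ℂ → ℂ} {B : V →L[ℂ] V} (hB : IsFormIntegral μ h B) (c : ℂ) :
    IsFormIntegral μ (c • h) (c • B) := fun x => by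
  simp only [smul_apply, inner_smul_right, hB x, Pi.smul_apply, smul_eq_mul,
    integral_const_mul]

theorem star [CompleteSpace V] {h : ℂ → ℂ} {B : V →L[ℂ] V} (hB : IsFormIntegral μ h B) :
    IsFormIntegral μ (fun z => star (h z)) (star B) := fun x => by
  rw [ContinuousLinearMap.star_eq_adjoint, ContinuousLinearMap.adjoint_inner_right,
    ← inner_conj_symm, hB x]
  exact integral_conj.symm

variable [∀ x, IsFiniteMeasure (μ x)]

theorem add {f g : ℂ → ℂ} {B C : V →L[ℂ] V} (hf : IsBoundedBorel f) (hg : IsBoundedBorel g)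
    (hB : IsFormIntegral μ f B) (hC : IsFormIntegral μ g C) :
    IsFormIntegral μ (f + g) (B + C) := fun x => by
  simp only [add_apply, inner_add_right, hB x, hC x, Pi.add_apply]
  exact (integral_add (hf.integrable _) (hg.integrable _)).symm

/-- Only one factor varies, so weak convergence suffices: it is tested at the pair `(C x, x)`, and
dominated convergence handles the integrals. -/
theorem mul_of_tendsto_left {f : ℕ → ℂ → ℂ} {f' g : ℂ → ℂ} {M : ℝ} {B : ℕ → V →L[ℂ] V}
    {D C : V →L[ℂ] V} (hf : ∀ n, Measurable (f n)) (hM : ∀ n z, ‖f n z‖ ≤ M)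
    (h : ∀ z, Tendsto (fun n => f n z) atTop (𝓝 (f' z)))
    (hw : ∀ x y, Tendsto (fun n => ⟪y, B n x⟫_ℂ) atTop (𝓝 ⟪y, D x⟫_ℂ)) (hg : IsBoundedBorel g)
    (hBC : ∀ n, IsFormIntegral μ (f n * g) (B n * C)) : IsFormIntegral μ (f' * g) (D * C) := by
  obtain ⟨M', hM'⟩ := hg.2
  refine fun x => tendsto_nhds_unique (hw (C x) x) ?_
  have h2 := IsBoundedBorel.tendsto_integral (f := fun n => f n * g) (g := f' * g) (C := M * M')
    (fun n => (hf n).mul hg.1) (fun n z => ?_) (fun z => (h z).mul_const _) (μ x)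
  · refine h2.congr fun n => ?_
    rw [← hBC n x, mul_apply_eq_comp]
  · rw [Pi.mul_apply, norm_mul]
    exact mul_le_mul (hM n z) (hM' z) (norm_nonneg _) ((norm_nonneg _).trans (hM n z))

variable [CompleteSpace V]

/-- Dominated convergence makes the quadratic forms converge, and `exists_weak_limit` turns their
limit into an operator. Weak convergence is recorded as well, since the product lemmas need it off
the diagonal. -/
theorem exists_of_tendsto {f : ℕ → ℂ → ℂ} {g : ℂ → ℂ} {C : ℝ} {B : ℕ → V →L[ℂ] V}
    (hf : ∀ n, Measurable (f n)) (hC : ∀ n z, ‖f n z‖ ≤ C)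
    (h : ∀ z, Tendsto (fun n => f n z) atTop (𝓝 (g z)))
    (hB : ∀ n, IsFormIntegral μ (f n) (B n)) :
    ∃ D, IsFormIntegral μ g D ∧
      ∀ x y, Tendsto (fun n => ⟪y, B n x⟫_ℂ) atTop (𝓝 ⟪y, D x⟫_ℂ) := by
  have key : ∀ x, Tendsto (fun n => ⟪x, B n x⟫_ℂ) atTop (𝓝 (∫ z, g z ∂(μ x))) := fun x => by
    simpa only [fun n => hB n x] using IsBoundedBorel.tendsto_integral hf hC h (μ x)
  obtain ⟨D, hD⟩ := exists_weak_limit key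
  refine ⟨D, hD, tendsto_inner_of_forall_self fun x => ?_⟩
  rw [hD]
  exact key x

theorem exists_of_isBoundedBorel
    (hF : ∀ F : Set ℂ, IsClosed F → ∃ P, IsFormIntegral μ (F.indicator 1) P)
    {f : ℂ → ℂ} (hf : IsBoundedBorel f) : ∃ B, IsFormIntegral μ f B := by
  refine IsBoundedBorel.induction (Q := fun f => ∃ B, IsFormIntegral μ f B) hF ?_ ?_ ?_ hf
  · rintro f g hf hg ⟨B, hB⟩ ⟨C, hC⟩
    exact ⟨_, hB.add hf hg hC⟩
  · rintro c f hf ⟨B, hB⟩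
    exact ⟨_, hB.smul c⟩
  · intro f g C hf hC h hB
    choose B hB using hB
    obtain ⟨D, hD, -⟩ := exists_of_tendsto hf hC h hB
    exact ⟨D, hD⟩

/-- As for the left factor, after moving `C` to the other side of the inner product as its adjoint.
-/
theorem mul_of_tendsto_right {f : ℕ → ℂ → ℂ} {f' g : ℂ → ℂ} {M : ℝ} {B : ℕ → V →L[ℂ] V}
    {D C : V →L[ℂ] V} (hf : ∀ n, Measurable (f n)) (hM : ∀ n z, ‖f n z‖ ≤ M)
    (h : ∀ z, Tendsto (fun n => f n z) atTop (𝓝 (f' z)))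
    (hw : ∀ x y, Tendsto (fun n => ⟪y, B n x⟫_ℂ) atTop (𝓝 ⟪y, D x⟫_ℂ)) (hg : IsBoundedBorel g)
    (hBC : ∀ n, IsFormIntegral μ (g * f n) (C * B n)) : IsFormIntegral μ (g * f') (C * D) := by
  obtain ⟨M', hM'⟩ := hg.2
  refine fun x => tendsto_nhds_unique
    (by simpa [ContinuousLinearMap.star_eq_adjoint, ContinuousLinearMap.adjoint_inner_left]
      using hw x (Star.star C x)) ?_
  have h2 := IsBoundedBorel.tendsto_integral (f := fun n => g * f n) (g := g * f') (C := M' * M)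
    (fun n => hg.1.mul (hf n)) (fun n z => ?_) (fun z => (h z).const_mul _) (μ x)
  · refine h2.congr fun n => ?_
    rw [← hBC n x, mul_apply_eq_comp]
  · rw [Pi.mul_apply, norm_mul]
    exact mul_le_mul (hM' z) (hM n z) (norm_nonneg _) ((norm_nonneg _).trans (hM' z))

/-- The induction carries the existence of the operator together with the product formula, so that
in the limit step both concern the same weak limit. -/
theorem exists_mul_of_left {g : ℂ → ℂ} (hg : IsBoundedBorel g) {C : V →L[ℂ] V}
    (hF : ∀ F : Set ℂ, IsClosed F → ∃ P, IsFormIntegral μ (F.indicator 1) P ∧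
      IsFormIntegral μ (F.indicator 1 * g) (P * C))
    {f : ℂ → ℂ} (hf : IsBoundedBorel f) :
    ∃ B, IsFormIntegral μ f B ∧ IsFormIntegral μ (f * g) (B * C) := by
  refine IsBoundedBorel.induction
    (Q := fun f => ∃ B, IsFormIntegral μ f B ∧ IsFormIntegral μ (f * g) (B * C)) hF ?_ ?_ ?_ hf
  · rintro f f' hf hf' ⟨B, hB, h⟩ ⟨B', hB', h'⟩
    exact ⟨_, hB.add hf hf' hB', by
      rw [add_mul, add_mul]; exact h.add (hf.mul hg) (hf'.mul hg) h'⟩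
  · rintro c f hf ⟨B, hB, h⟩
    exact ⟨_, hB.smul c, by rw [smul_mul_assoc, smul_mul_assoc]; exact h.smul c⟩
  · intro f f' M hf hM h hB
    choose B hB hBC using hB
    obtain ⟨D, hD, hw⟩ := exists_of_tendsto hf hM h hB
    exact ⟨D, hD, mul_of_tendsto_left hf hM h hw hg hBC⟩

theorem exists_mul_of_right {g : ℂ → ℂ} (hg : IsBoundedBorel g) {C : V →L[ℂ] V}
    (hF : ∀ F : Set ℂ, IsClosed F → ∃ P, IsFormIntegral μ (F.indicator 1) P ∧
      IsFormIntegral μ (g * F.indicator 1) (C * P))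
    {f : ℂ → ℂ} (hf : IsBoundedBorel f) :
    ∃ B, IsFormIntegral μ f B ∧ IsFormIntegral μ (g * f) (C * B) := by
  refine IsBoundedBorel.induction
    (Q := fun f => ∃ B, IsFormIntegral μ f B ∧ IsFormIntegral μ (g * f) (C * B)) hF ?_ ?_ ?_ hf
  · rintro f f' hf hf' ⟨B, hB, h⟩ ⟨B', hB', h'⟩
    exact ⟨_, hB.add hf hf' hB', by
      rw [mul_add, mul_add]; exact h.add (hg.mul hf) (hg.mul hf') h'⟩
  · rintro c f hf ⟨B, hB, h⟩
    exact ⟨_, hB.smul c, by rw [mul_smul_comm, mul_smul_comm]; exact h.smul c⟩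
  · intro f f' M hf hM h hB
    choose B hB hBC using hB
    obtain ⟨D, hD, hw⟩ := exists_of_tendsto hf hM h hB
    exact ⟨D, hD, mul_of_tendsto_right hf hM h hw hg hBC⟩

/-- If the operators representing indicators of closed sets multiply like the sets intersect,
then the operators representing bounded Borel functions multiply like the functions. -/
theorem mul
    (hF : ∀ F F' : Set ℂ, IsClosed F → IsClosed F' → ∃ P P', IsFormIntegral μ (F.indicator 1) P ∧
      IsFormIntegral μ (F'.indicator 1) P' ∧
      IsFormIntegral μ (F.indicator 1 * F'.indicator 1) (P * P'))
    {f g : ℂ → ℂ} (hf : IsBoundedBorel f) (hg : IsBoundedBorel g) {B C : V →L[ℂ] V}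
    (hB : IsFormIntegral μ f B) (hC : IsFormIntegral μ g C) :
    IsFormIntegral μ (f * g) (B * C) := by
  -- The second factor is extended from indicators to `g` while the first stays an indicator; only
  -- then is the first factor extended.
  have hleft : ∀ F : Set ℂ, IsClosed F → ∃ P, IsFormIntegral μ (F.indicator 1) P ∧
      IsFormIntegral μ (F.indicator 1 * g) (P * C) := fun F hFc => by
    obtain ⟨P, -, hP, -⟩ := hF F F hFc hFc
    obtain ⟨C', hC', h'⟩ := exists_mul_of_right (μ := μ) (C := P)
      (isBoundedBorel_indicator_one hFc.measurableSet) (fun F' hFc' => by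
        obtain ⟨P₁, P₂, h1, h2, h3⟩ := hF F F' hFc hFc'
        exact ⟨P₂, h2, by rwa [hP.unique h1]⟩) hg
    exact ⟨P, hP, by rwa [hC.unique hC']⟩
  obtain ⟨B', hB', h⟩ := exists_mul_of_left (μ := μ) hg hleft hf
  rwa [hB.unique hB']

end IsFormIntegral

end FormIntegral

/-! ### Integration with respect to a spectral measure -/

theorem integral_indicator_one_complex {Δ : Set ℂ} (hΔ : MeasurableSet Δ) (μ : Measure ℂ) :
    ∫ z, Δ.indicator (1 : ℂ → ℂ) z ∂μ = (μ.real Δ : ℂ) := by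
  rw [integral_indicator hΔ]
  simp

namespace SpectralMeasure

variable {V : Type*} [NormedAddCommGroup V] [InnerProductSpace ℂ V] [CompleteSpace V]
  (E : SpectralMeasure V)

instance isFiniteMeasure_scalarMeasure (x : V) : IsFiniteMeasure (E.scalarMeasure x) :=
  ⟨by rw [E.scalarMeasure_apply x MeasurableSet.univ]; exact ENNReal.ofReal_lt_top⟩

theorem isFormIntegral_proj {Δ : Set ℂ} (hΔ : MeasurableSet Δ) :
    IsFormIntegral E.scalarMeasure (Δ.indicator 1) (E.proj Δ) := fun x => by
  rw [integral_indicator_one_complex hΔ, Measure.real, E.scalarMeasure_apply x hΔ, E.inner_proj Δ hΔ x,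
    Complex.ofReal_re, ENNReal.toReal_ofReal (by positivity)]

theorem exists_isIntegral {f : ℂ → ℂ} (hf : IsBoundedBorel f) : ∃ B, E.IsIntegral f B :=
  IsFormIntegral.exists_of_isBoundedBorel
    (fun _ hF => ⟨_, E.isFormIntegral_proj hF.measurableSet⟩) hf

variable {E}

theorem IsIntegral.mul {f g : ℂ → ℂ} (hf : IsBoundedBorel f) (hg : IsBoundedBorel g)
    {B C : V →L[ℂ] V} (hB : E.IsIntegral f B) (hC : E.IsIntegral g C) :
    E.IsIntegral (f * g) (B * C) := by
  refine IsFormIntegral.mul (fun F F' hF hF' => ⟨_, _, E.isFormIntegral_proj hF.measurableSet,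
    E.isFormIntegral_proj hF'.measurableSet, ?_⟩) hf hg hB hC
  rw [← E.proj_inter _ _ hF.measurableSet hF'.measurableSet, ← Set.inter_indicator_one]
  exact E.isFormIntegral_proj (hF.measurableSet.inter hF'.measurableSet)

theorem isIntegral_one : E.IsIntegral 1 1 := by
  have h := E.isFormIntegral_proj MeasurableSet.univ
  rwa [E.proj_univ, Set.indicator_univ] at h

/-- Only the values on a set of full `E`-measure are relevant. -/
theorem IsIntegral.congr {Δ : Set ℂ} (hΔ : MeasurableSet Δ) (h1 : E.proj Δ = 1) {f g : ℂ → ℂ}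
    (hfg : Set.EqOn f g Δ) {B : V →L[ℂ] V} (hB : E.IsIntegral f B) : E.IsIntegral g B := by
  intro x
  rw [hB x]
  refine integral_congr_ae ?_
  have h2 : E.scalarMeasure x Δᶜ = 0 := by
    rw [measure_compl hΔ (measure_ne_top _ _), E.scalarMeasure_apply x hΔ,
      E.scalarMeasure_apply x MeasurableSet.univ, E.proj_univ, h1, tsub_self]
  filter_upwards [compl_mem_ae_iff.2 h2] with z hz
  exact hfg (by simpa using hz)

end SpectralMeasure

/-! ### The spectral theorem for bounded normal operators -/

section SpectralTheorem

variable {V : Type*} [NormedAddCommGroup V] [InnerProductSpace ℂ V] [CompleteSpace V]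

/-- The inclusion of the real valued into the complex valued continuous functions. -/
def ContinuousMap.complexify {X : Type*} [TopologicalSpace X] : C(X, ℝ) →ₗ[ℝ] C(X, ℂ) where
  toFun f := ⟨fun z => (f z : ℂ), by fun_prop⟩
  map_add' f g := by ext; simp
  map_smul' c f := by ext; simp

/-- The functional `f ↦ ⟪x, f(M) x⟫` on real continuous functions on the compact spectrum is
positive. Riesz–Markov represents it by a measure, which is pushed forward to `ℂ`. -/
theorem exists_measure_of_normal {M : V →L[ℂ] V} (hM : IsStarNormal M) (x : V) :
    ∃ μ : Measure ℂ, IsFiniteMeasure μ ∧ μ (spectrum ℂ M)ᶜ = 0 ∧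
      ∀ f : ℂ → ℂ, Continuous f → ⟪x, cfc f M x⟫_ℂ = ∫ z, f z ∂μ := by
  have hcpt : CompactSpace (spectrum ℂ M) := isCompact_iff_compactSpace.1 (spectrum.isCompact M)
  have hreal : ∀ f : C(spectrum ℂ M, ℝ),
      ((⟪x, cfcHom hM (ContinuousMap.complexify f) x⟫_ℂ).re : ℂ)
        = ⟪x, cfcHom hM (ContinuousMap.complexify f) x⟫_ℂ := by
    intro f
    have hs : IsSelfAdjoint (cfcHom hM (ContinuousMap.complexify f)) := by
      refine IsSelfAdjoint.map ?_ (cfcHom hM)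
      ext z
      simp [ContinuousMap.complexify]
    refine Complex.conj_eq_iff_re.1 ?_
    rw [inner_conj_symm]
    exact hs.isSymmetric x x
  let L : CompactlySupportedContinuousMap (spectrum ℂ M) ℝ →ₗ[ℝ] ℝ :=
    { toFun := fun f => (⟪x, cfcHom hM (ContinuousMap.complexify f.toContinuousMap) x⟫_ℂ).re
      map_add' := fun f g => by
        have e : (f + g).toContinuousMap = f.toContinuousMap + g.toContinuousMap := rfl
        rw [e, map_add, map_add, add_apply, inner_add_right, Complex.add_re]
      map_smul' := fun c f => by
        have e : (c • f).toContinuousMap = c • f.toContinuousMap := rfl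
        have e2 : cfcHom hM (c • ContinuousMap.complexify f.toContinuousMap)
            = (c : ℂ) • cfcHom hM (ContinuousMap.complexify f.toContinuousMap) := by
          rw [← map_smul (cfcHom hM)]
          congr 1
        rw [e, map_smul, e2, smul_apply, inner_smul_right,
          Complex.re_ofReal_mul]
        rfl }
  have hLpos : ∀ f, 0 ≤ f → 0 ≤ L f := by
    intro f hf
    have h0 : (0 : C(spectrum ℂ M, ℂ)) ≤ ContinuousMap.complexify f.toContinuousMap := by
      intro z
      simpa [ContinuousMap.complexify] using hf z
    have h1 : 0 ≤ cfcHom hM (ContinuousMap.complexify f.toContinuousMap) :=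
      (cfcHom_nonneg_iff hM).2 h0
    exact ((ContinuousLinearMap.nonneg_iff_isPositive _).1 h1).re_inner_nonneg_right x
  let Λ := PositiveLinearMap.mk₀ L hLpos
  have hΛ : ∀ f : C(spectrum ℂ M, ℝ), ⟪x, cfcHom hM (ContinuousMap.complexify f) x⟫_ℂ
      = ∫ z, (f z : ℂ) ∂(RealRMK.rieszMeasure Λ) := by
    intro f
    have h1 := RealRMK.integral_rieszMeasure Λ (CompactlySupportedContinuousMap.continuousMapEquiv f)
    rw [integral_complex_ofReal, ← hreal]
    exact congrArg _ h1.symm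
  refine ⟨(RealRMK.rieszMeasure Λ).map Subtype.val, inferInstance, ?_, ?_⟩
  · rw [Measure.map_apply measurable_subtype_coe (spectrum.isCompact M).measurableSet.compl]
    convert measure_empty (μ := RealRMK.rieszMeasure Λ)
    ext z
    simp
  · intro f hf
    rw [integral_map measurable_subtype_coe.aemeasurable hf.aestronglyMeasurable,
      cfc_apply f M hM hf.continuousOn]
    have hint : ∀ g : C(spectrum ℂ M, ℝ),
        Integrable (fun z => (g z : ℂ)) (RealRMK.rieszMeasure Λ) := fun g =>
      (Continuous.integrable_of_hasCompactSupport g.continuous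
        (HasCompactSupport.of_compactSpace _)).ofReal
    let f₁ : C(spectrum ℂ M, ℝ) := ⟨fun z => (f z).re, by fun_prop⟩
    let f₂ : C(spectrum ℂ M, ℝ) := ⟨fun z => (f z).im, by fun_prop⟩
    have e : (⟨_, hf.continuousOn.domRestrict⟩ : C(spectrum ℂ M, ℂ))
        = ContinuousMap.complexify f₁ + Complex.I • ContinuousMap.complexify f₂ := by
      ext z
      simp [ContinuousMap.complexify, f₁, f₂, mul_comm Complex.I, Complex.re_add_im]
    rw [e, map_add, map_smul, add_apply, smul_apply,
      inner_add_right, inner_smul_right, hΛ, hΛ, ← integral_const_mul,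
      ← integral_add (hint f₁) ((hint f₂).const_mul _)]
    refine integral_congr_ae (ae_of_all _ fun z => ?_)
    simp [f₁, f₂, mul_comm Complex.I, Complex.re_add_im]

/-- The continuous functions approximating the indicator of a closed set. -/
theorem exists_continuous_tendsto_indicator {F : Set ℂ} (hF : IsClosed F) :
    ∃ f : ℕ → ℂ → ℂ, (∀ n, Continuous (f n)) ∧ (∀ n z, ‖f n z‖ ≤ 1) ∧
      ∀ z, Tendsto (fun n => f n z) atTop (𝓝 (F.indicator 1 z)) := by
  refine ⟨fun n z => ((hF.apprSeq n z : ℝ) : ℂ), fun n => ?_, fun n z => ?_, fun z => ?_⟩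
  · have := (hF.apprSeq n).continuous
    fun_prop
  · have h := HasOuterApproxClosed.apprSeq_apply_le_one hF n z
    rw [Complex.norm_real, Real.norm_of_nonneg (NNReal.coe_nonneg _)]
    exact_mod_cast h
  · have h := tendsto_pi_nhds.1 (HasOuterApproxClosed.tendsto_apprSeq hF) z
    have h2 : Tendsto (fun n => ((hF.apprSeq n z : ℝ) : ℂ)) atTop
        (𝓝 (((F.indicator (fun _ => (1 : NNReal)) z : NNReal) : ℝ) : ℂ)) :=
      (Complex.continuous_ofReal.comp NNReal.continuous_coe).continuousAt.tendsto.comp h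
    convert h2 using 2
    by_cases hz : z ∈ F <;> simp [hz]

/-- The spectral theorem: a bounded normal operator has a spectral measure. -/
theorem exists_isSpectralMeasureOf {M : V →L[ℂ] V} (hM : IsStarNormal M) :
    ∃ E : SpectralMeasure V, E.IsSpectralMeasureOf M := by
  choose μ hfin hσ hcont using exists_measure_of_normal hM
  have hcont' : ∀ f : ℂ → ℂ, Continuous f → IsFormIntegral μ f (cfc f M) := fun f hf x =>
    hcont x f hf
  -- For continuous functions multiplicativity is that of the functional calculus. Both indicators
  -- are approximated by continuous functions, and the two limits are taken one at a time.
  have hclosed : ∀ F F' : Set ℂ, IsClosed F → IsClosed F' → ∃ P P',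
      IsFormIntegral μ (F.indicator 1) P ∧ IsFormIntegral μ (F'.indicator 1) P' ∧
      IsFormIntegral μ (F.indicator 1 * F'.indicator 1) (P * P') := by
    intro F F' hF hF'
    obtain ⟨f, hfc, hf1, hfl⟩ := exists_continuous_tendsto_indicator hF
    obtain ⟨g, hgc, hg1, hgl⟩ := exists_continuous_tendsto_indicator hF'
    obtain ⟨P, hP, hPw⟩ := IsFormIntegral.exists_of_tendsto (fun n => (hfc n).measurable) hf1 hfl
      fun n => hcont' _ (hfc n)
    obtain ⟨P', hP', hPw'⟩ := IsFormIntegral.exists_of_tendsto (fun n => (hgc n).measurable) hg1 hgl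
      fun n => hcont' _ (hgc n)
    refine ⟨P, P', hP, hP', ?_⟩
    refine IsFormIntegral.mul_of_tendsto_left (fun n => (hfc n).measurable) hf1 hfl hPw
      (isBoundedBorel_indicator_one hF'.measurableSet) fun n => ?_
    refine IsFormIntegral.mul_of_tendsto_right (fun n => (hgc n).measurable) hg1 hgl hPw'
      ⟨(hfc n).measurable, 1, hf1 n⟩ fun k => ?_
    have h := hcont' _ ((hfc n).mul (hgc k))
    rwa [show f n * g k = fun z => f n z * g k z from rfl,
      cfc_mul _ _ M (hfc n).continuousOn (hgc k).continuousOn] at h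
  -- `choose` needs an operator for every set; non-measurable sets receive the irrelevant value `0`.
  have hex : ∀ Δ : Set ℂ, ∃ P : V →L[ℂ] V, MeasurableSet Δ → IsFormIntegral μ (Δ.indicator 1) P := by
    intro Δ
    by_cases hΔ : MeasurableSet Δ
    · obtain ⟨P, hP⟩ := IsFormIntegral.exists_of_isBoundedBorel (μ := μ)
        (fun F hF => by obtain ⟨P, -, hP, -⟩ := hclosed F F hF hF; exact ⟨P, hP⟩)
        (isBoundedBorel_indicator_one hΔ)
      exact ⟨P, fun _ => hP⟩
    · exact ⟨0, fun h => absurd h hΔ⟩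
  choose P hP using hex
  have hinter : ∀ Δ Δ', MeasurableSet Δ → MeasurableSet Δ' → P (Δ ∩ Δ') = P Δ * P Δ' := by
    intro Δ Δ' h h'
    refine (hP _ (h.inter h')).unique ?_
    rw [Set.inter_indicator_one]
    exact IsFormIntegral.mul hclosed (isBoundedBorel_indicator_one h)
      (isBoundedBorel_indicator_one h') (hP _ h) (hP _ h')
  have hproj : ∀ Δ, MeasurableSet Δ → IsStarProjection (P Δ) := by
    intro Δ h
    refine ⟨by rw [IsIdempotentElem, ← hinter Δ Δ h h, Set.inter_self], ?_⟩
    refine (hP _ h).star.unique ?_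
    convert hP _ h using 1
    ext z
    by_cases hz : z ∈ Δ <;> simp [hz]
  have hinner : ∀ Δ, MeasurableSet Δ → ∀ x, ⟪x, P Δ x⟫_ℂ = ((μ x).real Δ : ℂ) := by
    intro Δ h x
    rw [hP Δ h x, integral_indicator_one_complex h]
  have hnorm : ∀ Δ, MeasurableSet Δ → ∀ x, ‖P Δ x‖ ^ 2 = (μ x).real Δ := by
    intro Δ h x
    have h1 : ⟪P Δ x, P Δ x⟫_ℂ = ⟪x, P Δ (P Δ x)⟫_ℂ := (hproj Δ h).isSelfAdjoint.isSymmetric x _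
    rw [← mul_apply_eq_comp, (hproj Δ h).isIdempotentElem.eq, hinner Δ h,
      inner_self_eq_norm_sq_to_K] at h1
    rw [← Complex.ofReal_inj, ← h1]
    simp
  have huniv : P Set.univ = 1 := by
    refine (hP _ MeasurableSet.univ).unique ?_
    rw [Set.indicator_univ]
    have h := hcont' 1 continuous_one
    rwa [Pi.one_def, cfc_const_one ℂ M] at h
  have hsum : ∀ Δ : ℕ → Set ℂ, (∀ n, MeasurableSet (Δ n)) →
      Pairwise (Function.onFun Disjoint Δ) → ∀ x,
      HasSum (fun n => P (Δ n) x) (P (⋃ n, Δ n) x) := by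
    intro Δ hΔ hd x
    have hU : MeasurableSet (⋃ n, Δ n) := MeasurableSet.iUnion hΔ
    have h1 : HasSum (fun n => (μ x).real (Δ n)) ((μ x).real (⋃ n, Δ n)) := by
      have h2 := measure_iUnion hd hΔ (μ := μ x)
      have h3 : ∑' n, μ x (Δ n) ≠ ⊤ := h2 ▸ measure_ne_top _ _
      rw [Measure.real, h2, ENNReal.tsum_toReal_eq fun n => measure_ne_top _ _]
      exact ENNReal.hasSum_toReal h3
    -- The difference is, up to sign, the projection of the remaining set applied to `x`, and its
    -- squared norm is the measure of that set. Strong additivity thus reduces to additivity of `μ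
    -- x`.
    have h2 : ∀ s : Finset ℕ, ‖∑ n ∈ s, P (Δ n) x - P (⋃ n, Δ n) x‖ ^ 2
        = (μ x).real (⋃ n, Δ n) - ∑ n ∈ s, (μ x).real (Δ n) := by
      intro s
      have hs : MeasurableSet (⋃ n ∈ s, Δ n) := Finset.measurableSet_biUnion _ fun i _ => hΔ i
      have hsub : (⋃ n ∈ s, Δ n) ⊆ ⋃ n, Δ n := Set.iUnion₂_subset fun i _ => Set.subset_iUnion Δ i
      have h4 : P ((⋃ n, Δ n) \ ⋃ n ∈ s, Δ n) = P (⋃ n, Δ n) - ∑ n ∈ s, P (Δ n) := by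
        refine ext_inner_self fun y => ?_
        rw [hinner _ (hU.diff hs), sub_apply, inner_sub_right, hinner _ hU,
          measureReal_sdiff hsub hs, measureReal_biUnion_finset (fun i _ j _ hij => hd hij)
            (fun i _ => hΔ i), sum_apply, inner_sum]
        simp only [hinner _ (hΔ _)]
        push_cast
        rfl
      rw [← norm_neg, neg_sub]
      have h5 : P (⋃ n, Δ n) x - ∑ n ∈ s, P (Δ n) x = P ((⋃ n, Δ n) \ ⋃ n ∈ s, Δ n) x := by
        rw [h4, sub_apply, sum_apply]
      rw [h5, hnorm _ (hU.diff hs), measureReal_sdiff hsub hs,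
        measureReal_biUnion_finset (fun i _ j _ hij => hd hij) (fun i _ => hΔ i)]
    have h3 : Tendsto (fun s : Finset ℕ => ‖∑ n ∈ s, P (Δ n) x - P (⋃ n, Δ n) x‖ ^ 2) atTop (𝓝 0) := by
      simp only [h2]
      simpa using (tendsto_const_nhds (x := (μ x).real (⋃ n, Δ n))).sub h1
    rw [HasSum, SummationFilter.unconditional_filter, tendsto_iff_norm_sub_tendsto_zero]
    have h4 := h3.sqrt
    simpa [Real.sqrt_sq (norm_nonneg _)] using h4
  let E : SpectralMeasure V := ⟨P, hproj, huniv, hinter, hsum⟩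
  have hE : ∀ x, E.scalarMeasure x = μ x := by
    intro x
    ext Δ hΔ
    rw [E.scalarMeasure_apply x hΔ]
    change ENNReal.ofReal (⟪x, P Δ x⟫_ℂ).re = _
    rw [hinner Δ hΔ, Complex.ofReal_re, ofReal_measureReal]
  have hσm : MeasurableSet (spectrum ℂ M) := (spectrum.isCompact M).measurableSet
  refine ⟨E, ?_, fun x => ?_⟩
  · refine ext_inner_self fun x => ?_
    change ⟪x, P _ x⟫_ℂ = _
    rw [← huniv, hinner _ hσm, hinner _ MeasurableSet.univ, Measure.real, Measure.real,
      ← add_zero (μ x (spectrum ℂ M)), ← hσ x, measure_add_measure_compl hσm]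
  · rw [hE, ← hcont x (fun z => z) continuous_id, cfc_id' ℂ M]

end SpectralTheorem

/-! ### Polynomials in two commuting elements -/

section PairEval

variable {R : Type*} [Ring R] [Algebra ℂ R]

open scoped IsMulCommutative in
-- Evaluation of polynomials takes place in a commutative algebra; the subalgebra generated by two
-- commuting elements is one.
theorem exists_pairEval {a b : R} (h : Commute a b) :
    ∃ e : MvPolynomial (Fin 2) ℂ →ₐ[ℂ] R, e (.X 0) = a ∧ e (.X 1) = b := by
  have hcomm : ∀ x ∈ ({a, b} : Set R), ∀ y ∈ ({a, b} : Set R), x * y = y * x := by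
    rintro x (rfl | rfl) y (rfl | rfl)
    exacts [rfl, h.eq, h.eq.symm, rfl]
  have := Algebra.isMulCommutative_adjoin ℂ hcomm
  let v : Fin 2 → Algebra.adjoin ℂ ({a, b} : Set R) :=
    ![⟨a, Algebra.subset_adjoin (by simp)⟩, ⟨b, Algebra.subset_adjoin (by simp)⟩]
  refine ⟨(Algebra.adjoin ℂ ({a, b} : Set R)).val.comp (MvPolynomial.aeval v), ?_, ?_⟩
  · simp [v]
  · simp [v]

/-- Evaluation of polynomials in two variables at a pair of commuting elements. -/
def pairEval {a b : R} (h : Commute a b) : MvPolynomial (Fin 2) ℂ →ₐ[ℂ] R :=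
  (exists_pairEval h).choose

variable {a b : R} (h : Commute a b)

@[simp] theorem pairEval_X_zero : pairEval h (.X 0) = a := (exists_pairEval h).choose_spec.1

@[simp] theorem pairEval_X_one : pairEval h (.X 1) = b := (exists_pairEval h).choose_spec.2

@[simp] theorem pairEval_C (c : ℂ) : pairEval h (.C c) = algebraMap ℂ R c :=
  (pairEval h).commutes c

theorem pairEval_eq_sum (s : MvPolynomial (Fin 2) ℂ) :
    pairEval h s = ∑ m ∈ s.support, s.coeff m • (a ^ m 0 * b ^ m 1) := by
  conv_lhs => rw [s.as_sum, map_sum]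
  refine Finset.sum_congr rfl fun m _ => ?_
  rw [MvPolynomial.monomial_eq, map_mul, pairEval_C, Algebra.smul_def,
    Finsupp.prod_fintype _ _ (by simp), Fin.prod_univ_two]
  simp

theorem pairEval_aeval_zero (r : Polynomial ℂ) :
    pairEval h (Polynomial.aeval (.X 0) r) = Polynomial.aeval a r := by
  rw [← Polynomial.aeval_algHom_apply, pairEval_X_zero]

theorem pairEval_aeval_one (r : Polynomial ℂ) :
    pairEval h (Polynomial.aeval (.X 1) r) = Polynomial.aeval b r := by
  rw [← Polynomial.aeval_algHom_apply, pairEval_X_one]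

theorem commute_pairEval {c : R} (ha : Commute c a) (hb : Commute c b)
    (s : MvPolynomial (Fin 2) ℂ) : Commute c (pairEval h s) := by
  induction s using MvPolynomial.induction_on with
  | C r => rw [pairEval_C]; exact Algebra.commute_algebraMap_right r c
  | add s t hs ht => rw [map_add]; exact hs.add_right ht
  | mul_X s i hs =>
    rw [map_mul]
    refine hs.mul_right ?_
    fin_cases i
    · simpa using ha
    · simpa using hb

end PairEval

/-- Applied with `S = T*`, this lets polynomials in `A, B` pass through `T*` as polynomials in
`Θ(A), Θ(B)`. -/
theorem pairEval_intertwine {V W : Type*} [NormedAddCommGroup V] [NormedSpace ℂ V]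
    [NormedAddCommGroup W] [NormedSpace ℂ W] {a b : V →L[ℂ] V} {A B : W →L[ℂ] W}
    (h : Commute a b) (H : Commute A B) {S : W →L[ℂ] V} (ha : a ∘L S = S ∘L A)
    (hb : b ∘L S = S ∘L B) (s : MvPolynomial (Fin 2) ℂ) :
    pairEval h s ∘L S = S ∘L pairEval H s := by
  induction s using MvPolynomial.induction_on with
  | C r => ext x; simp [Algebra.algebraMap_eq_smul_one]
  | add s t hs ht => rw [map_add, map_add, ContinuousLinearMap.add_comp,
      ContinuousLinearMap.comp_add, hs, ht]
  | mul_X s i hs =>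
    have hX : pairEval h (.X i) ∘L S = S ∘L pairEval H (.X i) := by
      fin_cases i
      · simpa using ha
      · simpa using hb
    have e1 : pairEval h (s * .X i) = pairEval h s ∘L pairEval h (.X i) := map_mul _ _ _
    have e2 : pairEval H (s * .X i) = pairEval H s ∘L pairEval H (.X i) := map_mul _ _ _
    rw [e1, e2, ContinuousLinearMap.comp_assoc, hX, ← ContinuousLinearMap.comp_assoc, hs,
      ContinuousLinearMap.comp_assoc]

/-- The function `z ↦ s(Re z, Im z)`. -/
def evalReIm (s : MvPolynomial (Fin 2) ℂ) (z : ℂ) : ℂ :=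
  MvPolynomial.eval ![(z.re : ℂ), (z.im : ℂ)] s

theorem continuous_evalReIm (s : MvPolynomial (Fin 2) ℂ) : Continuous (evalReIm s) := by
  refine (MvPolynomial.continuous_eval s).comp (continuous_pi fun i => ?_)
  fin_cases i
  · exact Complex.continuous_ofReal.comp Complex.continuous_re
  · exact Complex.continuous_ofReal.comp Complex.continuous_im

/-- A polynomial in the real and imaginary part of a normal element, in terms of the continuous
functional calculus. -/
theorem pairEval_eq_cfc {R : Type*} [CStarAlgebra R] {M a b : R} [IsStarNormal M]
    (h : Commute a b) (ha : a = (1 / 2 : ℂ) • (M + star M))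
    (hb : b = (1 / (2 * Complex.I)) • (M - star M)) (s : MvPolynomial (Fin 2) ℂ) :
    pairEval h s = cfc (evalReIm s) M := by
  have hc : Continuous fun z : ℂ => star z := continuous_star
  have h0 : cfc (evalReIm (.X 0)) M = a := by
    have e : evalReIm (.X 0) = fun z => (1 / 2 : ℂ) * (z + star z) := by
      ext z
      simp [evalReIm, Complex.add_conj]
    rw [e, cfc_const_mul _ (fun z => z + star z) M (continuous_id.add hc).continuousOn,
      cfc_add M (fun z => z) (fun z => star z) continuousOn_id hc.continuousOn, cfc_star_id M,
      cfc_id' ℂ M, ha]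
  have h1 : cfc (evalReIm (.X 1)) M = b := by
    have e : evalReIm (.X 1) = fun z => (1 / (2 * Complex.I)) * (z - star z) := by
      ext z
      simp [evalReIm, Complex.sub_conj]
      field_simp
      simp
    rw [e, cfc_const_mul _ (fun z => z - star z) M (continuous_id.sub hc).continuousOn,
      cfc_sub (fun z => z) (fun z => star z) M continuousOn_id hc.continuousOn, cfc_star_id M,
      cfc_id' ℂ M, hb]
  induction s using MvPolynomial.induction_on with
  | C c =>
    have e : evalReIm (.C c) = fun _ => c := by ext z; simp [evalReIm]
    rw [e, cfc_const c M, pairEval_C]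
  | add s t hs ht =>
    have e : evalReIm (s + t) = fun z => evalReIm s z + evalReIm t z := by
      ext z; simp [evalReIm]
    rw [e, cfc_add M _ _ (continuous_evalReIm s).continuousOn (continuous_evalReIm t).continuousOn,
      map_add, hs, ht]
  | mul_X s i hs =>
    have e : evalReIm (s * .X i) = fun z => evalReIm s z * evalReIm (.X i) z := by
      ext z; simp [evalReIm]
    rw [e, cfc_mul _ _ M (continuous_evalReIm s).continuousOn
      (continuous_evalReIm (.X i)).continuousOn, map_mul, hs]
    congr 1
    fin_cases i
    · exact (pairEval_X_zero h).trans h0.symm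
    · exact (pairEval_X_one h).trans h1.symm

/-! ### Real and imaginary parts in a Krein space -/

section Krein

variable {K : Type*} [NormedAddCommGroup K] [InnerProductSpace ℂ K] [CompleteSpace K]
  [KreinSpace K]

theorem kreinForm_conj_symm (x y : K) : star (kreinForm x y) = kreinForm y x := by
  simp only [kreinForm, RCLike.star_def]
  rw [inner_conj_symm, inner_J_left]

theorem kreinForm_right (C : K →L[ℂ] K) (x y : K) :
    kreinForm x (C y) = kreinForm (kreinAdjoint C x) y := by
  rw [← kreinForm_conj_symm, kreinForm_kreinAdjoint, kreinForm_conj_symm]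

theorem kreinRe_add_I_smul_kreinIm (N : K →L[ℂ] K) :
    kreinRe N + Complex.I • kreinIm N = N := by
  have h : Complex.I * (1 / (2 * Complex.I)) = 1 / 2 := by field_simp
  rw [kreinRe, kreinIm, smul_smul, h, ← smul_add, add_add_sub_cancel, ← two_smul ℂ N, smul_smul]
  simp

theorem kreinRe_sub_I_smul_kreinIm (N : K →L[ℂ] K) :
    kreinRe N - Complex.I • kreinIm N = kreinAdjoint N := by
  have h : Complex.I * (1 / (2 * Complex.I)) = 1 / 2 := by field_simp
  rw [kreinRe, kreinIm, smul_smul, h, ← smul_sub, add_sub_sub_cancel,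
    ← two_smul ℂ (kreinAdjoint N), smul_smul]
  simp

theorem isUnit_kreinAdjoint {C : K →L[ℂ] K} (hC : IsUnit C) : IsUnit (kreinAdjoint C) := by
  have hJ : IsUnit (KreinSpace.J : K →L[ℂ] K) :=
    ⟨⟨_, _, KreinSpace.J_mul_J, KreinSpace.J_mul_J⟩, rfl⟩
  exact (hJ.mul hC.star).mul hJ

end Krein

namespace DefinitizableNormal

variable {K : Type*} [NormedAddCommGroup K] [InnerProductSpace ℂ K] [CompleteSpace K]
  [KreinSpace K] (D : DefinitizableNormal K)

/-! ### The operators `Θ(A)` and `Θ(B)` -/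

theorem A_add_I_smul_B : D.A + Complex.I • D.B = D.N := kreinRe_add_I_smul_kreinIm D.N

theorem A_sub_I_smul_B : D.A - Complex.I • D.B = kreinAdjoint D.N :=
  kreinRe_sub_I_smul_kreinIm D.N

theorem commute_AB : Commute D.A D.B := by
  have h : Commute D.N (kreinAdjoint D.N) := D.normal
  refine Commute.smul_left (Commute.smul_right ?_ _) _
  exact ((Commute.refl _).sub_right h).add_left (h.symm.sub_right (Commute.refl _))

/-- `s(A, B)` as an algebra homomorphism. -/
def evalAB : MvPolynomial (Fin 2) ℂ →ₐ[ℂ] (K →L[ℂ] K) := pairEval D.commute_AB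

theorem polyOp_eq (s : MvPolynomial (Fin 2) ℂ) : D.polyOp s = D.evalAB s :=
  (pairEval_eq_sum _ s).symm

/-- The polynomial `p(z)` in two variables. -/
def pPoly : MvPolynomial (Fin 2) ℂ := Polynomial.aeval (.X 0) (D.p.map (algebraMap ℝ ℂ))

/-- The polynomial `q(w)` in two variables. -/
def qPoly : MvPolynomial (Fin 2) ℂ := Polynomial.aeval (.X 1) (D.q.map (algebraMap ℝ ℂ))

theorem pqPoly_eq : D.pqPoly = D.pPoly + D.qPoly := rfl

theorem evalAB_pPoly : D.evalAB D.pPoly = D.pA := pairEval_aeval_zero _ _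

theorem evalAB_qPoly : D.evalAB D.qPoly = D.qB := pairEval_aeval_one _ _

theorem evalAB_pqPoly : D.evalAB D.pqPoly = D.pA + D.qB := by
  rw [pqPoly_eq, map_add, evalAB_pPoly, evalAB_qPoly]

theorem commute_kreinAdjoint_sum : Commute (kreinAdjoint D.N) (D.pA + D.qB) := by
  have h : Commute D.N (kreinAdjoint D.N) := D.normal
  rw [← evalAB_pqPoly]
  exact commute_pairEval _ ((h.symm.add_right (Commute.refl _)).smul_right _)
    ((h.symm.sub_right (Commute.refl _)).smul_right _) _

/-- `T*` has dense range, so operators on `V` may be compared after composition with it. Together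
with cancellation of the injective `T`, this transfers identities between `K` and `V`. -/
theorem ext_comp_Tstar {W : Type*} [NormedAddCommGroup W] [NormedSpace ℂ W] {S S' : D.V →L[ℂ] W}
    (h : S ∘L D.Tstar = S' ∘L D.Tstar) : S = S' :=
  ContinuousLinearMap.coeFn_injective ((denseRange_gramEmb (D.pA + D.qB) D.sum_nonneg).equalizer
    S.continuous S'.continuous (funext fun x => congrArg (fun f : K →L[ℂ] W => f x) h))

theorem ext_T_comp {S S' : D.V →L[ℂ] D.V} (h : D.T ∘L S = D.T ∘L S') : S = S' := by
  ext x
  exact gramT_injective _ D.sum_nonneg (congrArg (fun f : D.V →L[ℂ] K => f x) h)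

theorem T_comp_Tstar : D.T ∘L D.Tstar = D.pA + D.qB := gramT_gramEmb _ _

theorem ThetaN_comp_Tstar : D.ThetaN ∘L D.Tstar = D.Tstar ∘L D.N := by
  ext x
  exact gramTheta_gramEmb _ _ _ D.commute_sum x

/-- `Θ` carries the Krein space adjoint to the Hilbert space adjoint: the inner product on the range
of `T*` is `[(p(A) + q(B)) x, y]`, and `N*` commutes with `p(A) + q(B)`. -/
theorem star_ThetaN_comp_Tstar : star D.ThetaN ∘L D.Tstar = D.Tstar ∘L kreinAdjoint D.N := by
  ext x
  refine (denseRange_gramEmb (D.pA + D.qB) D.sum_nonneg).eq_of_inner_right (𝕜 := ℂ) fun y => ?_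
  simp only [ContinuousLinearMap.comp_apply]
  rw [ContinuousLinearMap.star_eq_adjoint, ContinuousLinearMap.adjoint_inner_right]
  have h := congrArg (fun f : K →L[ℂ] D.V => f y) D.ThetaN_comp_Tstar
  simp only [ContinuousLinearMap.comp_apply] at h
  change ⟪D.ThetaN (D.Tstar y), _⟫_ℂ = _
  rw [h]
  change ⟪gramEmb _ _ _, gramEmb _ _ _⟫_ℂ = ⟪gramEmb _ _ _, gramEmb _ _ _⟫_ℂ
  rw [gramEmb_inner, gramEmb_inner, kreinForm_right]
  exact congrArg (fun f : K →L[ℂ] K => kreinForm (f x) y) D.commute_kreinAdjoint_sum.eq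

instance isStarNormal_ThetaN : IsStarNormal D.ThetaN := by
  refine ⟨D.ext_comp_Tstar ?_⟩
  have e1 : star D.ThetaN * D.ThetaN = star D.ThetaN ∘L D.ThetaN := rfl
  have e2 : D.ThetaN * star D.ThetaN = D.ThetaN ∘L star D.ThetaN := rfl
  rw [e1, e2, ContinuousLinearMap.comp_assoc, ThetaN_comp_Tstar, ContinuousLinearMap.comp_assoc,
    star_ThetaN_comp_Tstar, ← ContinuousLinearMap.comp_assoc, star_ThetaN_comp_Tstar,
    ← ContinuousLinearMap.comp_assoc, ThetaN_comp_Tstar, ContinuousLinearMap.comp_assoc,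
    ContinuousLinearMap.comp_assoc]
  exact congrArg (fun f => D.Tstar ∘L f) D.normal.symm

/-- `Θ(A)`, the real part of `Θ(N)`. -/
def ThetaA : D.V →L[ℂ] D.V := (1 / 2 : ℂ) • (D.ThetaN + star D.ThetaN)

/-- `Θ(B)`, the imaginary part of `Θ(N)`. -/
def ThetaB : D.V →L[ℂ] D.V := (1 / (2 * Complex.I)) • (D.ThetaN - star D.ThetaN)

theorem commute_ThetaAB : Commute D.ThetaA D.ThetaB := by
  have h : Commute D.ThetaN (star D.ThetaN) := D.isStarNormal_ThetaN.star_comm_self.symm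
  refine Commute.smul_left (Commute.smul_right ?_ _) _
  exact ((Commute.refl _).sub_right h).add_left (h.symm.sub_right (Commute.refl _))

theorem ThetaA_comp_Tstar : D.ThetaA ∘L D.Tstar = D.Tstar ∘L D.A := by
  rw [ThetaA, A, kreinRe, ContinuousLinearMap.smul_comp, ContinuousLinearMap.add_comp,
    ContinuousLinearMap.comp_smul, ContinuousLinearMap.comp_add, ThetaN_comp_Tstar,
    star_ThetaN_comp_Tstar]

theorem ThetaB_comp_Tstar : D.ThetaB ∘L D.Tstar = D.Tstar ∘L D.B := by
  rw [ThetaB, B, kreinIm, ContinuousLinearMap.smul_comp, ContinuousLinearMap.sub_comp,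
    ContinuousLinearMap.comp_smul, ContinuousLinearMap.comp_sub, ThetaN_comp_Tstar,
    star_ThetaN_comp_Tstar]

/-- `s(Θ(A), Θ(B))` as an algebra homomorphism. -/
def evalTheta : MvPolynomial (Fin 2) ℂ →ₐ[ℂ] (D.V →L[ℂ] D.V) := pairEval D.commute_ThetaAB

theorem evalTheta_comp_Tstar (s : MvPolynomial (Fin 2) ℂ) :
    D.evalTheta s ∘L D.Tstar = D.Tstar ∘L D.evalAB s :=
  pairEval_intertwine _ _ D.ThetaA_comp_Tstar D.ThetaB_comp_Tstar s

/-- After composition with `T*`, both sides are products of `s(A, B)` and `p(A) + q(B) = T T*`, in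
opposite orders, and these commute. -/
theorem T_comp_evalTheta (s : MvPolynomial (Fin 2) ℂ) :
    D.T ∘L D.evalTheta s = D.evalAB s ∘L D.T := by
  refine D.ext_comp_Tstar ?_
  rw [ContinuousLinearMap.comp_assoc, evalTheta_comp_Tstar, ← ContinuousLinearMap.comp_assoc,
    T_comp_Tstar, ContinuousLinearMap.comp_assoc, T_comp_Tstar, ← evalAB_pqPoly]
  change D.evalAB _ * D.evalAB _ = D.evalAB _ * D.evalAB _
  rw [← map_mul, ← map_mul, mul_comm]

/-- `T (T* T) = (p(A) + q(B)) T = T (p + q)(Θ(A), Θ(B))`, and `T` can be cancelled. -/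
theorem Tstar_comp_T : D.Tstar ∘L D.T = D.evalTheta D.pqPoly := by
  refine D.ext_T_comp ?_
  rw [T_comp_evalTheta, evalAB_pqPoly, ← ContinuousLinearMap.comp_assoc, T_comp_Tstar]

/-! ### The operators `R₁ R₁*` and `R₂ R₂*` -/

theorem T_comp_R₁R₁_comp_Tstar : D.T ∘L D.R₁R₁ ∘L D.Tstar = D.evalAB D.pPoly := by
  have h1 : D.T ∘L D.R₁ = gramT D.pA D.pA_nonneg := gramT_gramR _ _ _ _ _
  have h2 : ContinuousLinearMap.adjoint D.R₁ ∘L D.Tstar = gramEmb D.pA D.pA_nonneg := by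
    ext x
    exact adjoint_gramR_gramEmb _ _ _ _ _ x
  rw [R₁R₁, ContinuousLinearMap.comp_assoc, h2, ← ContinuousLinearMap.comp_assoc, h1, gramT_gramEmb,
    evalAB_pPoly]

theorem T_comp_R₂R₂_comp_Tstar : D.T ∘L D.R₂R₂ ∘L D.Tstar = D.evalAB D.qPoly := by
  have h1 : D.T ∘L D.R₂ = gramT D.qB D.qB_nonneg := gramT_gramR _ _ _ _ _
  have h2 : ContinuousLinearMap.adjoint D.R₂ ∘L D.Tstar = gramEmb D.qB D.qB_nonneg := by
    ext x
    exact adjoint_gramR_gramEmb _ _ _ _ _ x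
  rw [R₂R₂, ContinuousLinearMap.comp_assoc, h2, ← ContinuousLinearMap.comp_assoc, h1, gramT_gramEmb,
    evalAB_qPoly]

/-- Since `(p + q)(Θ(A), Θ(B)) = T* T`, one has `T X T* T = r(A, B) T = T r(Θ(A), Θ(B))`, and `T`
cancels; cancelling `T*` gives the other order. For `X = R_j R_j*` this yields the commutation with
`T* T` and the comparison of `p`, `q` with `p + q` on the spectrum. -/
theorem mul_pqPoly_of_T_comp {X : D.V →L[ℂ] D.V} {r : MvPolynomial (Fin 2) ℂ}
    (h : D.T ∘L X ∘L D.Tstar = D.evalAB r) :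
    X * D.evalTheta D.pqPoly = D.evalTheta r ∧ D.evalTheta D.pqPoly * X = D.evalTheta r := by
  rw [← Tstar_comp_T]
  constructor
  · refine D.ext_T_comp ?_
    rw [T_comp_evalTheta, ← h]
    rfl
  · refine D.ext_comp_Tstar ?_
    rw [evalTheta_comp_Tstar, ← h]
    rfl

theorem R₁R₁_mul : D.R₁R₁ * D.evalTheta D.pqPoly = D.evalTheta D.pPoly :=
  (D.mul_pqPoly_of_T_comp D.T_comp_R₁R₁_comp_Tstar).1

theorem mul_R₁R₁ : D.evalTheta D.pqPoly * D.R₁R₁ = D.evalTheta D.pPoly :=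
  (D.mul_pqPoly_of_T_comp D.T_comp_R₁R₁_comp_Tstar).2

theorem R₂R₂_mul : D.R₂R₂ * D.evalTheta D.pqPoly = D.evalTheta D.qPoly :=
  (D.mul_pqPoly_of_T_comp D.T_comp_R₂R₂_comp_Tstar).1

theorem mul_R₂R₂ : D.evalTheta D.pqPoly * D.R₂R₂ = D.evalTheta D.qPoly :=
  (D.mul_pqPoly_of_T_comp D.T_comp_R₂R₂_comp_Tstar).2

theorem evalTheta_eq_cfc (s : MvPolynomial (Fin 2) ℂ) :
    D.evalTheta s = cfc (evalReIm s) D.ThetaN :=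
  pairEval_eq_cfc _ rfl rfl s

end DefinitizableNormal

/-! ### Functions of a normal operator -/

namespace SpectralMeasure

variable {V : Type*} [NormedAddCommGroup V] [InnerProductSpace ℂ V] [CompleteSpace V]
  {E : SpectralMeasure V}

theorem isBoundedBorel_indicator_of_continuous {Δ : Set ℂ} (hΔ : IsCompact Δ) {f : ℂ → ℂ}
    (hf : Continuous f) : IsBoundedBorel (Δ.indicator f) := by
  obtain ⟨C, hC⟩ := hΔ.exists_bound_of_continuousOn hf.continuousOn
  refine ⟨hf.measurable.indicator hΔ.measurableSet, max C 0, fun z => ?_⟩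
  by_cases hz : z ∈ Δ
  · rw [Set.indicator_of_mem hz]
    exact (hC z hz).trans (le_max_left _ _)
  · rw [Set.indicator_of_notMem hz, norm_zero]
    exact le_max_right _ _

/-- Products of integrals are available for bounded functions only, and polynomials are unbounded on
`ℂ`. Cutting off outside the spectrum costs nothing because `E` is concentrated there. -/
theorem IsSpectralMeasureOf.isIntegral_eval {M a b : V →L[ℂ] V} (hE : E.IsSpectralMeasureOf M)
    (h : Commute a b) (ha : a = (1 / 2 : ℂ) • (M + star M))
    (hb : b = (1 / (2 * Complex.I)) • (M - star M)) (s : MvPolynomial (Fin 2) ℂ) :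
    E.IsIntegral ((spectrum ℂ M).indicator (evalReIm s)) (pairEval h s) := by
  have hcpt := spectrum.isCompact (𝕜 := ℂ) M
  have hσ := hcpt.measurableSet
  have hbb : ∀ {f : ℂ → ℂ}, Continuous f → IsBoundedBorel ((spectrum ℂ M).indicator f) := fun hf =>
    isBoundedBorel_indicator_of_continuous hcpt hf
  have hc : Continuous fun z : ℂ => star z := continuous_star
  have hcongr : ∀ {f g : ℂ → ℂ} {B : V →L[ℂ] V}, Set.EqOn f g (spectrum ℂ M) →
      E.IsIntegral f B → E.IsIntegral g B := fun hfg hB => hB.congr hσ hE.1 hfg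
  have hind : ∀ f : ℂ → ℂ, Set.EqOn f ((spectrum ℂ M).indicator f) (spectrum ℂ M) := fun f =>
    Set.eqOn_indicator.symm
  have hid : E.IsIntegral ((spectrum ℂ M).indicator fun z => z) M := hcongr (hind _) hE.2
  have hstar : E.IsIntegral ((spectrum ℂ M).indicator fun z => star z) (star M) :=
    hcongr (hind _) (IsFormIntegral.star hE.2)
  have h0 : E.IsIntegral ((spectrum ℂ M).indicator (evalReIm (.X 0))) a := by
    have h1 := (IsFormIntegral.add (hbb continuous_id) (hbb hc) hid hstar).smul (1 / 2 : ℂ)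
    rw [ha]
    refine hcongr (fun z hz => ?_) h1
    simp [evalReIm, hz, Complex.add_conj]
  have h1 : E.IsIntegral ((spectrum ℂ M).indicator (evalReIm (.X 1))) b := by
    have h1 := (IsFormIntegral.add (hbb continuous_id) ((hbb hc).const_smul (-1)) hid
      (IsFormIntegral.smul hstar (-1))).smul (1 / (2 * Complex.I))
    rw [hb]
    rw [neg_one_smul, neg_one_smul, ← sub_eq_add_neg, ← sub_eq_add_neg] at h1
    refine hcongr (fun z hz => ?_) h1
    simp [evalReIm, hz, Complex.sub_conj]
    field_simp
    simp
  induction s using MvPolynomial.induction_on with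
  | C c =>
    have h2 := IsFormIntegral.smul (isIntegral_one (E := E)) c
    rw [pairEval_C, Algebra.algebraMap_eq_smul_one]
    refine hcongr (fun z hz => ?_) h2
    simp [evalReIm, hz]
  | add s t hs ht =>
    rw [map_add]
    refine hcongr (fun z hz => ?_) (IsFormIntegral.add (hbb (continuous_evalReIm s))
      (hbb (continuous_evalReIm t)) hs ht)
    simp [evalReIm, hz]
  | mul_X s i hs =>
    rw [map_mul]
    have hX : E.IsIntegral ((spectrum ℂ M).indicator (evalReIm (.X i))) (pairEval h (.X i)) := by
      fin_cases i
      · simpa using h0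
      · simpa using h1
    refine hcongr (fun z hz => ?_) (hs.mul (hbb (continuous_evalReIm s))
      (hbb (continuous_evalReIm (.X i))) hX)
    simp [evalReIm, hz]

/-- The integral of a function that is bounded away from zero is invertible. -/
theorem IsIntegral.exists_inverse {f : ℂ → ℂ} (hf : IsBoundedBorel f) {L : V →L[ℂ] V}
    (hL : E.IsIntegral f L) {Δ : Set ℂ} (hΔ : MeasurableSet Δ) (h1 : E.proj Δ = 1) {δ : ℝ}
    (hδ : 0 < δ) (hfδ : ∀ z ∈ Δ, δ ≤ ‖f z‖) : ∃ W, L * W = 1 ∧ W * L = 1 := by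
  have hg : IsBoundedBorel (Δ.indicator fun z => (f z)⁻¹) := by
    refine ⟨hf.1.inv.indicator hΔ, δ⁻¹, fun z => ?_⟩
    by_cases hz : z ∈ Δ
    · rw [Set.indicator_of_mem hz, norm_inv]
      exact inv_anti₀ hδ (hfδ z hz)
    · rw [Set.indicator_of_notMem hz, norm_zero]
      positivity
  have hne : ∀ z ∈ Δ, f z ≠ 0 := fun z hz => norm_pos_iff.1 (hδ.trans_le (hfδ z hz))
  obtain ⟨W, hW⟩ := E.exists_isIntegral hg
  refine ⟨W, IsFormIntegral.unique (IsIntegral.congr hΔ h1 (fun z hz => ?_) (hL.mul hf hg hW))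
    (isIntegral_one (E := E)), IsFormIntegral.unique (IsIntegral.congr hΔ h1 (fun z hz => ?_)
    (hW.mul hg hf hL)) (isIntegral_one (E := E))⟩
  · simp [hz, hne z hz]
  · simp [hz, hne z hz]

end SpectralMeasure

/-! ### Invertibility modulo the ideal generated by `p(z)` and `q(w)` -/

/-- Over `ℂ` the polynomial splits into linear factors. The leading coefficient is a unit, so a
prime ideal containing the product contains one of these factors. -/
theorem exists_X_sub_C_mem_of_aeval_mem {P : Ideal (MvPolynomial (Fin 2) ℂ)} [hP : P.IsPrime]
    {f : Polynomial ℂ} (hf : f ≠ 0) {i : Fin 2} (h : Polynomial.aeval (.X i) f ∈ P) :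
    ∃ a, f.eval a = 0 ∧ (.X i - .C a : MvPolynomial (Fin 2) ℂ) ∈ P := by
  have h2 := (IsAlgClosed.splits f).eq_prod_roots
  rw [h2, map_mul, map_multiset_prod, Multiset.map_map, Polynomial.aeval_C] at h
  have h3 : algebraMap ℂ (MvPolynomial (Fin 2) ℂ) f.leadingCoeff ∉ P := fun hmem =>
    hP.ne_top (Ideal.eq_top_of_isUnit_mem _ hmem
      ((IsUnit.mk0 _ (Polynomial.leadingCoeff_ne_zero.2 hf)).map _))
  obtain ⟨x, hx, hxP⟩ := (hP.multiset_prod_mem_iff_exists_mem _).1 ((hP.mem_or_mem h).resolve_left h3)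
  obtain ⟨a, ha, rfl⟩ := Multiset.mem_map.1 hx
  refine ⟨a, (Polynomial.mem_roots hf).1 ha, ?_⟩
  simpa using hxP

/-- Modulo an ideal containing every `X i - a i`, a polynomial is congruent to its value at `a`. -/
theorem sub_C_eval_mem {P : Ideal (MvPolynomial (Fin 2) ℂ)} {a : Fin 2 → ℂ}
    (h : ∀ i, (.X i - .C (a i) : MvPolynomial (Fin 2) ℂ) ∈ P) (s : MvPolynomial (Fin 2) ℂ) :
    s - .C (MvPolynomial.eval a s) ∈ P := by
  induction s using MvPolynomial.induction_on with
  | C c => simp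
  | add s t hs ht =>
    rw [map_add, map_add, add_sub_add_comm]
    exact P.add_mem hs ht
  | mul_X s i hs =>
    have e : s * .X i - .C (MvPolynomial.eval a (s * .X i))
        = (s - .C (MvPolynomial.eval a s)) * .X i
          + .C (MvPolynomial.eval a s) * (.X i - .C (a i)) := by
      simp only [map_mul, MvPolynomial.eval_X]
      ring
    rw [e]
    exact P.add_mem (P.mul_mem_right _ hs) (P.mul_mem_left _ (h i))

/-- If every common zero of `s`, `f(z)`, `g(w)` is a zero of a polynomial that `e` maps to a unit,
then `e` maps an element of the ideal generated by `s`, `f(z)`, `g(w)` to a unit. -/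
theorem exists_isUnit_of_common_zeros {R : Type*} [Ring R] [Algebra ℂ R]
    (e : MvPolynomial (Fin 2) ℂ →ₐ[ℂ] R) {f g : Polynomial ℂ} (hf : f ≠ 0) (hg : g ≠ 0)
    (s : MvPolynomial (Fin 2) ℂ)
    (h : ∀ a : Fin 2 → ℂ, f.eval (a 0) = 0 → g.eval (a 1) = 0 → MvPolynomial.eval a s = 0 →
      ∃ l, MvPolynomial.eval a l = 0 ∧ IsUnit (e l)) :
    ∃ t u v, IsUnit (e (s * t + Polynomial.aeval (.X 0) f * u + Polynomial.aeval (.X 1) g * v)) := by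
  by_contra! hcon
  set J : Ideal (MvPolynomial (Fin 2) ℂ) :=
    Ideal.span {s, Polynomial.aeval (.X 0) f, Polynomial.aeval (.X 1) g}
  -- `R` need not be commutative, but the preimage of its units is a multiplicative subset of the
  -- polynomial ring. If the ideal `J` misses it, some prime `P ⊇ J` does too. Such a `P` contains
  -- the vanishing ideal of a common zero, hence the polynomial `l` supplied by the hypothesis,
  -- whose image is a unit.
  have hdis : Disjoint (J : Set (MvPolynomial (Fin 2) ℂ)) ((IsUnit.submonoid R).comap e) := by
    rw [Set.disjoint_left]
    intro r hr hu
    obtain ⟨t, y, hy, rfl⟩ := Ideal.mem_span_insert.1 hr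
    obtain ⟨u, v, rfl⟩ := Ideal.mem_span_pair.1 hy
    refine hcon t u v ?_
    have h2 : IsUnit (e (t * s + (u * Polynomial.aeval (.X 0) f + v * Polynomial.aeval (.X 1) g))) :=
      hu
    convert! h2 using 2
    ring
  obtain ⟨P, hP, hJP, hPd⟩ := Ideal.exists_le_prime_disjoint J _ hdis
  have hmem : ∀ r ∈ ({s, Polynomial.aeval (.X 0) f, Polynomial.aeval (.X 1) g} : Set _), r ∈ P :=
    fun r hr => hJP (Ideal.subset_span hr)
  obtain ⟨a, ha, haP⟩ := exists_X_sub_C_mem_of_aeval_mem (i := 0) hf (hmem _ (by simp))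
  obtain ⟨b, hb, hbP⟩ := exists_X_sub_C_mem_of_aeval_mem (i := 1) hg (hmem _ (by simp))
  have hX : ∀ i, (.X i - .C (![a, b] i) : MvPolynomial (Fin 2) ℂ) ∈ P := by
    intro i
    fin_cases i
    · exact haP
    · exact hbP
  have hs : MvPolynomial.eval ![a, b] s = 0 := by
    by_contra hne
    refine hP.ne_top (Ideal.eq_top_of_isUnit_mem _ ?_ ((IsUnit.mk0 _ hne).map MvPolynomial.C))
    have h2 := P.sub_mem (hmem s (by simp)) (sub_C_eval_mem hX s)
    rwa [sub_sub_cancel] at h2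
  obtain ⟨l, hl, hu⟩ := h ![a, b] ha hb hs
  have hlP : l ∈ P := by simpa [hl] using sub_C_eval_mem hX l
  exact Set.disjoint_left.1 hPd hlP hu

/-- An invertibility criterion for `E s + Ξ G`, where `Ξ` is an additive map that behaves like
`S ↦ T S T*`. -/
theorem isUnit_add_of_quasi_inverse {P R R' : Type*} [CommRing P] [Algebra ℂ P] [Ring R]
    [Algebra ℂ R] [Ring R'] [Algebra ℂ R'] (E : P →ₐ[ℂ] R) (e : P →ₐ[ℂ] R') (Ξ : R' → R)
    (h₀ : ∀ S S', Ξ (S + S') = Ξ S + Ξ S') (h₁ : ∀ S t, Ξ S * E t = Ξ (S * e t))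
    (h₂ : ∀ S t, E t * Ξ S = Ξ (e t * S)) {d p q : P} (h₃ : ∀ S S', Ξ S * Ξ S' = Ξ (S * e d * S'))
    {X Y : R'} (hp : Ξ X = E p) (hq : Ξ Y = E q) {s t u v : P} {G L W : R'}
    (hr : IsUnit (E (s * t + p * u + q * v))) (hL : e s + G * e d = L)
    (hL' : e s + e d * G = L) (hW : L * W = 1) (hW' : W * L = 1) : IsUnit (E s + Ξ G) := by
  obtain ⟨Ξ, rfl⟩ : ∃ F : R' →+ R, F = Ξ := ⟨AddMonoidHom.mk' Ξ h₀, rfl⟩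
  -- In `(E s + Ξ G) (E t - Ξ S)` the part under `Ξ` is `G e(t) - L S`. It should equal `X e(u) + Y
  -- e(v)`, because `Ξ X = E p` and `Ξ Y = E q`; solving for `S` gives `W M`.
  obtain ⟨M, hM⟩ : ∃ M, M = G * e t - X * e u - Y * e v :=
    ⟨_, rfl⟩
  obtain ⟨M', hM'⟩ :
      ∃ M', M' = e t * G - e u * X - e v * Y := ⟨_, rfl⟩
  have hright : (E s + Ξ G) * (E t - Ξ (W * M))
      = E (s * t + p * u + q * v) := by
    have h1 : Ξ (e s * (W * M)) + Ξ (G * e d * (W * M))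
        = Ξ M := by
      rw [← map_add Ξ, ← add_mul, hL, ← mul_assoc, hW, one_mul]
    rw [hM, map_sub Ξ, map_sub Ξ, ← hM] at h1
    rw [add_mul, mul_sub, mul_sub, h₁, h₂, h₃, map_add E, map_add E,
      map_mul E, map_mul E, map_mul E, ← hp, ← hq, h₁, h₁,
      eq_sub_of_add_eq h1]
    abel
  have hleft : (E t - Ξ (M' * W)) * (E s + Ξ G)
      = E (s * t + p * u + q * v) := by
    have h1 : Ξ (M' * W * e s) + Ξ (M' * W * e d * G)
        = Ξ M' := by
      rw [← map_add Ξ, mul_assoc (M' * W), ← mul_add, hL', mul_assoc, hW', mul_one]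
    rw [hM', map_sub Ξ, map_sub Ξ, ← hM'] at h1
    have h3 : s * t + p * u + q * v = t * s + u * p + v * q := by ring
    rw [sub_mul, mul_add, mul_add, h₁, h₂, h₃, h3, map_add E, map_add E,
      map_mul E, map_mul E, map_mul E, ← hp, ← hq, h₂, h₂,
      eq_sub_of_add_eq h1]
    abel
  -- The two quasi-inverses need not agree and nothing is assumed to commute with them, so a right
  -- and a left inverse are produced separately.
  rw [isUnit_iff_exists_and_exists]
  obtain ⟨U, hU⟩ := hr
  refine ⟨⟨(E t - Ξ (W * M)) * ↑U⁻¹, ?_⟩, ⟨↑U⁻¹ * (E t - Ξ (M' * W)), ?_⟩⟩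
  · rw [← mul_assoc, hright, ← hU, Units.mul_inv]
  · rw [mul_assoc, hleft, ← hU, Units.inv_mul]

namespace DefinitizableNormal

variable {K : Type*} [NormedAddCommGroup K] [InnerProductSpace ℂ K] [CompleteSpace K]
  [KreinSpace K] (D : DefinitizableNormal K)

theorem map_p_ne_zero : D.p.map (algebraMap ℝ ℂ) ≠ 0 :=
  (Polynomial.map_ne_zero_iff (algebraMap ℝ ℂ).injective).2 D.p_ne_zero

theorem map_q_ne_zero : D.q.map (algebraMap ℝ ℂ) ≠ 0 :=
  (Polynomial.map_ne_zero_iff (algebraMap ℝ ℂ).injective).2 D.q_ne_zero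

/-- The point `a + i b` belongs to the resolvent set of `N`, or `ā + i b̄` does. -/
theorem exists_isUnit_evalAB {a : Fin 2 → ℂ}
    (h : ¬ (a 0 + Complex.I * a 1 ∈ spectrum ℂ D.N ∧
      star (a 0) + Complex.I * star (a 1) ∈ spectrum ℂ D.N)) :
    ∃ l, MvPolynomial.eval a l = 0 ∧ IsUnit (D.evalAB l) := by
  have hX0 : D.evalAB (.X 0) = D.A := pairEval_X_zero _
  have hX1 : D.evalAB (.X 1) = D.B := pairEval_X_one _
  have hC : ∀ c, D.evalAB (.C c) = algebraMap ℂ _ c := pairEval_C _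
  rw [not_and_or, spectrum.notMem_iff, spectrum.notMem_iff] at h
  rcases h with h | h
  -- The value of this polynomial at `(A, B)` is `(a + i b) - N`.
  · refine ⟨.C (a 0 + Complex.I * a 1) - (.X 0 + .C Complex.I * .X 1), by simp, ?_⟩
    rw [map_sub D.evalAB, map_add D.evalAB, map_mul D.evalAB, hX0, hX1, hC, hC, ← Algebra.smul_def, D.A_add_I_smul_B]
    exact h
  -- Here the value is `(a - i b) - N*`, the Krein space adjoint of `(ā + i b̄) - N`.
  · refine ⟨.C (a 0 - Complex.I * a 1) - (.X 0 - .C Complex.I * .X 1), by simp, ?_⟩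
    rw [map_sub D.evalAB, map_sub D.evalAB, map_mul D.evalAB, hX0, hX1, hC, hC, ← Algebra.smul_def, D.A_sub_I_smul_B]
    convert! isUnit_kreinAdjoint h using 1
    have hs : star (algebraMap ℂ (K →L[ℂ] K) (star (a 0) + Complex.I * star (a 1)))
        = algebraMap ℂ (K →L[ℂ] K) (a 0 - Complex.I * a 1) := by
      rw [← algebraMap_star_comm]
      simp [sub_eq_add_neg]
    conv_rhs => rw [kreinAdjoint, star_sub, hs]
    rw [mul_sub, sub_mul, kreinAdjoint, ← Algebra.commutes,
      mul_assoc _ KreinSpace.J KreinSpace.J, KreinSpace.J_mul_J, mul_one]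

/-! ### The map `Ξ` -/

theorem Xi_add (S S' : D.V →L[ℂ] D.V) : D.Xi (S + S') = D.Xi S + D.Xi S' := by
  simp [Xi]

theorem Xi_mul_evalAB (S : D.V →L[ℂ] D.V) (t : MvPolynomial (Fin 2) ℂ) :
    D.Xi S * D.evalAB t = D.Xi (S * D.evalTheta t) := by
  have h : D.Xi (S * D.evalTheta t) = D.T ∘L S ∘L (D.evalTheta t ∘L D.Tstar) := rfl
  rw [h, evalTheta_comp_Tstar]
  rfl

theorem evalAB_mul_Xi (S : D.V →L[ℂ] D.V) (t : MvPolynomial (Fin 2) ℂ) :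
    D.evalAB t * D.Xi S = D.Xi (D.evalTheta t * S) := by
  have h : D.Xi (D.evalTheta t * S) = (D.T ∘L D.evalTheta t) ∘L S ∘L D.Tstar := rfl
  rw [h, T_comp_evalTheta]
  rfl

theorem Xi_mul_Xi (S S' : D.V →L[ℂ] D.V) :
    D.Xi S * D.Xi S' = D.Xi (S * D.evalTheta D.pqPoly * S') := by
  rw [← Tstar_comp_T]
  rfl

theorem Xi_R₁R₁ : D.Xi D.R₁R₁ = D.evalAB D.pPoly := D.T_comp_R₁R₁_comp_Tstar

theorem Xi_R₂R₂ : D.Xi D.R₂R₂ = D.evalAB D.qPoly := D.T_comp_R₂R₂_comp_Tstar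

/-- Invertibility of `s(A, B) + T G T*`. -/
theorem isUnit_evalAB_add_Xi {s t u v : MvPolynomial (Fin 2) ℂ} {G L W : D.V →L[ℂ] D.V}
    (hr : IsUnit (D.evalAB (s * t + D.pPoly * u + D.qPoly * v)))
    (hL : D.evalTheta s + G * D.evalTheta D.pqPoly = L)
    (hL' : D.evalTheta s + D.evalTheta D.pqPoly * G = L)
    (hW : L * W = 1) (hW' : W * L = 1) : IsUnit (D.evalAB s + D.Xi G) := by
  exact isUnit_add_of_quasi_inverse D.evalAB D.evalTheta D.Xi D.Xi_add D.Xi_mul_evalAB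
    D.evalAB_mul_Xi D.Xi_mul_Xi D.Xi_R₁R₁ D.Xi_R₂R₂ hr hL hL' hW hW'

end DefinitizableNormal

/-- `d I` and `I d` both integrate the product `g f`, hence coincide; `e + I d` integrates `h + g
f`, which is bounded away from zero on a set of full measure. -/
theorem SpectralMeasure.IsIntegral.exists_inverse_add_mul {V : Type*}
    [NormedAddCommGroup V] [InnerProductSpace ℂ V] [CompleteSpace V] {E : SpectralMeasure V}
    {f g h : ℂ → ℂ} (hf : IsBoundedBorel f) (hg : IsBoundedBorel g) (hh : IsBoundedBorel h)
    {d I e : V →L[ℂ] V} (hd : E.IsIntegral f d) (hI : E.IsIntegral g I) (he : E.IsIntegral h e)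
    {Δ : Set ℂ} (hΔ : MeasurableSet Δ) (h1 : E.proj Δ = 1) {δ : ℝ}
    (hδ : 0 < δ) (hfδ : ∀ z ∈ Δ, δ ≤ ‖h z + g z * f z‖) :
    d * I = I * d ∧ ∃ W, (e + I * d) * W = 1 ∧ W * (e + I * d) = 1 := by
  have hId := hI.mul hg hf hd
  have hdI := hd.mul hf hg hI
  rw [mul_comm] at hdI
  exact ⟨IsFormIntegral.unique hdI hId, SpectralMeasure.IsIntegral.exists_inverse
    (hh.add (hg.mul hf)) (IsFormIntegral.add hh (hg.mul hf) he hId) hΔ h1 hδ hfδ⟩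

/-- Each term vanishes against `d`, because `d` can be moved past `X` and `Y` to meet `P w`.
Finiteness of `S` is not needed, since a `finsum` with infinite support is `0`. -/
theorem finsum_annihilate {R ι : Type*} [Ring R] [Algebra ℂ R] {X Y d : R} (hX : X * d = d * X)
    (hY : Y * d = d * Y) (P : ι → R) {S : Set ι} (hP : ∀ w ∈ S, P w * d = 0 ∧ d * P w = 0)
    (g₁ g₂ : ι → ℂ) :
    (∑ᶠ w ∈ S, (g₁ w • (X * P w) + g₂ w • (Y * P w))) * d = 0 ∧
      d * (∑ᶠ w ∈ S, (g₁ w • (X * P w) + g₂ w • (Y * P w))) = 0 := by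
  refine finsum_mem_induction (fun r => r * d = 0 ∧ d * r = 0) ⟨zero_mul _, mul_zero _⟩ ?_ ?_
  · rintro r r' ⟨h1, h2⟩ ⟨h1', h2'⟩
    exact ⟨by rw [add_mul, h1, h1', add_zero], by rw [mul_add, h2, h2', add_zero]⟩
  · intro w hw
    obtain ⟨h1, h2⟩ := hP w hw
    have h3 : ∀ X : R, X * d = d * X → X * P w * d = 0 ∧ d * (X * P w) = 0 := fun X hX =>
      ⟨by rw [mul_assoc, h1, mul_zero], by rw [← mul_assoc, ← hX, mul_assoc, h2, mul_zero]⟩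
    obtain ⟨a1, a2⟩ := h3 X hX
    obtain ⟨b1, b2⟩ := h3 Y hY
    constructor
    · rw [add_mul, smul_mul_assoc, smul_mul_assoc, a1, b1, smul_zero, smul_zero, add_zero]
    · rw [mul_add, mul_smul_comm, mul_smul_comm, a2, b2, smul_zero, smul_zero, add_zero]

namespace DefinitizableNormal

variable {K : Type*} [NormedAddCommGroup K] [InnerProductSpace ℂ K] [CompleteSpace K]
  [KreinSpace K] (D : DefinitizableNormal K)

/-! ### Entries of the functions of the calculus -/

theorem isCompact_specTheta : IsCompact D.specTheta := spectrum.isCompact _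

theorem isClosed_Zreal : IsClosed D.Zreal :=
  (isClosed_eq (D.p.continuous.comp Complex.continuous_re) continuous_const).inter
    (isClosed_eq (D.q.continuous.comp Complex.continuous_im) continuous_const)

theorem measurableSet_diff : MeasurableSet (D.specTheta \ D.Zreal) :=
  D.isCompact_specTheta.measurableSet.diff D.isClosed_Zreal.measurableSet

theorem eval_map_p (x : ℝ) : (D.p.map (algebraMap ℝ ℂ)).eval (x : ℂ) = (D.p.eval x : ℝ) := by
  rw [Polynomial.eval_map_algebraMap, ← Complex.coe_algebraMap, Polynomial.aeval_algebraMap_apply,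
    Polynomial.coe_aeval_eq_eval]

theorem eval_map_q (x : ℝ) : (D.q.map (algebraMap ℝ ℂ)).eval (x : ℂ) = (D.q.eval x : ℝ) := by
  rw [Polynomial.eval_map_algebraMap, ← Complex.coe_algebraMap, Polynomial.aeval_algebraMap_apply,
    Polynomial.coe_aeval_eq_eval]

theorem dp_pos {ξ : ℂ} (h : (D.p.map (algebraMap ℝ ℂ)).eval ξ = 0) : 0 < D.dp ξ :=
  (Polynomial.rootMultiplicity_pos D.map_p_ne_zero).2 h

theorem dq_pos {η : ℂ} (h : (D.q.map (algebraMap ℝ ℂ)).eval η = 0) : 0 < D.dq η :=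
  (Polynomial.rootMultiplicity_pos D.map_q_ne_zero).2 h

theorem dp_pos_of_mem {z : ℂ} (hz : z ∈ D.Zreal) : 0 < D.dp z.re :=
  D.dp_pos (by rw [eval_map_p, hz.1, Complex.ofReal_zero])

theorem dq_pos_of_mem {z : ℂ} (hz : z ∈ D.Zreal) : 0 < D.dq z.im :=
  D.dq_pos (by rw [eval_map_q, hz.2, Complex.ofReal_zero])

theorem mem_index_inl {z : ↥(D.specTheta ∪ D.Zreal)} (hz : z.1 ∈ D.Zreal) {k l : ℕ} :
    (k, l) ∈ D.index (.inl z) ↔ (k < D.dp z.1.re ∧ l < D.dq z.1.im) ∨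
      (k = D.dp z.1.re ∧ l = 0) ∨ (k = 0 ∧ l = D.dq z.1.im) := by
  simp [index, hz]
  tauto

theorem mem_index_inl_of_notMem {z : ↥(D.specTheta ∪ D.Zreal)} (hz : z.1 ∉ D.Zreal) {k l : ℕ} :
    (k, l) ∈ D.index (.inl z) ↔ k = 0 ∧ l = 0 := by
  simp [index, hz]

theorem mem_index_inr {ζ : ↥D.Zimag} {k l : ℕ} :
    (k, l) ∈ D.index (.inr ζ) ↔ k < D.dp ζ.1.1 ∧ l < D.dq ζ.1.2 := by
  simp [index]

theorem entry_sub (φ ψ : D.MN) (x : D.Domain) (k l : ℕ) :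
    D.entry (φ - ψ) x k l = D.entry φ x k l - D.entry ψ x k l := by
  unfold entry
  split_ifs <;> simp

theorem entry_polyFun (s : MvPolynomial (Fin 2) ℂ) {x : D.Domain} {k l : ℕ}
    (h : (k, l) ∈ D.index x) : D.entry (D.polyFun s) x k l = taylorCoeff s (D.point x) k l := by
  rw [entry, dif_pos h]
  rfl

theorem taylorCoeff_zero_zero (s : MvPolynomial (Fin 2) ℂ) (a : ℂ × ℂ) :
    taylorCoeff s a 0 0 = MvPolynomial.eval ![a.1, a.2] s := by
  simp [taylorCoeff]

section Decomposition

variable {D} {φ : D.MN} {s : MvPolynomial (Fin 2) ℂ} {g₀ g₁ g₂ : ℂ → ℂ}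
  (h : D.IsDecomposition φ s g₀ g₁ g₂)
include h

/-- At points of `Z` both multiplicities are positive, so `(0, 0)` is among the indices at which `φ`
and `s_N` must agree. -/
theorem IsDecomposition.entry_of_mem_Zreal (z : ↥(D.specTheta ∪ D.Zreal)) (hz : z.1 ∈ D.Zreal) :
    D.entry φ (.inl z) 0 0 = evalReIm s z.1 := by
  have h1 := h.sub_mem.1 z hz 0 (D.dp_pos_of_mem hz) 0 (D.dq_pos_of_mem hz)
  rw [entry_sub, sub_eq_zero] at h1
  rw [h1, entry_polyFun _ _ ((D.mem_index_inl hz).2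
    (.inl ⟨D.dp_pos_of_mem hz, D.dq_pos_of_mem hz⟩)), taylorCoeff_zero_zero]
  rfl

theorem IsDecomposition.entry_inr (ζ : ↥D.Zimag) :
    D.entry φ (.inr ζ) 0 0 = MvPolynomial.eval ![ζ.1.1, ζ.1.2] s := by
  have h1 := h.sub_mem.2 ζ 0 (D.dp_pos ζ.2.1) 0 (D.dq_pos ζ.2.2.1)
  rw [entry_sub, sub_eq_zero] at h1
  rw [h1, entry_polyFun _ _ (D.mem_index_inr.2 ⟨D.dp_pos ζ.2.1, D.dq_pos ζ.2.2.1⟩),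
    taylorCoeff_zero_zero]
  rfl

theorem IsDecomposition.entry_of_notMem_Zreal (z : ↥D.specTheta) (hz : z.1 ∉ D.Zreal) :
    D.entry φ (.inl ⟨z.1, Or.inl z.2⟩) 0 0
      = evalReIm s z.1 + evalReIm D.pqPoly z.1 * g₀ z.1 := by
  have hi : (0, 0) ∈ D.index (.inl ⟨z.1, Or.inl z.2⟩) :=
    (D.mem_index_inl_of_notMem (z := ⟨z.1, Or.inl z.2⟩) hz).2 ⟨rfl, rfl⟩
  rw [h.eq z (0, 0) hi, mulEntry, if_pos hz, entry_polyFun _ _ hi, entry_polyFun _ _ hi,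
    taylorCoeff_zero_zero, taylorCoeff_zero_zero]
  rfl

theorem IsDecomposition.isBoundedBorel :
    IsBoundedBorel ((D.specTheta \ D.Zreal).indicator g₀) := by
  refine ⟨?_, ?_⟩
  · refine measurable_of_restrict_of_restrict_compl D.measurableSet_diff ?_ ?_
    · convert! h.measurable using 1
      ext z
      exact Set.indicator_of_mem z.2 g₀
    · convert! measurable_const (a := (0 : ℂ)) using 1
      ext z
      exact Set.indicator_of_notMem z.2 g₀
  · obtain ⟨C, hC⟩ := h.bounded
    refine ⟨max C 0, fun z => ?_⟩
    by_cases hz : z ∈ D.specTheta \ D.Zreal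
    · rw [Set.indicator_of_mem hz]
      exact (hC z hz).trans (le_max_left _ _)
    · rw [Set.indicator_of_notMem hz, norm_zero]
      exact le_max_right _ _

end Decomposition

theorem evalReIm_pPoly (z : ℂ) : evalReIm D.pPoly z = (D.p.eval z.re : ℝ) := by
  rw [evalReIm, pPoly, ← MvPolynomial.coe_aeval_eq_eval, ← eval_map_p]
  simp only [RingHom.coe_coe]
  rw [← Polynomial.aeval_algHom_apply, MvPolynomial.aeval_X, Polynomial.coe_aeval_eq_eval]
  rfl

theorem evalReIm_qPoly (z : ℂ) : evalReIm D.qPoly z = (D.q.eval z.im : ℝ) := by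
  rw [evalReIm, qPoly, ← MvPolynomial.coe_aeval_eq_eval, ← eval_map_q]
  simp only [RingHom.coe_coe]
  rw [← Polynomial.aeval_algHom_apply, MvPolynomial.aeval_X, Polynomial.coe_aeval_eq_eval]
  rfl

theorem evalReIm_pqPoly (z : ℂ) :
    evalReIm D.pqPoly z = (D.p.eval z.re + D.q.eval z.im : ℝ) := by
  rw [Complex.ofReal_add, ← evalReIm_pPoly, ← evalReIm_qPoly]
  simp [evalReIm, pqPoly_eq]

theorem evalReIm_pqPoly_of_mem {z : ℂ} (hz : z ∈ D.Zreal) : evalReIm D.pqPoly z = 0 := by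
  rw [evalReIm_pqPoly, hz.1, hz.2, add_zero, Complex.ofReal_zero]

/-! ### The spectral inclusion -/

theorem isIntegral_evalTheta {E : SpectralMeasure D.V} (hE : E.IsSpectralMeasureOf D.ThetaN)
    (s : MvPolynomial (Fin 2) ℂ) :
    E.IsIntegral (D.specTheta.indicator (evalReIm s)) (D.evalTheta s) :=
  hE.isIntegral_eval _ rfl rfl s

theorem isBoundedBorel_evalReIm (s : MvPolynomial (Fin 2) ℂ) :
    IsBoundedBorel (D.specTheta.indicator (evalReIm s)) :=
  SpectralMeasure.isBoundedBorel_indicator_of_continuous D.isCompact_specTheta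
    (continuous_evalReIm s)

/-- The function `p + q` vanishes at `w`, so its product with the indicator of `{w}` is zero. -/
theorem proj_singleton_mul {E : SpectralMeasure D.V} (hE : E.IsSpectralMeasureOf D.ThetaN)
    {w : ℂ} (hw : w ∈ D.Zreal) : E.proj {w} * D.evalTheta D.pqPoly = 0 ∧
      D.evalTheta D.pqPoly * E.proj {w} = 0 := by
  have h1 : E.IsIntegral (Set.indicator {w} 1) (E.proj {w}) :=
    E.isFormIntegral_proj (measurableSet_singleton w)
  have h2 := D.isIntegral_evalTheta hE D.pqPoly
  have hb := isBoundedBorel_indicator_one (measurableSet_singleton w)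
  have h0 : IsFormIntegral E.scalarMeasure 0 0 := fun x => by simp
  have hz : ∀ z, Set.indicator {w} (1 : ℂ → ℂ) z * D.specTheta.indicator (evalReIm D.pqPoly) z
      = 0 := by
    intro z
    by_cases hzw : z = w
    · subst hzw
      simp [D.evalReIm_pqPoly_of_mem hw]
    · simp [hzw]
  constructor
  · refine IsFormIntegral.unique (h := 0) ?_ h0
    rw [← show Set.indicator {w} 1 * D.specTheta.indicator (evalReIm D.pqPoly) = 0 from funext hz]
    exact h1.mul hb (D.isBoundedBorel_evalReIm _) h2
  · refine IsFormIntegral.unique (h := 0) ?_ h0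
    rw [← show Set.indicator {w} 1 * D.specTheta.indicator (evalReIm D.pqPoly) = 0 from funext hz,
      mul_comm]
    exact h2.mul (D.isBoundedBorel_evalReIm _) hb h1

theorem finsum_mul_evalTheta {E : SpectralMeasure D.V} (hE : E.IsSpectralMeasureOf D.ThetaN)
    (g₁ g₂ : ℂ → ℂ) :
    (∑ᶠ w ∈ D.specTheta ∩ D.Zreal,
        (g₁ w • (D.R₁R₁ * E.proj {w}) + g₂ w • (D.R₂R₂ * E.proj {w}))) * D.evalTheta D.pqPoly = 0 ∧
      D.evalTheta D.pqPoly * (∑ᶠ w ∈ D.specTheta ∩ D.Zreal,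
        (g₁ w • (D.R₁R₁ * E.proj {w}) + g₂ w • (D.R₂R₂ * E.proj {w}))) = 0 :=
  finsum_annihilate (D.R₁R₁_mul.trans D.mul_R₁R₁.symm) (D.R₂R₂_mul.trans D.mul_R₂R₂.symm)
    (fun w => E.proj {w}) (fun _ hw => D.proj_singleton_mul hE hw.2) g₁ g₂

section Inclusion

variable {D} {φ : D.MN} {s : MvPolynomial (Fin 2) ℂ} {g₀ g₁ g₂ : ℂ → ℂ}
  (hdec : D.IsDecomposition φ s g₀ g₁ g₂) {c : ℂ} {δ : ℝ} (hδ : 0 < δ)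
  (hfar : ∀ x ∈ D.sigmaN, δ ≤ ‖D.entry φ x 0 0 - c‖)
include hdec hδ hfar

/-- The operator is the integral of `s - c + g₀ (p + q)`, which equals `φ₀₀ - c` on all of `σ(Θ(N))
⊆ σ_N`; on `Z` the second summand is removed by the indicator. -/
theorem IsDecomposition.exists_inverse_evalTheta {E : SpectralMeasure D.V} {I : D.V →L[ℂ] D.V}
    (hE : E.IsSpectralMeasureOf D.ThetaN)
    (hI : E.IsIntegral (Set.indicator (D.specTheta \ D.Zreal) g₀) I) :
    D.evalTheta D.pqPoly * I = I * D.evalTheta D.pqPoly ∧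
      ∃ W, (D.evalTheta (s - .C c) + I * D.evalTheta D.pqPoly) * W = 1 ∧
        W * (D.evalTheta (s - .C c) + I * D.evalTheta D.pqPoly) = 1 := by
  have h3 := D.isIntegral_evalTheta hE (s - MvPolynomial.C c)
  have h4 := D.isBoundedBorel_evalReIm (s - MvPolynomial.C c)
  have h5 := SpectralMeasure.IsIntegral.exists_inverse_add_mul (D.isBoundedBorel_evalReIm D.pqPoly)
    hdec.isBoundedBorel h4 (D.isIntegral_evalTheta hE D.pqPoly)
    hI h3 D.isCompact_specTheta.measurableSet hE.1 hδ
  refine h5 fun z hz => ?_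
  refine (hfar (.inl ⟨z, Or.inl hz⟩) (Or.inl hz)).trans_eq (congrArg _ ?_)
  have hsc : evalReIm (s - .C c) z = evalReIm s z - c := by simp [evalReIm]
  rw [Set.indicator_of_mem hz, Set.indicator_of_mem hz, hsc]
  by_cases hzZ : z ∈ D.Zreal
  · rw [hdec.entry_of_mem_Zreal _ hzZ, Set.indicator_of_notMem fun h => h.2 hzZ, zero_mul, add_zero]
  · rw [hdec.entry_of_notMem_Zreal ⟨z, hz⟩ hzZ, Set.indicator_of_mem (show z ∈ D.specTheta \ D.Zreal from ⟨hz, hzZ⟩)]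
    ring

/-- A common zero of `s - c`, `p(z)`, `q(w)` with both `a + i b` and `ā + i b̄` in `σ(N)` would be a
point of `σ_N` with `φ₀₀ = c`: a point of `Z` when both coordinates are real, of `Zⁱ` otherwise. -/
theorem IsDecomposition.exists_isUnit_evalAB :
    ∃ t u v, IsUnit (D.evalAB ((s - .C c) * t + D.pPoly * u + D.qPoly * v)) := by
  have h5 := exists_isUnit_of_common_zeros (R := K →L[ℂ] K) D.evalAB D.map_p_ne_zero D.map_q_ne_zero
    (s - .C c)
  refine h5 fun a ha hb hs => D.exists_isUnit_evalAB fun hspec => ?_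
  have hsa : MvPolynomial.eval a s = c := by simpa [sub_eq_zero] using hs
  have hae : ![a 0, a 1] = a := by
    ext i
    fin_cases i <;> rfl
  by_cases hre : (a 0).im = 0 ∧ (a 1).im = 0
  · have h0 : ((a 0).re : ℂ) = a 0 := Complex.ext rfl hre.1.symm
    have h1 : ((a 1).re : ℂ) = a 1 := Complex.ext rfl hre.2.symm
    have hzre : (a 0 + Complex.I * a 1).re = (a 0).re := by simp [hre.2]
    have hzim : (a 0 + Complex.I * a 1).im = (a 1).re := by simp [hre.1]
    have hzZ : a 0 + Complex.I * a 1 ∈ D.Zreal := by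
      rw [← h0, eval_map_p] at ha
      rw [← h1, eval_map_q] at hb
      exact ⟨by rw [hzre]; exact_mod_cast ha, by rw [hzim]; exact_mod_cast hb⟩
    have h2 := hfar (.inl ⟨a 0 + Complex.I * a 1, Or.inr hzZ⟩) (Or.inr ⟨hzZ, hspec.1⟩)
    rw [hdec.entry_of_mem_Zreal _ hzZ, evalReIm, hzre, hzim, h0, h1, hae, hsa, sub_self,
      norm_zero] at h2
    exact absurd h2 (not_le.2 hδ)
  · have h2 := hfar (.inr ⟨(a 0, a 1), ha, hb, hre⟩) hspec
    rw [hdec.entry_inr, hae, hsa, sub_self, norm_zero] at h2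
    exact absurd h2 (not_le.2 hδ)

end Inclusion

theorem isUnit_polyOp_add_Xi_sub {s t u v : MvPolynomial (Fin 2) ℂ} {c : ℂ} {I F : D.V →L[ℂ] D.V}
    (hr : IsUnit (D.evalAB ((s - .C c) * t + D.pPoly * u + D.qPoly * v)))
    (hF : F * D.evalTheta D.pqPoly = 0) (hF' : D.evalTheta D.pqPoly * F = 0)
    (hI : D.evalTheta D.pqPoly * I = I * D.evalTheta D.pqPoly)
    (hW : ∃ W, (D.evalTheta (s - .C c) + I * D.evalTheta D.pqPoly) * W = 1 ∧
        W * (D.evalTheta (s - .C c) + I * D.evalTheta D.pqPoly) = 1) :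
    IsUnit (algebraMap ℂ _ c - (D.polyOp s + D.Xi (I + F))) := by
  obtain ⟨W, hW, hW'⟩ := hW
  have hunit := D.isUnit_evalAB_add_Xi (G := I + F) hr (by rw [add_mul, hF, add_zero])
    (by rw [mul_add, hF', add_zero, hI]) hW hW'
  have hC : D.evalAB (.C c) = algebraMap ℂ _ c := pairEval_C _ c
  rw [map_sub D.evalAB, hC] at hunit
  rw [← IsUnit.neg_iff, neg_sub, polyOp_eq, add_sub_right_comm]
  exact hunit

theorem spectrum_subset_closure {φ : D.MN} {Φ : K →L[ℂ] K} (h : D.IsCalculusValue φ Φ) :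
    spectrum ℂ Φ ⊆ closure ((fun x => D.entry φ x 0 0) '' D.sigmaN) := by
  obtain ⟨E, s, g₀, g₁, g₂, I, hE, hdec, hI, rfl⟩ := h
  intro c hc
  by_contra hcl
  refine hc ?_
  rw [Metric.mem_closure_iff] at hcl
  push Not at hcl
  obtain ⟨δ, hδ, hfar⟩ := hcl
  have hfar' : ∀ x ∈ D.sigmaN, δ ≤ ‖D.entry φ x 0 0 - c‖ := fun x hx => by
    rw [← dist_eq_norm, dist_comm]
    exact hfar _ ⟨x, hx, rfl⟩
  obtain ⟨hF, hF'⟩ := D.finsum_mul_evalTheta hE g₁ g₂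
  obtain ⟨hcomm, hW⟩ := hdec.exists_inverse_evalTheta hδ hfar' hE hI
  obtain ⟨t, u, v, hr⟩ := hdec.exists_isUnit_evalAB hδ hfar'
  exact D.isUnit_polyOp_add_Xi_sub hr hF hF' hcomm hW

end DefinitizableNormal

/-! ### Taylor coefficients and Hermite interpolation -/

section Taylor

theorem X_sub_C_pow_dvd_iff_taylor_coeff {f : Polynomial ℂ} {a : ℂ} {m : ℕ} :
    (Polynomial.X - Polynomial.C a) ^ m ∣ f ↔ ∀ k < m, (Polynomial.taylor a f).coeff k = 0 := by
  rw [Polynomial.X_sub_C_pow_dvd_iff, Polynomial.X_pow_dvd_iff]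
  rfl

theorem taylor_X_sub_C_pow (a : ℂ) (k : ℕ) :
    Polynomial.taylor a ((Polynomial.X - Polynomial.C a) ^ k) = Polynomial.X ^ k := by
  simp [Polynomial.taylor_apply]

theorem exists_eq_taylor_sum_add (f : Polynomial ℂ) (a : ℂ) (m : ℕ) :
    ∃ r, f = ∑ k ∈ Finset.range m, Polynomial.C ((Polynomial.taylor a f).coeff k) *
      (Polynomial.X - Polynomial.C a) ^ k + (Polynomial.X - Polynomial.C a) ^ m * r := by
  have h : (Polynomial.X - Polynomial.C a) ^ m ∣ f - ∑ k ∈ Finset.range m,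
      Polynomial.C ((Polynomial.taylor a f).coeff k) * (Polynomial.X - Polynomial.C a) ^ k := by
    rw [X_sub_C_pow_dvd_iff_taylor_coeff]
    intro k hk
    simp only [map_sub, map_sum, Polynomial.taylor_mul, Polynomial.taylor_C, taylor_X_sub_C_pow,
      Polynomial.coeff_sub, Polynomial.finsetSum_coeff, Polynomial.coeff_C_mul_X_pow]
    simp [Finset.sum_ite_eq, hk]
  obtain ⟨r, hr⟩ := h
  exact ⟨r, by rw [← hr]; ring⟩

theorem taylor_coeff_rootMultiplicity_ne_zero {f : Polynomial ℂ} (hf : f ≠ 0) (a : ℂ) :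
    (Polynomial.taylor a f).coeff (f.rootMultiplicity a) ≠ 0 := by
  intro h
  have h1 : (Polynomial.X - Polynomial.C a) ^ (f.rootMultiplicity a + 1) ∣ f := by
    rw [X_sub_C_pow_dvd_iff_taylor_coeff]
    intro k hk
    rcases Nat.lt_succ_iff_lt_or_eq.1 hk with hk | rfl
    · exact X_sub_C_pow_dvd_iff_taylor_coeff.1 (Polynomial.pow_rootMultiplicity_dvd f a) k hk
    · exact h
  exact absurd ((Polynomial.le_rootMultiplicity_iff hf).2 h1) (by simp)

/-- Hermite interpolation in one variable. -/
theorem exists_hermite_basis {f : Polynomial ℂ} (hf : f ≠ 0) (a : ℂ) (k : ℕ) :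
    ∃ h : Polynomial ℂ, ∀ b, ∀ j < f.rootMultiplicity b,
      (Polynomial.taylor b h).coeff j = if b = a ∧ j = k then 1 else 0 := by
  obtain ⟨Q, hQ, hnd⟩ := Polynomial.exists_eq_pow_rootMultiplicity_mul_and_not_dvd f hf a
  have hcop : IsCoprime ((Polynomial.X - Polynomial.C a) ^ f.rootMultiplicity a) Q :=
    ((Polynomial.irreducible_X_sub_C a).coprime_iff_not_dvd.2 hnd).pow_left
  obtain ⟨u, v, huv⟩ := hcop
  -- Chinese remainder theorem: `v Q` is `1` modulo the power of `X - a` occurring in `f` and `0`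
  -- modulo those at the other roots.
  refine ⟨(Polynomial.X - Polynomial.C a) ^ k * (v * Q), fun b j hj => ?_⟩
  by_cases hba : b = a
  · subst hba
    have h1 : (Polynomial.X - Polynomial.C b) ^ f.rootMultiplicity b ∣
        (Polynomial.X - Polynomial.C b) ^ k * (v * Q) - (Polynomial.X - Polynomial.C b) ^ k :=
      ⟨-(Polynomial.X - Polynomial.C b) ^ k * u, by rw [← eq_sub_iff_add_eq'] at huv; rw [huv]; ring⟩
    have h2 := X_sub_C_pow_dvd_iff_taylor_coeff.1 h1 j hj
    rw [map_sub, Polynomial.coeff_sub, sub_eq_zero, taylor_X_sub_C_pow,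
      Polynomial.coeff_X_pow] at h2
    rw [h2]
    simp
  · have h1 : (Polynomial.X - Polynomial.C b) ^ f.rootMultiplicity b ∣ Q := by
      have hc : IsCoprime (Polynomial.X - Polynomial.C b) (Polynomial.X - Polynomial.C a) :=
        Polynomial.isCoprime_X_sub_C_of_isUnit_sub (sub_ne_zero.2 hba).isUnit
      have h2 : (Polynomial.X - Polynomial.C b) ^ f.rootMultiplicity b ∣
          (Polynomial.X - Polynomial.C a) ^ f.rootMultiplicity a * Q :=
        (Polynomial.pow_rootMultiplicity_dvd f b).trans (dvd_of_eq hQ)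
      exact hc.pow.dvd_of_dvd_mul_left h2
    rw [X_sub_C_pow_dvd_iff_taylor_coeff.1 ((h1.mul_left v).mul_left _) j hj, if_neg fun h => hba h.1]

/-- The product `f(z) g(w)`. -/
def prodPoly (f g : Polynomial ℂ) : MvPolynomial (Fin 2) ℂ :=
  Polynomial.aeval (.X 0) f * Polynomial.aeval (.X 1) g

theorem pderiv_zero_prodPoly (f g : Polynomial ℂ) :
    MvPolynomial.pderiv 0 (prodPoly f g) = prodPoly f.derivative g := by
  rw [prodPoly, prodPoly, Derivation.leibniz, Derivation.map_aeval, Derivation.map_aeval,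
    MvPolynomial.pderiv_X_self, MvPolynomial.pderiv_X_of_ne (by decide)]
  simp [mul_comm]

theorem pderiv_one_prodPoly (f g : Polynomial ℂ) :
    MvPolynomial.pderiv 1 (prodPoly f g) = prodPoly f g.derivative := by
  rw [prodPoly, prodPoly, Derivation.leibniz, Derivation.map_aeval, Derivation.map_aeval,
    MvPolynomial.pderiv_X_self, MvPolynomial.pderiv_X_of_ne (by decide)]
  simp

theorem eval_prodPoly (f g : Polynomial ℂ) (a b : ℂ) :
    MvPolynomial.eval ![a, b] (prodPoly f g) = f.eval a * g.eval b := by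
  rw [prodPoly, map_mul, ← MvPolynomial.coe_aeval_eq_eval]
  simp only [RingHom.coe_coe]
  rw [← Polynomial.aeval_algHom_apply, ← Polynomial.aeval_algHom_apply, MvPolynomial.aeval_X,
    MvPolynomial.aeval_X, Polynomial.coe_aeval_eq_eval, Polynomial.coe_aeval_eq_eval]
  rfl

theorem eval_iterate_derivative (f : Polynomial ℂ) (a : ℂ) (k : ℕ) :
    (Polynomial.derivative^[k] f).eval a = k.factorial * (Polynomial.taylor a f).coeff k := by
  rw [← Polynomial.factorial_smul_hasseDeriv, Polynomial.taylor_coeff]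
  simp

/-- On products `f(z) g(w)` the partial derivatives separate, which reduces two-variable
interpolation and Taylor expansion to one variable. -/
theorem taylorCoeff_prodPoly (f g : Polynomial ℂ) (a : ℂ × ℂ) (k l : ℕ) :
    DefinitizableNormal.taylorCoeff (prodPoly f g) a k l
      = (Polynomial.taylor a.1 f).coeff k * (Polynomial.taylor a.2 g).coeff l := by
  have h1 : ∀ l g, (MvPolynomial.pderiv 1)^[l] (prodPoly f g)
      = prodPoly f (Polynomial.derivative^[l] g) := by
    intro l
    induction l with
    | zero => intro g; rfl
    | succ l ih => intro g; rw [Function.iterate_succ_apply, pderiv_one_prodPoly, ih]; rfl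
  have h0 : ∀ k f g, (MvPolynomial.pderiv 0)^[k] (prodPoly f g)
      = prodPoly (Polynomial.derivative^[k] f) g := by
    intro k
    induction k with
    | zero => intro f g; rfl
    | succ k ih => intro f g; rw [Function.iterate_succ_apply, pderiv_zero_prodPoly, ih]; rfl
  rw [DefinitizableNormal.taylorCoeff, h1, h0, eval_prodPoly, eval_iterate_derivative,
    eval_iterate_derivative]
  have hk : (k.factorial : ℂ) ≠ 0 := by exact_mod_cast k.factorial_ne_zero
  have hl : (l.factorial : ℂ) ≠ 0 := by exact_mod_cast l.factorial_ne_zero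
  field_simp

/-- The Taylor coefficient as a linear functional. -/
def taylorCoeffLin (a : ℂ × ℂ) (k l : ℕ) : MvPolynomial (Fin 2) ℂ →ₗ[ℂ] ℂ :=
  ((k.factorial : ℂ) * (l.factorial : ℂ))⁻¹ • ((MvPolynomial.aeval ![a.1, a.2]).toLinearMap ∘ₗ
    ((MvPolynomial.pderiv 0).toLinearMap ^ k) ∘ₗ ((MvPolynomial.pderiv 1).toLinearMap ^ l))

theorem taylorCoeffLin_apply (a : ℂ × ℂ) (k l : ℕ) (s : MvPolynomial (Fin 2) ℂ) :
    taylorCoeffLin a k l s = DefinitizableNormal.taylorCoeff s a k l := by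
  simp only [taylorCoeffLin, DefinitizableNormal.taylorCoeff, LinearMap.smul_apply,
    LinearMap.comp_apply, Module.End.pow_apply, smul_eq_mul, div_eq_inv_mul]
  rfl

/-- Hermite interpolation in two variables. -/
theorem exists_hermite_interpolation {f g : Polynomial ℂ} (hf : f ≠ 0) (hg : g ≠ 0)
    (val : ℂ → ℂ → ℕ → ℕ → ℂ) : ∃ s : MvPolynomial (Fin 2) ℂ, ∀ a b,
      ∀ k < f.rootMultiplicity a, ∀ l < g.rootMultiplicity b,
        DefinitizableNormal.taylorCoeff s (a, b) k l = val a b k l := by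
  choose h hh using exists_hermite_basis hf
  choose h' hh' using exists_hermite_basis hg
  refine ⟨∑ a ∈ f.roots.toFinset, ∑ b ∈ g.roots.toFinset,
    ∑ k ∈ Finset.range (f.rootMultiplicity a), ∑ l ∈ Finset.range (g.rootMultiplicity b),
      val a b k l • prodPoly (h a k) (h' b l), fun a b k hk l hl => ?_⟩
  have ha : a ∈ f.roots.toFinset := by
    rw [Multiset.mem_toFinset, Polynomial.mem_roots hf]
    exact (Polynomial.rootMultiplicity_pos hf).1 (Nat.zero_lt_of_lt hk)
  have hb : b ∈ g.roots.toFinset := by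
    rw [Multiset.mem_toFinset, Polynomial.mem_roots hg]
    exact (Polynomial.rootMultiplicity_pos hg).1 (Nat.zero_lt_of_lt hl)
  rw [← taylorCoeffLin_apply]
  simp only [map_sum, map_smul, taylorCoeffLin_apply, taylorCoeff_prodPoly, hh _ _ _ _ hk,
    hh' _ _ _ _ hl]
  rw [Finset.sum_eq_single_of_mem a ha fun a' _ hne => by simp [hne.symm],
    Finset.sum_eq_single_of_mem b hb fun b' _ hne => by simp [hne.symm],
    Finset.sum_eq_single_of_mem k (Finset.mem_range.2 hk) fun k' _ hne => by simp [hne.symm],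
    Finset.sum_eq_single_of_mem l (Finset.mem_range.2 hl) fun l' _ hne => by simp [hne.symm]]
  simp

/-- Taylor's formula with respect to the ideal generated by `(z - a)^m` and `(w - b)^n`. -/
theorem exists_taylor_remainder (s : MvPolynomial (Fin 2) ℂ) (a : ℂ × ℂ) (m n : ℕ) :
    ∃ u v : MvPolynomial (Fin 2) ℂ, ∀ x y : ℂ, MvPolynomial.eval ![x, y] s
      - ∑ k ∈ Finset.range m, ∑ l ∈ Finset.range n,
          DefinitizableNormal.taylorCoeff s a k l * (x - a.1) ^ k * (y - a.2) ^ l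
      = (x - a.1) ^ m * MvPolynomial.eval ![x, y] u + (y - a.2) ^ n * MvPolynomial.eval ![x, y] v := by
  induction s using MvPolynomial.induction_on' with
  | add s t hs ht =>
    obtain ⟨u, v, h⟩ := hs
    obtain ⟨u', v', h'⟩ := ht
    refine ⟨u + u', v + v', fun x y => ?_⟩
    have e : ∀ k l, DefinitizableNormal.taylorCoeff (s + t) a k l
        = DefinitizableNormal.taylorCoeff s a k l + DefinitizableNormal.taylorCoeff t a k l := by
      intro k l
      simp only [← taylorCoeffLin_apply, map_add]
    simp only [e, map_add, add_mul, Finset.sum_add_distrib]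
    linear_combination h x y + h' x y
  | monomial i c =>
    have e : MvPolynomial.monomial i c
        = prodPoly (Polynomial.C c * Polynomial.X ^ i 0) (Polynomial.X ^ i 1) := by
      rw [MvPolynomial.monomial_eq, Finsupp.prod_fintype _ _ (by simp), Fin.prod_univ_two, prodPoly]
      simp [mul_assoc]
    rw [e]
    generalize (Polynomial.C c * Polynomial.X ^ i 0 : Polynomial ℂ) = f
    generalize (Polynomial.X ^ i 1 : Polynomial ℂ) = g
    obtain ⟨r, hr⟩ := exists_eq_taylor_sum_add f a.1 m
    obtain ⟨r', hr'⟩ := exists_eq_taylor_sum_add g a.2 n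
    -- With Taylor polynomials `F`, `G` of `f`, `g`, one writes `f g - F G = (f - F) g + F (g - G)`.
    refine ⟨prodPoly r g, prodPoly (∑ k ∈ Finset.range m,
      Polynomial.C ((Polynomial.taylor a.1 f).coeff k) * (Polynomial.X - Polynomial.C a.1) ^ k) r',
      fun x y => ?_⟩
    simp only [taylorCoeff_prodPoly, eval_prodPoly]
    have h1 := congrArg (Polynomial.eval x) hr
    have h2 := congrArg (Polynomial.eval y) hr'
    simp only [Polynomial.eval_add, Polynomial.eval_finsetSum, Polynomial.eval_mul,
      Polynomial.eval_C, Polynomial.eval_pow, Polynomial.eval_sub, Polynomial.eval_X] at h1 h2 ⊢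
    have h3 : ∑ k ∈ Finset.range m, ∑ l ∈ Finset.range n,
        (Polynomial.taylor a.1 f).coeff k * (Polynomial.taylor a.2 g).coeff l * (x - a.1) ^ k
          * (y - a.2) ^ l
        = (∑ k ∈ Finset.range m, (Polynomial.taylor a.1 f).coeff k * (x - a.1) ^ k)
          * ∑ l ∈ Finset.range n, (Polynomial.taylor a.2 g).coeff l * (y - a.2) ^ l := by
      rw [Finset.sum_mul_sum]
      refine Finset.sum_congr rfl fun k _ => Finset.sum_congr rfl fun l _ => ?_
      ring
    rw [h3]
    linear_combination g.eval y * h1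
      + (∑ k ∈ Finset.range m, (Polynomial.taylor a.1 f).coeff k * (x - a.1) ^ k) * h2

end Taylor

/-! ### Estimates on the spectrum and existence of decompositions -/

/-- If `f(M) = X g(M)` for a normal element `M`, then `|f| ≤ ‖X‖ |g|` on the spectrum of `M`. -/
theorem norm_le_of_cfc_eq_mul {R : Type*} [CStarAlgebra R] [PartialOrder R] [StarOrderedRing R]
    {M X : R} [IsStarNormal M] {f g : ℂ → ℂ} (hf : Continuous f) (hg : Continuous g)
    (h : cfc f M = X * cfc g M) {z : ℂ} (hz : z ∈ spectrum ℂ M) : ‖f z‖ ≤ ‖X‖ * ‖g z‖ := by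
  have hsq : ∀ {k : ℂ → ℂ}, Continuous k →
      star (cfc k M) * cfc k M = cfc (fun z => star (k z) * k z) M := fun {k} hk => by
    rw [cfc_mul (fun z => star (k z)) k M (continuous_star.comp hk).continuousOn hk.continuousOn,
      cfc_star]
  -- This is `g(M)* X* X g(M) ≤ ‖X‖² g(M)* g(M)`. Both sides are functions of `M`, so the inequality
  -- holds pointwise on the spectrum, even though `X` need not be a function of `M`.
  have h1 := CStarAlgebra.star_left_conjugate_le_norm_smul (a := cfc g M) (b := star X * X)
  have h2 : star (cfc g M) * (star X * X) * cfc g M = star (cfc f M) * cfc f M := by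
    rw [h, star_mul]
    simp only [mul_assoc]
  have hc : Continuous fun z => star (g z) * g z := (continuous_star.comp hg).mul hg
  have h3 : ((‖star X * X‖ : ℝ) : ℂ) • cfc (fun z => star (g z) * g z) M
      = cfc (fun z => ((‖star X * X‖ : ℝ) : ℂ) * (star (g z) * g z)) M := by
    rw [cfc_const_mul _ _ M hc.continuousOn]
  rw [h2, hsq hf, hsq hg, ← Complex.coe_smul, h3,
    cfc_le_iff (fun z => star (f z) * f z) (fun z => ((‖star X * X‖ : ℝ) : ℂ) * (star (g z) * g z))
      M ((continuous_star.comp hf).mul hf).continuousOn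
      (continuous_const.mul hc).continuousOn] at h1
  have h4 := h1 z hz
  simp only [RCLike.star_def] at h4
  rw [Complex.conj_mul', Complex.conj_mul',
    CStarRing.norm_star_mul_self] at h4
  have h5 : ‖f z‖ ^ 2 ≤ (‖X‖ * ‖g z‖) ^ 2 := by
    rw [mul_pow, sq ‖X‖]
    exact_mod_cast h4
  exact le_of_sq_le_sq h5 (by positivity)

theorem exists_norm_le_nhds_of_continuous {f : ℂ → ℂ} (hf : Continuous f) (w : ℂ) :
    ∃ C : ℝ, 0 ≤ C ∧ ∀ᶠ z in 𝓝 w, ‖f z‖ ≤ C :=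
  ⟨‖f w‖ + 1, by positivity, (hf.norm.continuousAt.eventually_lt_const (lt_add_one _)).mono
    fun _ h => h.le⟩

/-- Near a point, a nonzero real polynomial is bounded below by the power given by the order of
its zero. -/
theorem exists_pow_le_eval {p : Polynomial ℝ} (hp : p.map (algebraMap ℝ ℂ) ≠ 0) (a : ℝ) :
    ∃ C : ℝ, 0 ≤ C ∧ ∀ᶠ x in 𝓝 a,
      |x - a| ^ (p.map (algebraMap ℝ ℂ)).rootMultiplicity (a : ℂ) ≤ C * |p.eval x| := by
  obtain ⟨Q, hQ, hnd⟩ := Polynomial.exists_eq_pow_rootMultiplicity_mul_and_not_dvd _ hp (a : ℂ)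
  generalize (p.map (algebraMap ℝ ℂ)).rootMultiplicity (a : ℂ) = m at hQ ⊢
  have hQa : Q.eval (a : ℂ) ≠ 0 := fun h => hnd (Polynomial.dvd_iff_isRoot.2 h)
  have hc : Continuous fun x : ℝ => ‖Q.eval (x : ℂ)‖ := by fun_prop
  have hev := hc.continuousAt.eventually_const_lt (half_lt_self (norm_pos_iff.2 hQa))
  -- The cofactor `Q` does not vanish at `a`, so by continuity it stays above half its modulus
  -- there.
  refine ⟨(‖Q.eval (a : ℂ)‖ / 2)⁻¹, by positivity, hev.mono fun x hx => ?_⟩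
  have h1 : |p.eval x| = |x - a| ^ m * ‖Q.eval (x : ℂ)‖ := by
    have h2 := congrArg (Polynomial.eval (x : ℂ)) hQ
    rw [Polynomial.eval_map_algebraMap, ← Complex.coe_algebraMap,
      Polynomial.aeval_algebraMap_apply, Polynomial.coe_aeval_eq_eval] at h2
    have h3 := congrArg norm h2
    simp only [Complex.coe_algebraMap, Polynomial.eval_mul, Polynomial.eval_pow,
      Polynomial.eval_sub, Polynomial.eval_X, Polynomial.eval_C, norm_mul, norm_pow,
      ← Complex.ofReal_sub, Complex.norm_real, Real.norm_eq_abs] at h3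
    exact h3
  rw [h1]
  have hpos : 0 < ‖Q.eval (a : ℂ)‖ / 2 := by positivity
  rw [← div_eq_inv_mul, le_div_iff₀ hpos]
  exact mul_le_mul_of_nonneg_left hx.le (by positivity)

namespace DefinitizableNormal

variable {K : Type*} [NormedAddCommGroup K] [InnerProductSpace ℂ K] [CompleteSpace K]
  [KreinSpace K] (D : DefinitizableNormal K)

theorem abs_p_le {z : ℂ} (hz : z ∈ D.specTheta) :
    |D.p.eval z.re| ≤ ‖D.R₁R₁‖ * ‖evalReIm D.pqPoly z‖ := by
  have h := norm_le_of_cfc_eq_mul (continuous_evalReIm D.pPoly) (continuous_evalReIm D.pqPoly)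
    (by rw [← evalTheta_eq_cfc, ← evalTheta_eq_cfc, R₁R₁_mul]) hz
  rwa [evalReIm_pPoly, Complex.norm_real, Real.norm_eq_abs] at h

theorem abs_q_le {z : ℂ} (hz : z ∈ D.specTheta) :
    |D.q.eval z.im| ≤ ‖D.R₂R₂‖ * ‖evalReIm D.pqPoly z‖ := by
  have h := norm_le_of_cfc_eq_mul (continuous_evalReIm D.qPoly) (continuous_evalReIm D.pqPoly)
    (by rw [← evalTheta_eq_cfc, ← evalTheta_eq_cfc, R₂R₂_mul]) hz
  rwa [evalReIm_qPoly, Complex.norm_real, Real.norm_eq_abs] at h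

/-- `p` and `q` cannot cancel on `σ(Θ(N))`, as each is dominated by `p + q`. -/
theorem evalReIm_pqPoly_ne_zero {z : ℂ} (hz : z ∈ D.specTheta) (hzZ : z ∉ D.Zreal) :
    evalReIm D.pqPoly z ≠ 0 := by
  intro h
  have h1 := D.abs_p_le hz
  have h2 := D.abs_q_le hz
  rw [h, norm_zero, mul_zero] at h1 h2
  exact hzZ ⟨abs_eq_zero.1 (h1.antisymm (abs_nonneg _)), abs_eq_zero.1 (h2.antisymm (abs_nonneg _))⟩

/-- Near `w` the powers are bounded by `|p|` and `|q|`, and on `σ(Θ(N))` these are bounded by `|p +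
q|`. This trades the denominator of the growth condition for the one in the quotient defining `g`.
-/
theorem exists_max_le (w : ℂ) : ∃ C : ℝ, 0 ≤ C ∧ ∀ᶠ z in 𝓝 w, z ∈ D.specTheta →
    max (|(z - w).re| ^ D.dp w.re) (|(z - w).im| ^ D.dq w.im) ≤ C * ‖evalReIm D.pqPoly z‖ := by
  obtain ⟨C, hC, h⟩ := exists_pow_le_eval D.map_p_ne_zero w.re
  obtain ⟨C', hC', h'⟩ := exists_pow_le_eval D.map_q_ne_zero w.im
  refine ⟨C * ‖D.R₁R₁‖ + C' * ‖D.R₂R₂‖, by positivity, ?_⟩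
  filter_upwards [Complex.continuous_re.continuousAt.eventually h,
    Complex.continuous_im.continuousAt.eventually h'] with z h1 h2 hz
  have h3 := mul_le_mul_of_nonneg_left (D.abs_p_le hz) hC
  have h4 := mul_le_mul_of_nonneg_left (D.abs_q_le hz) hC'
  have h5 : 0 ≤ C * (‖D.R₁R₁‖ * ‖evalReIm D.pqPoly z‖) := by positivity
  have h6 : 0 ≤ C' * (‖D.R₂R₂‖ * ‖evalReIm D.pqPoly z‖) := by positivity
  rw [Complex.sub_re, Complex.sub_im, add_mul, mul_assoc, mul_assoc]
  exact max_le ((h1.trans h3).trans (le_add_of_nonneg_right h6))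
    ((h2.trans h4).trans (le_add_of_nonneg_left h5))

theorem exists_remainder_le (s : MvPolynomial (Fin 2) ℂ) (w : ℂ) (m n : ℕ) :
    ∃ C : ℝ, ∀ᶠ z in 𝓝 w, ‖evalReIm s z - ∑ k ∈ Finset.range m, ∑ l ∈ Finset.range n,
        taylorCoeff s ((w.re : ℂ), (w.im : ℂ)) k l * ((z - w).re : ℂ) ^ k * ((z - w).im : ℂ) ^ l‖
      ≤ C * max (|(z - w).re| ^ m) (|(z - w).im| ^ n) := by
  obtain ⟨u, v, huv⟩ := exists_taylor_remainder s ((w.re : ℂ), (w.im : ℂ)) m n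
  obtain ⟨C, hC, h⟩ := exists_norm_le_nhds_of_continuous (continuous_evalReIm u) w
  obtain ⟨C', hC', h'⟩ := exists_norm_le_nhds_of_continuous (continuous_evalReIm v) w
  refine ⟨C + C', ?_⟩
  filter_upwards [h, h'] with z h1 h2
  have h3 := huv z.re z.im
  simp only [← Complex.ofReal_sub, ← Complex.sub_re, ← Complex.sub_im] at h3
  rw [evalReIm, h3]
  refine (norm_add_le _ _).trans ?_
  rw [norm_mul, norm_mul, norm_pow, norm_pow, Complex.norm_real, Complex.norm_real,
    Real.norm_eq_abs, Real.norm_eq_abs, add_mul, mul_comm, mul_comm (|(z - w).im| ^ n)]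
  exact add_le_add (mul_le_mul h1 (le_max_left _ _) (by positivity) hC)
    (mul_le_mul h2 (le_max_right _ _) (by positivity) hC')

/-- Real pairs are excluded from `Zⁱ`, so the two halves of the domain do not collide in `ℂ²`; this
makes the interpolation data well defined. -/
theorem point_injective : Function.Injective D.point := by
  rintro (z | ζ) (z' | ζ') h
  · simp only [point, Prod.mk.injEq, Complex.ofReal_inj] at h
    exact congrArg _ (Subtype.ext (Complex.ext h.1 h.2))
  · refine absurd ?_ ζ'.2.2.2
    change ((z.1.re : ℂ), (z.1.im : ℂ)) = ζ'.1 at h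
    rw [← h]
    simp
  · refine absurd ?_ ζ.2.2.2
    change ζ.1 = ((z'.1.re : ℂ), (z'.1.im : ℂ)) at h
    rw [h]
    simp
  · exact congrArg _ (Subtype.ext h)

/-- A polynomial with prescribed entries at the points of `(Z_p^ℝ + i Z_q^ℝ) ⊔ Zⁱ`. -/
theorem exists_sub_isInR (φ : D.MN) : ∃ s, D.IsInR (φ - D.polyFun s) := by
  classical
  -- The prescribed value at `(a, b)` is the entry of `φ` at the domain point lying over it, and `0`
  -- when there is none.
  obtain ⟨s, hs⟩ := exists_hermite_interpolation D.map_p_ne_zero D.map_q_ne_zero fun a b k l =>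
    if h : ∃ x, D.point x = (a, b) then D.entry φ h.choose k l else 0
  have hval : ∀ (x : D.Domain), ∀ k < D.dp (D.point x).1, ∀ l < D.dq (D.point x).2,
      taylorCoeff s (D.point x) k l = D.entry φ x k l := by
    intro x k hk l hl
    have h : ∃ y, D.point y = ((D.point x).1, (D.point x).2) := ⟨x, rfl⟩
    have h1 := hs _ _ k hk l hl
    rw [dif_pos h, D.point_injective h.choose_spec] at h1
    exact h1
  refine ⟨s, fun z hz k hk l hl => ?_, fun ζ k hk l hl => ?_⟩
  · rw [entry_sub, entry_polyFun _ _ ((D.mem_index_inl hz).2 (.inl ⟨hk, hl⟩)), sub_eq_zero]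
    exact (hval (.inl z) k hk l hl).symm
  · rw [entry_sub, entry_polyFun _ _ (D.mem_index_inr.2 ⟨hk, hl⟩), sub_eq_zero]
    exact (hval (.inr ζ) k hk l hl).symm

theorem taylorCoeff_pqPoly (a : ℂ × ℂ) (k l : ℕ) : taylorCoeff D.pqPoly a k l
    = (Polynomial.taylor a.1 (D.p.map (algebraMap ℝ ℂ))).coeff k * (if l = 0 then 1 else 0)
      + (if k = 0 then 1 else 0) * (Polynomial.taylor a.2 (D.q.map (algebraMap ℝ ℂ))).coeff l := by
  have e : D.pqPoly = prodPoly (D.p.map (algebraMap ℝ ℂ)) 1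
      + prodPoly 1 (D.q.map (algebraMap ℝ ℂ)) := by
    simp [prodPoly, pqPoly]
  rw [e, ← taylorCoeffLin_apply, map_add, taylorCoeffLin_apply, taylorCoeffLin_apply,
    taylorCoeff_prodPoly, taylorCoeff_prodPoly]
  simp [Polynomial.taylor_one, Polynomial.coeff_one]

theorem taylorCoeff_pqPoly_dp_ne_zero {z : ℂ} (hz : z ∈ D.Zreal) :
    taylorCoeff D.pqPoly ((z.re : ℂ), (z.im : ℂ)) (D.dp z.re) 0 ≠ 0 := by
  rw [taylorCoeff_pqPoly, if_pos rfl, if_neg (D.dp_pos_of_mem hz).ne', mul_one, zero_mul, add_zero]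
  exact taylor_coeff_rootMultiplicity_ne_zero D.map_p_ne_zero _

theorem taylorCoeff_pqPoly_dq_ne_zero {z : ℂ} (hz : z ∈ D.Zreal) :
    taylorCoeff D.pqPoly ((z.re : ℂ), (z.im : ℂ)) 0 (D.dq z.im) ≠ 0 := by
  rw [taylorCoeff_pqPoly, if_pos rfl, if_neg (D.dq_pos_of_mem hz).ne', mul_zero, one_mul, zero_add]
  exact taylor_coeff_rootMultiplicity_ne_zero D.map_q_ne_zero _

open Classical in
/-- The entries on `σ(Θ(N))`, as functions on `ℂ`. -/
def entryAt (φ : D.MN) (k l : ℕ) (z : ℂ) : ℂ :=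
  if h : z ∈ D.specTheta then D.entry φ (.inl ⟨z, Or.inl h⟩) k l else 0

theorem entryAt_of_mem (φ : D.MN) (k l : ℕ) {z : ℂ} (h : z ∈ D.specTheta) :
    D.entryAt φ k l z = D.entry φ (.inl ⟨z, Or.inl h⟩) k l := dif_pos h

/-- The quotient `(φ - s) / (p + q)` on `σ(Θ(N))`. -/
def quotientFun (φ : D.MN) (s : MvPolynomial (Fin 2) ℂ) (z : ℂ) : ℂ :=
  (D.entryAt φ 0 0 z - evalReIm s z) / evalReIm D.pqPoly z

variable {D}

theorem IsInR.entry_eq_taylorCoeff {φ : D.MN} {s : MvPolynomial (Fin 2) ℂ}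
    (hs : D.IsInR (φ - D.polyFun s)) {z : ℂ} (hz : z ∈ D.specTheta) (hzZ : z ∈ D.Zreal) {k l : ℕ}
    (hk : k < D.dp z.re) (hl : l < D.dq z.im) :
    D.entry φ (.inl ⟨z, Or.inl hz⟩) k l = taylorCoeff s ((z.re : ℂ), (z.im : ℂ)) k l := by
  have hkl : (k, l) ∈ D.index (.inl ⟨z, Or.inl hz⟩) :=
    (D.mem_index_inl (z := ⟨z, Or.inl hz⟩) hzZ).2 (.inl ⟨hk, hl⟩)
  have h := hs.1 ⟨z, Or.inl hz⟩ hzZ k hk l hl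
  rw [entry_sub, sub_eq_zero, entry_polyFun _ _ hkl] at h
  exact h

/-- The absolute values are there because the constants in the growth and remainder bounds come
without a sign. -/
theorem norm_le_mul_of_sub_le {a b c d : ℂ} {C₁ C₂ C₃ M : ℝ} (hM : 0 ≤ M) (h₁ : ‖a - c‖ ≤ C₁ * M)
    (h₂ : ‖b - c‖ ≤ C₂ * M) (h₃ : M ≤ C₃ * ‖d‖) : ‖a - b‖ ≤ (|C₁| + |C₂|) * C₃ * ‖d‖ :=
  calc ‖a - b‖ = ‖(a - c) - (b - c)‖ := by rw [sub_sub_sub_cancel_right]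
    _ ≤ C₁ * M + C₂ * M := (norm_sub_le _ _).trans (add_le_add h₁ h₂)
    _ ≤ (|C₁| + |C₂|) * M := by
      rw [← add_mul]
      exact mul_le_mul_of_nonneg_right (add_le_add (le_abs_self _) (le_abs_self _)) hM
    _ ≤ _ := by
      rw [mul_assoc]
      exact mul_le_mul_of_nonneg_left h₃ (by positivity)

/-- Near `w`, `φ` and `s` differ from one and the same Taylor polynomial by `O(max(|Re|^m,
|Im|^n))`, which is `O(|p + q|)` on `σ(Θ(N))`. -/
theorem IsInFN.exists_bound_nhds_of_mem {φ : D.MN} (hφ : D.IsInFN φ)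
    {s : MvPolynomial (Fin 2) ℂ} (hs : D.IsInR (φ - D.polyFun s)) {w : ℂ} (hw : w ∈ D.specTheta)
    (hwZ : w ∈ D.Zreal) :
    ∃ C : ℝ, ∀ᶠ z in 𝓝 w, z ∈ D.specTheta \ D.Zreal → ‖D.quotientFun φ s z‖ ≤ C := by
  obtain ⟨U, hU, C₁, h₁⟩ := hφ.growth w ⟨hw, hwZ⟩
  obtain ⟨C₂, h₂⟩ := exists_remainder_le s w (D.dp w.re) (D.dq w.im)
  obtain ⟨C₃, hC₃, h₃⟩ := D.exists_max_le w
  refine ⟨(|C₁| + |C₂|) * C₃, ?_⟩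
  filter_upwards [hU, h₂, h₃] with z hzU h₂ h₃ hz
  have hne : z ≠ w := fun h => hz.2 (h ▸ hwZ)
  have h₁ := h₁ z hz.1 hzU hne
  have h₃ := h₃ hz.1
  have hcoeff : ∑ k ∈ Finset.range (D.dp w.re), ∑ l ∈ Finset.range (D.dq w.im),
        D.entry φ (.inl ⟨w, Or.inl hw⟩) k l
          * ((z - w).re : ℂ) ^ k * ((z - w).im : ℂ) ^ l
      = ∑ k ∈ Finset.range (D.dp w.re), ∑ l ∈ Finset.range (D.dq w.im),
          taylorCoeff s ((w.re : ℂ), (w.im : ℂ)) k l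
            * ((z - w).re : ℂ) ^ k * ((z - w).im : ℂ) ^ l :=
    Finset.sum_congr rfl fun k hk => Finset.sum_congr rfl fun l hl => by
      rw [hs.entry_eq_taylorCoeff hw hwZ (Finset.mem_range.1 hk) (Finset.mem_range.1 hl)]
  rw [hcoeff] at h₁
  rw [quotientFun, norm_div, div_le_iff₀ (norm_pos_iff.2 (D.evalReIm_pqPoly_ne_zero hz.1 hz.2)),
    D.entryAt_of_mem _ _ _ hz.1]
  exact norm_le_mul_of_sub_le (le_max_of_le_left (by positivity)) h₁ h₂ h₃

/-- Away from `Z` the numerator is bounded and the denominator is bounded below, because `p + q` is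
continuous and nonzero at `w`. -/
theorem IsInFN.exists_bound_nhds {φ : D.MN} (hφ : D.IsInFN φ) {s : MvPolynomial (Fin 2) ℂ}
    (hs : D.IsInR (φ - D.polyFun s)) {w : ℂ} (hw : w ∈ D.specTheta) :
    ∃ C : ℝ, ∀ᶠ z in 𝓝 w, z ∈ D.specTheta \ D.Zreal → ‖D.quotientFun φ s z‖ ≤ C := by
  by_cases hwZ : w ∈ D.Zreal
  · exact hφ.exists_bound_nhds_of_mem hs hw hwZ
  · obtain ⟨C₁, h₁⟩ := hφ.bounded
    obtain ⟨C₂, hC₂, h₂⟩ := exists_norm_le_nhds_of_continuous (continuous_evalReIm s) w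
    have hpos := norm_pos_iff.2 (D.evalReIm_pqPoly_ne_zero hw hwZ)
    have h₃ := (continuous_evalReIm D.pqPoly).norm.continuousAt.eventually_const_lt
      (half_lt_self hpos)
    refine ⟨(C₁ + C₂) / (‖evalReIm D.pqPoly w‖ / 2), ?_⟩
    filter_upwards [h₂, h₃] with z h₂ h₃ hz
    have h₁ := h₁ ⟨z, hz⟩
    rw [quotientFun, norm_div, D.entryAt_of_mem _ _ _ hz.1]
    exact div_le_div₀ (add_nonneg ((norm_nonneg _).trans h₁) hC₂)
      ((norm_sub_le _ _).trans (add_le_add h₁ h₂)) (by positivity) h₃.le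

theorem IsInFN.exists_bound {φ : D.MN} (hφ : D.IsInFN φ) {s : MvPolynomial (Fin 2) ℂ}
    (hs : D.IsInR (φ - D.polyFun s)) :
    ∃ C : ℝ, ∀ z ∈ D.specTheta \ D.Zreal, ‖D.quotientFun φ s z‖ ≤ C := by
  have h : ∃ C : ℝ, ∀ z ∈ D.specTheta, z ∈ D.specTheta \ D.Zreal →
      ‖D.quotientFun φ s z‖ ≤ C := by
    refine D.isCompact_specTheta.induction_on
      (p := fun S => ∃ C : ℝ, ∀ z ∈ S, z ∈ D.specTheta \ D.Zreal → ‖D.quotientFun φ s z‖ ≤ C)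
      ⟨0, by simp⟩ ?_ ?_ ?_
    · rintro S S' hS ⟨C, hC⟩
      exact ⟨C, fun z hz => hC z (hS hz)⟩
    · rintro S S' ⟨C, hC⟩ ⟨C', hC'⟩
      refine ⟨max C C', fun z hz hzd => ?_⟩
      rcases hz with hz | hz
      · exact (hC z hz hzd).trans (le_max_left _ _)
      · exact (hC' z hz hzd).trans (le_max_right _ _)
    · intro w hw
      obtain ⟨C, hC⟩ := hφ.exists_bound_nhds hs hw
      exact ⟨_, mem_nhdsWithin_of_mem_nhds hC, C, fun z hz => hz⟩
  obtain ⟨C, hC⟩ := h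
  exact ⟨C, fun z hz => hC z hz.1 hz⟩

/-- The conditions determine `g` once `s` is fixed: divide by `p + q` off `Z`, and by its Taylor
coefficients at `(m, 0)` and `(0, n)` on `Z`. These coefficients are nonzero because `m` and `n` are
the exact orders of the zeros. -/
theorem IsInFN.exists_isDecomposition {φ : D.MN} (hφ : D.IsInFN φ) :
    ∃ s g₀ g₁ g₂, D.IsDecomposition φ s g₀ g₁ g₂ := by
  obtain ⟨s, hs⟩ := D.exists_sub_isInR φ
  refine ⟨s, D.quotientFun φ s,
    fun z => (D.entryAt φ (D.dp z.re) 0 z - taylorCoeff s ((z.re : ℂ), (z.im : ℂ)) (D.dp z.re) 0)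
      / taylorCoeff D.pqPoly ((z.re : ℂ), (z.im : ℂ)) (D.dp z.re) 0,
    fun z => (D.entryAt φ 0 (D.dq z.im) z - taylorCoeff s ((z.re : ℂ), (z.im : ℂ)) 0 (D.dq z.im))
      / taylorCoeff D.pqPoly ((z.re : ℂ), (z.im : ℂ)) 0 (D.dq z.im), hs, ?_, hφ.exists_bound hs, ?_⟩
  · have h1 : Measurable fun z : ↥(D.specTheta \ D.Zreal) => D.entryAt φ 0 0 z.1 := by
      convert! hφ.measurable using 2 with z
      exact D.entryAt_of_mem φ 0 0 z.2.1
    exact (h1.sub ((continuous_evalReIm s).measurable.comp measurable_subtype_coe)).div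
      ((continuous_evalReIm D.pqPoly).measurable.comp measurable_subtype_coe)
  · rintro ⟨z, hz⟩ ⟨k, l⟩ hkl
    by_cases hzZ : z ∈ D.Zreal
    · rw [mulEntry, entry_polyFun _ _ hkl, entry_polyFun _ _ hkl, if_neg (not_not.2 hzZ)]
      change _ = taylorCoeff s ((z.re : ℂ), (z.im : ℂ)) k l
        + taylorCoeff D.pqPoly ((z.re : ℂ), (z.im : ℂ)) k l * _
      rcases (D.mem_index_inl (z := ⟨z, Or.inl hz⟩) hzZ).1 hkl with ⟨hk, hl⟩ | ⟨rfl, rfl⟩ | ⟨rfl, rfl⟩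
      · have h1 := hs.entry_eq_taylorCoeff hz hzZ hk hl
        rw [if_neg fun h => hk.ne (Prod.ext_iff.1 h).1, if_neg fun h => hl.ne (Prod.ext_iff.1 h).2,
          mul_zero, add_zero]
        exact h1
      · rw [if_pos rfl, mul_div_cancel₀ _ (D.taylorCoeff_pqPoly_dp_ne_zero hzZ),
          add_sub_cancel, D.entryAt_of_mem _ _ _ hz]
      · rw [if_neg fun h => (D.dp_pos_of_mem hzZ).ne (Prod.ext_iff.1 h).1, if_pos rfl,
          mul_div_cancel₀ _ (D.taylorCoeff_pqPoly_dq_ne_zero hzZ), add_sub_cancel,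
          D.entryAt_of_mem _ _ _ hz]
    · obtain ⟨rfl, rfl⟩ := (D.mem_index_inl_of_notMem (z := ⟨z, Or.inl hz⟩) hzZ).1 hkl
      rw [mulEntry, entry_polyFun _ _ hkl, entry_polyFun _ _ hkl, if_pos hzZ,
        taylorCoeff_zero_zero, taylorCoeff_zero_zero]
      change _ = evalReIm s z + evalReIm D.pqPoly z * _
      rw [quotientFun, mul_div_cancel₀ _ (D.evalReIm_pqPoly_ne_zero hz hzZ), add_sub_cancel,
        D.entryAt_of_mem _ _ _ hz]

theorem IsInFN.exists_isCalculusValue {φ : D.MN} (hφ : D.IsInFN φ) :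
    ∃ Φ : K →L[ℂ] K, D.IsCalculusValue φ Φ := by
  obtain ⟨E, hE⟩ := exists_isSpectralMeasureOf D.isStarNormal_ThetaN
  obtain ⟨s, g₀, g₁, g₂, hdec⟩ := hφ.exists_isDecomposition
  obtain ⟨I, hI⟩ := E.exists_isIntegral hdec.isBoundedBorel
  exact ⟨_, E, s, g₀, g₁, g₂, I, hE, hdec, hI, rfl⟩

end DefinitizableNormal

end

theorem mainTheorem4 {K : Type*} [NormedAddCommGroup K] [InnerProductSpace ℂ K]
    [CompleteSpace K] [KreinSpace K] (D : DefinitizableNormal K) (φ : D.MN)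
    (hφ : D.IsInFN φ) :
    (∃ Φ : K →L[ℂ] K, D.IsCalculusValue φ Φ) ∧
    ∀ Φ : K →L[ℂ] K, D.IsCalculusValue φ Φ →
      spectrum ℂ Φ ⊆ closure ((fun x => D.entry φ x 0 0) '' D.sigmaN) :=
  ⟨hφ.exists_isCalculusValue, fun _ h => D.spectrum_subset_closure h⟩
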